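/- Let $\Omega$ be $\mathbb R^d$ or the flat torus $\mathbb R^d/\mathbb Z^d$. For $T>0$ let $\Gamma=\Gamma_T$ be the space of continuous curves $[0,T]\to\Omega$ with the topology of uniform convergence. Functions on $\Omega$ are identified with (periodic, in the case of the torus) functions on $\mathbb R^d$. Let $\delta,\lambda>0$, let $\eta:\Omega\to\mathbb R$ be the interaction kernel and $\Psi:\Omega\to\mathbb R$ the final cost. For $\gamma,\omega\in\Gamma$ put $$K(\gamma)=\tfrac12\int_0^T|\gamma'|^2dt,\qquad V(\gamma,\omega)=\tfrac12\int_0^T|\gamma'-\omega'|^2\,\eta(\gamma-\omega)\,dt,$$ with value $+\infty$ if $\gamma\notin H^1$, respectively $\gamma-\omega\notin H^1$, and for a probability measure $Q$ on $\Gamma$ put $$F(\gamma,Q)=\delta K(\gamma)+\Psi(\gamma(T))+\lambda\int_\Gamma V(\gamma,\omega)\,dQ(\omega).$$ Given a probability measure $m_0$ on $\Omega$ for which the negative part of $\Psi$ is integrable, $Q$ is an equilibrium if its image under $\gamma\mapsto\gamma(0)$ is $m_0$, $\int_\Gamma F(\gamma,Q)\,dQ(\gamma)<\infty$, and $F(\gamma,Q)=\inf\{F(\omega,Q):\omega\in\Gamma,\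 \omega(0)=\gamma(0)\}$ for every $\gamma$ in the support of $Q$. A curve $\gamma$ is called optimal from $x_0$ if it solves $\min\{F(\gamma,Q):\gamma\in\Gamma,\ \gamma(0)=x_0\}$. With $$a(t,x)=\int_\Gamma\eta(x-\omega(t))\,dQ(\omega),\qquad u(t,x)=\frac1{a(t,x)}\int_\Gamma\omega'(t)\,\eta(x-\omega(t))\,dQ(\omega),$$ $$z_\gamma(t)=\delta\gamma'(t)+\lambda\,a(t,\gamma(t))\,\bigl(\gamma'(t)-u(t,\gamma(t))\bigr),$$ let $\|z\|_\infty\in[0,\infty]$ be the supremum of $\|z_\gamma\|_{L^\infty(0,T)}$ over all curves $\gamma$ that are optimal from their initial point. Assume that $\eta$ is strictly positive, bounded, $C^1$, Lipschitz continuous and semi-convex, with $|\nabla\eta|\le C\eta$ for some constant $C$. Let $c_\Psi\in\mathbb R$. Then there is a function $T_0:[0,\infty)\to(0,\infty)$, depending only on $\Omega,\delta,\lambda,\eta$ (including the lower bound of $D^2\eta$) and $c_\Psi$, such that the following holds for every $\Psi$ that is $C^1$, Lipschitz continuous and semi-convex with $D^2\Psi\ge -c_\Psi I$ (that is, $\Psi+\frac{c_\Psi}2|\cdot|^2$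 is convex on $\mathbb R^d$). 1. For all $T>0$, all $m_0$ as above and every equilibrium $Q$, one has $\|z\|_\infty<\infty$, and if $T<T_0(\|z\|_\infty)$, then for every $x_0\in\Omega$ the problem $$\min\{F(\gamma,Q):\gamma\in\Gamma,\ \gamma(0)=x_0\}$$ has a unique solution. Moreover, in this case $Q$ is an equilibrium in pure strategies: there is a measurable map $S:\Omega\to\Gamma$ such that $S(x)$ is optimal from $x$ for every $x\in\Omega$, and $Q=S_\#m_0$. 2. The condition is met for all short times: there is $T_1>0$, depending only on $\Omega,\delta,\lambda,\eta,\Psi$ and on the function $T_0$, such that for all $0<T<T_1$, all $m_0$ as above and every equilibrium $Q$, one has $T<T_0(\|z\|_\infty)$. -/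

import Mathlib

open scoped NNReal ENNReal Topology
open MeasureTheory

noncomputable section

namespace VelocityMFG

/-! ### The state space: `ℝ^d` or the flat torus `ℝ^d / ℤ^d` -/

/-- The two kinds of state spaces without boundary. -/
inductive DomainKind where
  | wholeSpace
  | torus

/-- The group of periods: `{0}` for the whole space, `ℤ^d` for the torus. -/
def periods (d : ℕ) : DomainKind → AddSubgroup (EuclideanSpace ℝ (Fin d))
  | .wholeSpace => ⊥
  | .torus =>
    { carrier := {x | ∀ i, ∃ n : ℤ, x i = n}
      zero_mem' := fun _ => ⟨0, by simp⟩
      add_mem' := fun {x y} hx hy i => by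
        obtain ⟨m, hm⟩ := hx i
        obtain ⟨n, hn⟩ := hy i
        exact ⟨m + n, by simp [hm, hn]⟩
      neg_mem' := fun {x} hx i => by
        obtain ⟨m, hm⟩ := hx i
        exact ⟨-m, by simp [hm]⟩ }

/-- The state space `Ω`: the quotient of `ℝ^d` by the periods, i.e. `ℝ^d` itself or the torus
`ℝ^d / ℤ^d`, with the quotient topology and the Borel structure. -/
abbrev Domain (d : ℕ) (k : DomainKind) : Type :=
  EuclideanSpace ℝ (Fin d) ⧸ periods d k

variable {d : ℕ} {k : DomainKind} {T : ℝ≥0}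

/-- A function on `Ω` read as a (periodic) function on `ℝ^d`. -/
def lift (f : Domain d k → ℝ) : EuclideanSpace ℝ (Fin d) → ℝ :=
  fun x => f (x : Domain d k)

/-- `D²f ≥ -c` in the sense of semi-convexity: `f + (c/2)|·|²` is convex. -/
def SemiconvexWith (c : ℝ) (f : EuclideanSpace ℝ (Fin d) → ℝ) : Prop :=
  ConvexOn ℝ Set.univ fun x => f x + c / 2 * ‖x‖ ^ 2

/-! ### Curves -/

/-- The space `Γ` of continuous curves `[0,T] → Ω` with the topology of uniform convergence
(the compact-open topology, as `[0,T]` is compact). -/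
abbrev Curve (d : ℕ) (k : DomainKind) (T : ℝ≥0) : Type :=
  C(Set.Icc (0 : ℝ) (T : ℝ), Domain d k)

instance instMeasurableSpaceCurve : MeasurableSpace (Curve d k T) := borel _

instance instBorelSpaceCurve : BorelSpace (Curve d k T) := ⟨rfl⟩

/-- The point `γ(t)` for `t ∈ [0,T]`; outside `[0,T]` the curve is extended by its end points. -/
def Curve.pos (γ : Curve d k T) (t : ℝ) : Domain d k :=
  γ (Set.projIcc (0 : ℝ) (T : ℝ) T.2 t)

/-- Lebesgue measure on `[0,T]`. -/
def timeMeasure (T : ℝ≥0) : Measure ℝ :=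
  volume.restrict (Set.Icc (0 : ℝ) (T : ℝ))

/-- `γ` is differentiable at time `t` with derivative `v`: some representative of `γ` in `ℝ^d`
near time `t` has derivative `v` at `t`. -/
def HasVelocityAt (γ : Curve d k T) (t : ℝ) (v : EuclideanSpace ℝ (Fin d)) : Prop :=
  ∃ c : ℝ → EuclideanSpace ℝ (Fin d),
    (∀ᶠ s in 𝓝 t, (c s : Domain d k) = Curve.pos γ s) ∧ HasDerivAt c v t

open Classical in
/-- The derivative `γ'(t)` (`0` at times where `γ` is not differentiable). -/
def velocity (γ : Curve d k T) (t : ℝ) : EuclideanSpace ℝ (Fin d) :=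
  if h : ∃ v, HasVelocityAt γ t v then h.choose else 0

/-- `γ ∈ H¹`: the curve `γ` is the primitive of a square integrable velocity. -/
def IsH1 (γ : Curve d k T) : Prop :=
  ∃ v : ℝ → EuclideanSpace ℝ (Fin d), MemLp v 2 (timeMeasure T) ∧
    ∀ t ∈ Set.Icc (0 : ℝ) (T : ℝ),
      Curve.pos γ t = Curve.pos γ 0 + ((∫ s in (0 : ℝ)..t, v s : EuclideanSpace ℝ (Fin d)) :
        Domain d k)

/-! ### Costs -/

open Classical in
/-- The kinetic energy `K(γ) = ½ ∫₀ᵀ |γ'|² dt`, `+∞` outside `H¹`. -/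
def kineticEnergy (γ : Curve d k T) : ℝ≥0∞ :=
  if IsH1 γ then (1 / 2) * ∫⁻ t, ‖velocity γ t‖ₑ ^ 2 ∂timeMeasure T else ⊤

open Classical in
/-- The interaction `V(γ,ω) = ½ ∫₀ᵀ |γ' - ω'|² η(γ - ω) dt`, `+∞` if `γ - ω ∉ H¹`. -/
def interaction (η : Domain d k → ℝ) (γ ω : Curve d k T) : ℝ≥0∞ :=
  if IsH1 (γ - ω) then
    (1 / 2) * ∫⁻ t, ‖velocity (γ - ω) t‖ₑ ^ 2 *
      ENNReal.ofReal (η (Curve.pos γ t - Curve.pos ω t)) ∂timeMeasure T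
  else ⊤

/-- The total cost `F(γ,Q) = δ K(γ) + Ψ(γ(T)) + lam ∫ V(γ,ω) dQ(ω)`. -/
def cost (δ lam : ℝ) (η Ψ : Domain d k → ℝ) (Q : Measure (Curve d k T)) (γ : Curve d k T) :
    EReal :=
  ((ENNReal.ofReal δ * kineticEnergy γ + ENNReal.ofReal lam * ∫⁻ ω, interaction η γ ω ∂Q :
    ℝ≥0∞) : EReal) + ((Ψ (Curve.pos γ T) : ℝ) : EReal)

/-- `γ` solves `min {F(γ,Q) : γ(0) = x₀}`. -/
def IsOptimalFrom (δ lam : ℝ) (η Ψ : Domain d k → ℝ) (Q : Measure (Curve d k T))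
    (x₀ : Domain d k) (γ : Curve d k T) : Prop :=
  Curve.pos γ 0 = x₀ ∧
    ∀ ω : Curve d k T, Curve.pos ω 0 = x₀ → cost δ lam η Ψ Q γ ≤ cost δ lam η Ψ Q ω

/-- `Q` is an equilibrium of the game with data `Ω, Ψ, δ, η, lam, m₀`. The condition `finite_cost`
says that the positive part of `F(·,Q)` is `Q`-integrable, i.e. `∫ F(γ,Q) dQ(γ) < ∞`. -/
structure IsEquilibrium (δ lam : ℝ) (η Ψ : Domain d k → ℝ) (m₀ : Measure (Domain d k))
    (Q : Measure (Curve d k T)) : Prop where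
  initial : Q.map (fun γ => Curve.pos γ 0) = m₀
  finite_cost : ∫⁻ γ, (cost δ lam η Ψ Q γ).toENNReal ∂Q < ⊤
  optimal : ∀ γ ∈ Q.support, cost δ lam η Ψ Q γ =
    ⨅ (ω : Curve d k T) (_ : Curve.pos ω 0 = Curve.pos γ 0), cost δ lam η Ψ Q ω

/-! ### Macroscopic quantities -/

/-- `a(t,x) = ∫ η(x - ω(t)) dQ(ω)`. -/
def localMass (η : Domain d k → ℝ) (Q : Measure (Curve d k T)) (t : ℝ) (x : Domain d k) : ℝ :=
  ∫ ω, η (x - Curve.pos ω t) ∂Q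

/-- `u(t,x) = a(t,x)⁻¹ ∫ η(x - ω(t)) ω'(t) dQ(ω)`. -/
def meanVelocity (η : Domain d k → ℝ) (Q : Measure (Curve d k T)) (t : ℝ) (x : Domain d k) :
    EuclideanSpace ℝ (Fin d) :=
  (localMass η Q t x)⁻¹ • ∫ ω, η (x - Curve.pos ω t) • velocity ω t ∂Q

/-- The momentum `z_γ(t) = δ γ'(t) + lam a(t,γ(t)) (γ'(t) - u(t,γ(t)))`, for a.e. `t`. -/
def momentum (δ lam : ℝ) (η : Domain d k → ℝ) (Q : Measure (Curve d k T)) (γ : Curve d k T)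
    (t : ℝ) : EuclideanSpace ℝ (Fin d) :=
  δ • velocity γ t + (lam * localMass η Q t (Curve.pos γ t)) •
    (velocity γ t - meanVelocity η Q t (Curve.pos γ t))

/-- `‖z‖_∞`: the supremum of `‖z_γ‖_{L^∞(0,T)}` over all curves `γ` which are optimal for
`F(·,Q)` among the curves with the same initial point. -/
def momentumSup (δ lam : ℝ) (η Ψ : Domain d k → ℝ) (Q : Measure (Curve d k T)) : ℝ≥0∞ :=
  ⨆ (γ : Curve d k T) (_ : IsOptimalFrom δ lam η Ψ Q (Curve.pos γ 0) γ),
    eLpNorm (momentum δ lam η Q γ) ⊤ (timeMeasure T)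

/-- `Q` is in pure strategies: for a measurable family `S` of curves, `S x` being optimal among
the curves starting from `x`, all agents starting from `x` follow `S x`, i.e. `Q = S_# m₀`. -/
def IsPureStrategy (δ lam : ℝ) (η Ψ : Domain d k → ℝ) (m₀ : Measure (Domain d k))
    (Q : Measure (Curve d k T)) : Prop :=
  ∃ S : Domain d k → Curve d k T, Measurable S ∧
    (∀ x, IsOptimalFrom δ lam η Ψ Q x (S x)) ∧ Q = m₀.map S

end VelocityMFG

end

/-! ### Lifting curves from the quotient to `ℝ^d` -/

noncomputable section

namespace VelocityMFG

variable {d : ℕ} {k : DomainKind} {T : ℝ≥0}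

/-! ### The state space -/

/-! After lifting to `ℝ^d`, an agent starting from `x` chooses a velocity `v` in `L²(0,T)` and
minimises a functional `J x v` made of the kinetic energy, an interaction with weight `N` and the
final cost. `InteractionData` isolates this problem from the game. Everything rests on three
estimates.

Convexity (`weight_midpoint`, `J_midpoint`). The map `(y, V) ↦ N(y)|V|²` is semi-convex in the
position `y`, at a price proportional to `|V|²`: since `η` is semi-convex and `|∇η| ≤ Cη`, the mixed
term is absorbed by the square of the velocity increment. The loss in a midpoint inequality for `J`
is therefore controlled by the squared sup norm of the difference of the curves, and the gain by the
squared `L²` norm of the difference of the velocities. The former is at most `T` times the latter,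
so for bounded velocities and small `T` the functional is strictly convex (`J_strict_midpoint`). The
same inequality makes minimising sequences converge strongly, because Arzelà–Ascoli makes the loss
vanish (`exists_isMin`).

Momentum (`IsMin.norm_z_le`). A first variation with directions that vanish before time `s` bounds
`|z|` after `s` by the Lipschitz constant of the final cost plus a multiple of the interaction
energy spent after `s`. Only one-sided estimates enter, no Euler–Lagrange equation.

Maximum principle (`ae_norm_le_of_momentum_le`). At a fixed time, `z` is `δ` times the velocity plus
a weighted average of relative velocities. If all momenta are at most `Z`, a contraction argument
bounds all velocities by `Z/δ`.

For part 1, the momenta are finite by comparison with the resting curve, so the velocities are at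
most `‖z‖_∞/δ`. For `T` below `shortTime` the optimal curve is then unique, it depends continuously
on its starting point (`IsMin.integral_sub_sq_le`), and this gives the measurable strategy. For part
2, `momentumBound_short` propagates the bound `2(L+1)` backwards from the final time: the momentum
bound after `s` controls velocities after `s`, hence the interaction energy, hence momenta slightly
earlier. Since the resulting bound on `‖z‖_∞` does not depend on `T` or `Q` and `shortTime` is
antitone, all short times satisfy the condition. -/

theorem eq_zero_of_mem_periods {x : EuclideanSpace ℝ (Fin d)} (hx : x ∈ periods d k)
    (h : ‖x‖ < 1) : x = 0 := by
  cases k with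
  | wholeSpace => simpa [periods] using hx
  | torus =>
    ext i
    obtain ⟨n, hn⟩ := (show ∀ i, ∃ n : ℤ, x i = n from hx) i
    have h1 : |x i| < 1 := lt_of_le_of_lt (by simpa using PiLp.norm_apply_le x i) h
    rw [hn] at h1 ⊢
    have : n = 0 := Int.abs_lt_one_iff.mp (Int.cast_lt (R := ℝ).1 (by simpa using h1))
    simp [this]

theorem periods_discreteTopology : DiscreteTopology (periods d k) := by
  rw [discreteTopology_iff_isOpen_singleton_zero]
  have : ({0} : Set (periods d k)) = Subtype.val ⁻¹' Metric.ball 0 1 := by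
    ext x
    simp only [Set.mem_singleton_iff, Set.mem_preimage, mem_ball_zero_iff]
    exact ⟨fun h => by simp [h], fun h => Subtype.ext (eq_zero_of_mem_periods x.2 h)⟩
  rw [this]
  exact Metric.isOpen_ball.preimage continuous_subtype_val

instance isClosed_periods : IsClosed (periods d k : Set (EuclideanSpace ℝ (Fin d))) :=
  have := periods_discreteTopology (d := d) (k := k)
  AddSubgroup.isClosed_of_discrete

instance borelSpace_domain : BorelSpace (Domain d k) := inferInstance

theorem isCoveringMap_mk : IsCoveringMap ((↑) : EuclideanSpace ℝ (Fin d) → Domain d k) :=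
  ((periods d k).isAddQuotientCoveringMap_of_comm
    (isDiscrete_iff_discreteTopology.2 periods_discreteTopology)).isCoveringMap

theorem continuous_mk : Continuous ((↑) : EuclideanSpace ℝ (Fin d) → Domain d k) :=
  continuous_quot_mk

/-! ### Lifts of curves -/

theorem continuous_pos : Continuous fun p : Curve d k T × ℝ => Curve.pos p.1 p.2 := by
  have : Continuous fun p : Curve d k T × ℝ =>
      (p.1, Set.projIcc (0 : ℝ) (T : ℝ) T.2 p.2) :=
    continuous_fst.prodMk (continuous_projIcc.comp continuous_snd)
  exact ContinuousEval.continuous_eval.comp this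

/-- The curve `γ - γ(0)` on the unit interval, at constant speed. -/
def Curve.unitLoop : C(unitInterval × Curve d k T, Domain d k) where
  toFun p := Curve.pos p.2 (T * p.1) - Curve.pos p.2 0
  continuous_toFun := by
    refine (continuous_pos.comp (g := fun p : Curve d k T × ℝ => Curve.pos p.1 p.2)
      (f := fun p : unitInterval × Curve d k T => (p.2, (T : ℝ) * p.1)) (by fun_prop)).sub
      (continuous_pos.comp (g := fun p : Curve d k T × ℝ => Curve.pos p.1 p.2)
      (f := fun p : unitInterval × Curve d k T => (p.2, (0 : ℝ))) (by fun_prop))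

/-- The lift of `γ - γ(0)` to `ℝ^d` which starts from `0`. -/
def Curve.unitLift (γ : Curve d k T) : C(unitInterval, EuclideanSpace ℝ (Fin d)) :=
  isCoveringMap_mk.liftPath (X := Domain d k)
    ⟨fun s => Curve.unitLoop (s, γ), by fun_prop⟩ 0 (by simp [Curve.unitLoop])

theorem Curve.mk_unitLift (γ : Curve d k T) (s : unitInterval) :
    (Curve.unitLift γ s : Domain d k) = Curve.pos γ (T * s) - Curve.pos γ 0 :=
  congrFun (isCoveringMap_mk.liftPath_lifts (X := Domain d k)
    ⟨fun s => Curve.unitLoop (s, γ), by fun_prop⟩ 0 (by simp [Curve.unitLoop])) s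

theorem Curve.unitLift_zero (γ : Curve d k T) : Curve.unitLift γ 0 = 0 :=
  isCoveringMap_mk.liftPath_zero (X := Domain d k)
    ⟨fun s => Curve.unitLoop (s, γ), by fun_prop⟩ 0 (by simp [Curve.unitLoop])

/-- Each lift is continuous in time and all of them start from `0`, so along a local homeomorphism
they depend continuously on the curve as well. Joint continuity is what later makes the velocity
jointly measurable. -/
theorem continuous_unitLift :
    Continuous fun p : unitInterval × Curve d k T => Curve.unitLift p.2 p.1 := by
  refine isCoveringMap_mk.isLocalHomeomorph.continuous_lift isCoveringMap_mk.isSeparatedMap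
    (Curve.unitLoop (d := d) (k := k) (T := T)) ?_ ?_ ?_
  · ext p
    exact Curve.mk_unitLift p.2 p.1
  · simp only [Curve.unitLift_zero]
    exact continuous_const
  · exact fun γ => (Curve.unitLift γ).continuous

/-- The lift of `γ - γ(0)` to `ℝ^d` which starts from `0`, as a function of time. -/
def Curve.path (γ : Curve d k T) (t : ℝ) : EuclideanSpace ℝ (Fin d) :=
  Curve.unitLift γ (Set.projIcc (0 : ℝ) 1 zero_le_one (t / T))

theorem continuous_path : Continuous fun p : Curve d k T × ℝ => Curve.path p.1 p.2 := by
  have : Continuous fun p : Curve d k T × ℝ =>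
      (Set.projIcc (0 : ℝ) 1 zero_le_one (p.2 / T), p.1) :=
    (continuous_projIcc.comp (continuous_snd.div_const _)).prodMk continuous_fst
  exact continuous_unitLift.comp this

theorem Curve.continuous_path_right (γ : Curve d k T) : Continuous γ.path :=
  continuous_path.comp (Continuous.prodMk_right γ)

theorem Curve.pos_eq_add_path (γ : Curve d k T) (t : ℝ) :
    γ.pos t = γ.pos 0 + (γ.path t : Domain d k) := by
  rw [Curve.path, Curve.mk_unitLift, add_sub_cancel, Curve.pos, Curve.pos]
  refine congrArg γ (Subtype.ext ?_)
  change max (0 : ℝ) (min (T : ℝ) t) = max 0 (min (T : ℝ) (T * max 0 (min 1 (t / T))))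
  have hT : (0 : ℝ) ≤ T := T.2
  rw [mul_max_of_nonneg _ _ hT, mul_min_of_nonneg _ _ hT, mul_zero, mul_one]
  -- For `T = 0` the quotient `t / T` has the default value `0`, and both sides are the only point
  -- of the time interval.
  rcases eq_or_lt_of_le hT with h | h
  · simp [← h]
  · rw [mul_div_cancel₀ _ h.ne', min_eq_right (max_le hT (min_le_left _ _)), max_eq_right (le_max_left _ _)]

theorem Curve.path_eq_of_lift (γ : Curve d k T) {c : ℝ → EuclideanSpace ℝ (Fin d)}
    (hc : ContinuousOn c (Set.Icc 0 T)) (h0 : c 0 = 0)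
    (h : ∀ t ∈ Set.Icc (0 : ℝ) T, γ.pos t = γ.pos 0 + (c t : Domain d k))
    {t : ℝ} (ht : t ∈ Set.Icc (0 : ℝ) T) : γ.path t = c t := by
  have hm : ∀ s : unitInterval, (T : ℝ) * s ∈ Set.Icc (0 : ℝ) T := fun s =>
    ⟨mul_nonneg T.2 s.2.1, mul_le_of_le_one_right T.2 s.2.2⟩
  have key : (fun s : unitInterval => c (T * s)) = Curve.unitLift γ := by
    refine (isCoveringMap_mk.eq_liftPath_iff (X := Domain d k) (by simp [Curve.unitLoop])).2
      ⟨?_, ?_, by simp [h0]⟩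
    · exact hc.comp_continuous (by fun_prop) hm
    · ext s
      simp [Curve.unitLoop, h _ (hm s)]
  rw [Curve.path, ← key]
  rcases eq_or_lt_of_le (show (0 : ℝ) ≤ T from T.2) with h' | h'
  · rw [← h'] at ht
    simp [← h', le_antisymm ht.2 ht.1]
  · have : t / T ∈ Set.Icc (0 : ℝ) 1 := ⟨div_nonneg ht.1 h'.le, (div_le_one h').2 ht.2⟩
    simp only [Set.projIcc_of_mem _ this]
    rw [mul_div_cancel₀ _ h'.ne']

/-- Two representatives of a curve near `t` differ by a period up to a constant. The difference of
their increments is continuous, vanishes at `t` and takes values in a discrete group, so it vanishes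
near `t`. Hence the velocity can be computed with the global lift. -/
theorem hasVelocityAt_iff {γ : Curve d k T} {t : ℝ} {v : EuclideanSpace ℝ (Fin d)} :
    HasVelocityAt γ t v ↔ HasDerivAt γ.path v t := by
  constructor
  · rintro ⟨c, hc, hd⟩
    set g := fun s => (c s - c t) - (γ.path s - γ.path t) with hg
    have hct : (c t : Domain d k) = γ.pos t := hc.self_of_nhds
    have hgc : ContinuousAt g t :=
      (hd.continuousAt.sub continuousAt_const).sub
        (γ.continuous_path_right.continuousAt.sub continuousAt_const)
    have hg0 : ∀ᶠ s in 𝓝 t, ‖g s‖ < 1 := by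
      have := hgc.norm.tendsto
      refine this.eventually_lt_const ?_
      simp [hg]
    have : γ.path =ᶠ[𝓝 t] fun s => c s - c t + γ.path t := by
      filter_upwards [hg0, hc] with s hs hcs
      have hmem : g s ∈ periods d k := by
        rw [← QuotientAddGroup.eq_zero_iff]
        simp only [hg, QuotientAddGroup.mk_sub, hcs, hct, γ.pos_eq_add_path s,
          γ.pos_eq_add_path t]
        abel
      have h0 := eq_zero_of_mem_periods hmem hs
      simp only [hg] at h0
      rw [sub_eq_zero.1 h0]
      abel
    exact ((hd.sub_const _).add_const _).congr_of_eventuallyEq this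
  · intro h
    obtain ⟨x, hx⟩ := QuotientAddGroup.mk_surjective (γ.pos 0)
    refine ⟨fun s => x + γ.path s, .of_forall fun s => ?_, h.const_add x⟩
    rw [γ.pos_eq_add_path s, ← hx]
    rfl

theorem velocity_eq_deriv (γ : Curve d k T) (t : ℝ) : velocity γ t = deriv γ.path t := by
  unfold velocity
  split_ifs with h
  · exact (hasVelocityAt_iff.1 h.choose_spec).deriv.symm
  · rw [deriv_zero_of_not_differentiableAt]
    exact fun hd => h ⟨_, hasVelocityAt_iff.2 hd.hasDerivAt⟩

theorem measurable_velocity :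
    Measurable fun p : Curve d k T × ℝ => velocity p.1 p.2 := by
  simp only [velocity_eq_deriv]
  exact measurable_deriv_with_param (f := fun γ : Curve d k T => γ.path) continuous_path

end VelocityMFG
end

/-! ### Primitives, and the abstract variational problem with its midpoint inequality -/

noncomputable section

namespace VelocityMFG

set_option linter.unusedSectionVars false

/-! ### Primitives of square integrable velocities -/

section Primitive

variable {E : Type*} [NormedAddCommGroup E] [NormedSpace ℝ E] {T : ℝ≥0}

instance isFiniteMeasure_timeMeasure : IsFiniteMeasure (timeMeasure T) := by
  unfold timeMeasure; infer_instance

instance nullSingletonClass_timeMeasure : NullSingletonClass (timeMeasure T) := by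
  unfold timeMeasure; infer_instance

theorem timeMeasure_real_univ : (timeMeasure T).real Set.univ = T := by
  simp [timeMeasure, Measure.real]

theorem ae_mem_timeMeasure : ∀ᵐ t ∂timeMeasure T, t ∈ Set.Icc (0 : ℝ) T :=
  ae_restrict_mem measurableSet_Icc

/-- The primitive `∫₀ᵗ v` of a velocity field which is integrable on `[0,T]`, constant after `T`. -/
def primitive (T : ℝ≥0) (v : ℝ → E) (t : ℝ) : E := ∫ s in (0 : ℝ)..t, v s ∂timeMeasure T

theorem primitive_zero (v : ℝ → E) : primitive T v 0 = 0 := intervalIntegral.integral_same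

theorem primitive_congr {v v' : ℝ → E} (h : v =ᵐ[timeMeasure T] v') :
    primitive T v = primitive T v' := by
  funext t
  refine intervalIntegral.integral_congr_ae ?_
  filter_upwards [h] with s hs _ using hs

theorem primitive_eq {v : ℝ → E} {t : ℝ} (ht : t ∈ Set.Icc (0 : ℝ) T) :
    primitive T v t = ∫ s in (0 : ℝ)..t, v s := by
  rw [primitive, intervalIntegral.integral_of_le ht.1, intervalIntegral.integral_of_le ht.1,
    timeMeasure, Measure.restrict_restrict measurableSet_Ioc]
  congr 2
  exact Set.inter_eq_left.2 fun s hs => ⟨hs.1.le, hs.2.trans ht.2⟩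

theorem memLp_two_integrable {v : ℝ → E} (hv : MemLp v 2 (timeMeasure T)) :
    Integrable v (timeMeasure T) := hv.integrable one_le_two

theorem continuous_primitive {v : ℝ → E} (hv : Integrable v (timeMeasure T)) :
    Continuous (primitive T v) :=
  intervalIntegral.continuous_primitive (fun _ _ => hv.intervalIntegrable) 0

theorem primitive_add {v v' : ℝ → E} (hv : Integrable v (timeMeasure T))
    (hv' : Integrable v' (timeMeasure T)) (t : ℝ) :
    primitive T (v + v') t = primitive T v t + primitive T v' t :=
  intervalIntegral.integral_add hv.intervalIntegrable hv'.intervalIntegrable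

theorem primitive_sub {v v' : ℝ → E} (hv : Integrable v (timeMeasure T))
    (hv' : Integrable v' (timeMeasure T)) (t : ℝ) :
    primitive T (v - v') t = primitive T v t - primitive T v' t :=
  intervalIntegral.integral_sub hv.intervalIntegrable hv'.intervalIntegrable

theorem primitive_smul (c : ℝ) (v : ℝ → E) (t : ℝ) :
    primitive T (c • v) t = c • primitive T v t :=
  intervalIntegral.integral_smul _ _

theorem sq_integral_norm_le {α F : Type*} [MeasurableSpace α] [NormedAddCommGroup F]
    {μ : Measure α} [IsFiniteMeasure μ] {v : α → F} (hv : MemLp v 2 μ) :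
    (∫ s, ‖v s‖ ∂μ) ^ 2 ≤ μ.real Set.univ * ∫ s, ‖v s‖ ^ 2 ∂μ := by
  set I := ∫ s, ‖v s‖ ∂μ
  set K := ∫ s, ‖v s‖ ^ 2 ∂μ
  set m := μ.real Set.univ
  have hm : 0 ≤ m := measureReal_nonneg
  have h1 : Integrable (fun s => ‖v s‖) μ := (hv.integrable one_le_two).norm
  have h2 : Integrable (fun s => ‖v s‖ ^ 2) μ := hv.norm.integrable_sq
  -- Cauchy–Schwarz by integrating `(c - ‖v‖)² ≥ 0`; the best choice is `c = I / m`.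
  have key : ∀ c : ℝ, 2 * c * I ≤ c ^ 2 * m + K := by
    intro c
    have : ∫ s, (2 * c * ‖v s‖) ∂μ ≤ ∫ s, (c ^ 2 + ‖v s‖ ^ 2) ∂μ :=
      integral_mono (h1.const_mul _) ((integrable_const _).add h2)
        fun s => by nlinarith [sq_nonneg (c - ‖v s‖)]
    rw [integral_const_mul, integral_add (integrable_const _) h2, integral_const] at this
    simpa [m, smul_eq_mul, mul_comm] using this
  rcases eq_or_lt_of_le hm with h0 | h0
  · have hμ : μ = 0 := by
      have : μ.real Set.univ = 0 := h0.symm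
      rw [measureReal_eq_zero_iff] at this
      exact Measure.measure_univ_eq_zero.1 this
    have : I = 0 := by simp [I, hμ]
    rw [this, ← h0]; simp
  · have := key (I / m)
    have e1 : 2 * (I / m) * I = 2 * (I ^ 2 / m) := by ring
    have e2 : (I / m) ^ 2 * m = I ^ 2 / m := by field_simp
    rw [e1, e2] at this
    have h3 : I ^ 2 / m ≤ K := by linarith
    rwa [div_le_iff₀ h0, mul_comm] at h3

theorem norm_primitive_le_integral {v : ℝ → E} (hv : Integrable v (timeMeasure T)) (t : ℝ) :
    ‖primitive T v t‖ ≤ ∫ s, ‖v s‖ ∂timeMeasure T :=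
  (intervalIntegral.norm_integral_le_integral_norm_uIoc).trans
    (setIntegral_le_integral hv.norm (.of_forall fun _ => norm_nonneg _))

theorem norm_primitive_sq_le {v : ℝ → E} (hv : MemLp v 2 (timeMeasure T)) (t : ℝ) :
    ‖primitive T v t‖ ^ 2 ≤ T * ∫ s, ‖v s‖ ^ 2 ∂timeMeasure T := by
  have := sq_integral_norm_le hv
  rw [timeMeasure_real_univ] at this
  refine le_trans ?_ this
  gcongr
  exact norm_primitive_le_integral (memLp_two_integrable hv) t

theorem norm_primitive_sub_sq_le {v : ℝ → E} (hv : MemLp v 2 (timeMeasure T)) (s t : ℝ) :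
    ‖primitive T v t - primitive T v s‖ ^ 2 ≤ |t - s| * ∫ r, ‖v r‖ ^ 2 ∂timeMeasure T := by
  have hi := memLp_two_integrable hv
  rw [primitive, primitive, intervalIntegral.integral_interval_sub_left hi.intervalIntegrable
    hi.intervalIntegrable]
  have h1 : ‖∫ r in s..t, v r ∂timeMeasure T‖ ^ 2 ≤
      (∫ r in Set.uIoc s t, ‖v r‖ ∂timeMeasure T) ^ 2 := by
    gcongr
    exact intervalIntegral.norm_integral_le_integral_norm_uIoc
  refine h1.trans ((sq_integral_norm_le (hv.restrict _)).trans ?_)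
  gcongr
  · rw [measureReal_restrict_apply_univ]
    calc (timeMeasure T).real (Set.uIoc s t) ≤ (volume : Measure ℝ).real (Set.uIoc s t) := by
          refine ENNReal.toReal_mono ?_ (Measure.restrict_apply_le _ _)
          simp [Set.uIoc]
      _ = |t - s| := by
          simp [Set.uIoc, Measure.real, max_sub_min_eq_abs]
  · exact .of_forall fun _ => sq_nonneg _
  · exact hv.norm.integrable_sq
  · exact Measure.restrict_le_self

/-- Young's inequality combined with `‖∫v‖² ≤ T ∫‖v‖²`. It lets a fraction of the kinetic energy pay
for the linear growth of the final cost. -/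
theorem mul_norm_primitive_le (L : ℝ) {v : ℝ → E} (hv : MemLp v 2 (timeMeasure T)) (t : ℝ) {ε : ℝ}
    (hε : 0 < ε) : L * ‖primitive T v t‖ ≤
      ε * ∫ s, ‖v s‖ ^ 2 ∂timeMeasure T + L ^ 2 * T / (4 * ε) := by
  have h1 := norm_primitive_sq_le hv t
  set K := ∫ s, ‖v s‖ ^ 2 ∂timeMeasure T
  rcases eq_or_lt_of_le (show (0 : ℝ) ≤ T from T.2) with h | h
  · rw [← h, zero_mul] at h1
    have h0 : ‖primitive T v t‖ = 0 := by nlinarith [norm_nonneg (primitive T v t)]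
    have hK : 0 ≤ K := integral_nonneg fun _ => sq_nonneg _
    rw [h0, ← h]; simp; positivity
  · set n := ‖primitive T v t‖
    have h2 : n ^ 2 / T ≤ K := by rw [div_le_iff₀ h]; linarith
    have h3 : 0 ≤ ε * (n ^ 2 / T) - L * n + L ^ 2 * T / (4 * ε) := by
      have : ε * (n ^ 2 / T) - L * n + L ^ 2 * T / (4 * ε) =
          ε / T * (n - L * T / (2 * ε)) ^ 2 := by field_simp; ring
      rw [this]; positivity
    nlinarith

end Primitive

/-! ### A variational problem with interaction -/

variable {E A : Type*} [NormedAddCommGroup E] [InnerProductSpace ℝ E] [FiniteDimensional ℝ E]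
  [MeasurableSpace E] [BorelSpace E] [MeasurableSpace A] {T : ℝ≥0}

variable (E A T) in
/-- The data of the variational problem of an agent who interacts with the population `(A, P)` with
velocities `w`; the weight of the interaction at a point of `A × [0,T]` and a position in `E` is
`N`. The bounds on the data are part of the structure. -/
structure InteractionData where
  P : Measure A
  isProbabilityMeasure : IsProbabilityMeasure P
  (δ lam M C c L cΨ : ℝ)
  δ_pos : 0 < δ
  lam_pos : 0 < lam
  C_nonneg : 0 ≤ C
  c_nonneg : 0 ≤ c
  L_nonneg : 0 ≤ L
  cΨ_nonneg : 0 ≤ cΨ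
  N : A × ℝ → E → ℝ
  measurable_N : Measurable (Function.uncurry N)
  N_pos : ∀ p y, 0 < N p y
  N_le : ∀ p y, N p y ≤ M
  N_le_exp : ∀ p y y', N p y ≤ Real.exp (C * ‖y - y'‖) * N p y'
  N_semiconvex : ∀ p y h, 2 * N p y - c * ‖h‖ ^ 2 ≤ N p (y + h) + N p (y - h)
  w : A × ℝ → E
  memLp_w : MemLp w 2 (P.prod (timeMeasure T))
  Ψ : E → ℝ
  Ψ_lip : ∀ y y', |Ψ y - Ψ y'| ≤ L * ‖y - y'‖
  Ψ_semiconvex : ∀ y h, 2 * Ψ y - cΨ * ‖h‖ ^ 2 ≤ Ψ (y + h) + Ψ (y - h)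

namespace InteractionData

variable (G : InteractionData E A T)

instance : IsProbabilityMeasure G.P := G.isProbabilityMeasure

/-- The measure `P ⊗ dt` on `A × [0,T]`. -/
def prodMeasure : Measure (A × ℝ) := G.P.prod (timeMeasure T)

instance : IsFiniteMeasure G.prodMeasure := by unfold prodMeasure; infer_instance

/-- Twice the interaction energy of the curve `y` with velocity `u`. -/
def inter (y u : ℝ → E) : ℝ := ∫ p, G.N p (y p.2) * ‖u p.2 - G.w p‖ ^ 2 ∂G.prodMeasure

/-- The cost of the curve which starts from `x` with velocity `v`. -/
def J (x : E) (v : ℝ → E) : ℝ :=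
  G.δ / 2 * ∫ t, ‖v t‖ ^ 2 ∂timeMeasure T +
    G.lam / 2 * G.inter (fun t => x + primitive T v t) v + G.Ψ (x + primitive T v T)

/-- `v` is the velocity of a curve which is optimal among the curves starting from `x`. -/
def IsMin (x : E) (v : ℝ → E) : Prop :=
  MemLp v 2 (timeMeasure T) ∧ ∀ v', MemLp v' 2 (timeMeasure T) → G.J x v ≤ G.J x v'

theorem M_pos : 0 < G.M :=
  have := nonempty_of_isProbabilityMeasure G.P
  (G.N_pos (Classical.arbitrary A, 0) 0).trans_le (G.N_le _ _)

theorem memLp_comp_snd {u : ℝ → E} (hu : MemLp u 2 (timeMeasure T)) :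
    MemLp (fun p : A × ℝ => u p.2) 2 G.prodMeasure := hu.comp_snd G.P

theorem memLp_sub_w {u : ℝ → E} (hu : MemLp u 2 (timeMeasure T)) :
    MemLp (fun p : A × ℝ => u p.2 - G.w p) 2 G.prodMeasure :=
  (G.memLp_comp_snd hu).sub G.memLp_w

theorem measurable_weight {y : ℝ → E} (hy : Measurable y) :
    Measurable fun p : A × ℝ => G.N p (y p.2) :=
  G.measurable_N.comp (measurable_id.prodMk (hy.comp measurable_snd))

theorem integrable_weight_mul {y : ℝ → E} (hy : Measurable y) {f : A × ℝ → ℝ}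
    (hf : Integrable f G.prodMeasure) :
    Integrable (fun p => G.N p (y p.2) * f p) G.prodMeasure := by
  refine hf.bdd_mul (c := G.M) (G.measurable_weight hy).aestronglyMeasurable
    (.of_forall fun p => ?_)
  rw [Real.norm_eq_abs, abs_of_pos (G.N_pos _ _)]
  exact G.N_le _ _

theorem integrable_inter {y u : ℝ → E} (hy : Measurable y) (hu : MemLp u 2 (timeMeasure T)) :
    Integrable (fun p => G.N p (y p.2) * ‖u p.2 - G.w p‖ ^ 2) G.prodMeasure :=
  G.integrable_weight_mul hy (G.memLp_sub_w hu).norm.integrable_sq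

theorem inter_nonneg (y u : ℝ → E) : 0 ≤ G.inter y u :=
  integral_nonneg fun _ => mul_nonneg (G.N_pos _ _).le (sq_nonneg _)

theorem inter_le {y u : ℝ → E} (hy : Measurable y) (hu : MemLp u 2 (timeMeasure T)) :
    G.inter y u ≤ G.M * ∫ p, ‖u p.2 - G.w p‖ ^ 2 ∂G.prodMeasure := by
  rw [← integral_const_mul]
  refine integral_mono (G.integrable_inter hy hu)
    ((G.memLp_sub_w hu).norm.integrable_sq.const_mul _) fun p => ?_
  exact mul_le_mul_of_nonneg_right (G.N_le _ _) (sq_nonneg _)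

theorem inter_le_exp {y y' u : ℝ → E} (hy : Measurable y) (hy' : Measurable y')
    (hu : MemLp u 2 (timeMeasure T)) {r : ℝ} (hr : ∀ t, ‖y t - y' t‖ ≤ r) :
    G.inter y u ≤ Real.exp (G.C * r) * G.inter y' u := by
  rw [inter, inter, ← integral_const_mul]
  refine integral_mono (G.integrable_inter hy hu)
    ((G.integrable_inter hy' hu).const_mul _) fun p => ?_
  simp only [← mul_assoc]
  refine mul_le_mul_of_nonneg_right ((G.N_le_exp _ _ (y' p.2)).trans ?_) (sq_nonneg _)
  refine mul_le_mul_of_nonneg_right ?_ (G.N_pos _ _).le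
  exact Real.exp_le_exp.2 (mul_le_mul_of_nonneg_left (hr _) G.C_nonneg)

theorem measurable_curve {v : ℝ → E} (hv : MemLp v 2 (timeMeasure T)) (x : E) :
    Measurable fun t => x + primitive T v t :=
  (continuous_const.add (continuous_primitive (memLp_two_integrable hv))).measurable

/-! ### The midpoint inequality -/

/-- From `1 - e^{-s} ≤ s`, an increment of `N` is at most `C` times the distance, relative to the
larger value of `N`. Keeping the factor `N(y+h) + N(y-h)` on the right is essential: the mixed term
below must be absorbed by a square that carries this very weight. -/
theorem abs_weight_sub_le (p : A × ℝ) (y h : E) :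
    |G.N p (y + h) - G.N p (y - h)| ≤ (G.N p (y + h) + G.N p (y - h)) * (2 * G.C * ‖h‖) := by
  have key : ∀ y y' : E, G.N p y - G.N p y' ≤ G.N p y * (G.C * ‖y - y'‖) := by
    intro y y'
    have h1 := G.N_le_exp p y y'
    have h2 : G.N p y * Real.exp (-(G.C * ‖y - y'‖)) ≤ G.N p y' := by
      rw [Real.exp_neg, ← div_eq_mul_inv, div_le_iff₀ (Real.exp_pos _), mul_comm]
      exact h1
    have h3 := Real.add_one_le_exp (-(G.C * ‖y - y'‖))
    nlinarith [G.N_pos p y]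
  have e1 : ‖(y + h) - (y - h)‖ = 2 * ‖h‖ := by
    rw [show (y + h) - (y - h) = (2 : ℝ) • h by rw [two_smul]; abel, norm_smul]; simp
  have e2 : ‖(y - h) - (y + h)‖ = 2 * ‖h‖ := by rw [norm_sub_rev, e1]
  have h1 := key (y + h) (y - h)
  have h2 := key (y - h) (y + h)
  rw [e1] at h1
  rw [e2] at h2
  have hn : 0 ≤ G.C * ‖h‖ := mul_nonneg G.C_nonneg (norm_nonneg _)
  have p1 := mul_nonneg (G.N_pos p (y + h)).le hn
  have p2 := mul_nonneg (G.N_pos p (y - h)).le hn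
  rw [abs_le]
  constructor <;> nlinarith

/-- The semi-convexity constant of `(y, V) ↦ N(y) |V|²`. -/
def semiconvexity : ℝ := G.c + 8 * G.M * G.C ^ 2

theorem semiconvexity_nonneg : 0 ≤ G.semiconvexity := by
  have h1 := G.M_pos
  have h2 := G.c_nonneg
  unfold semiconvexity; positivity

/-- With `a, b` the weights at `y ± h`, the right side is `(a+b)(‖V‖² + ‖k‖²) + 2(a-b)⟨V,k⟩`.
Semi-convexity of `N` treats `(a+b)‖V‖²`. The mixed term is at most `(a+b)(‖k‖² + 4C²‖h‖²‖V‖²)`, and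
its first part is cancelled by `(a+b)‖k‖²`; in the second, `a + b ≤ 2M` produces the constant
`8MC²`. -/
theorem weight_midpoint (p : A × ℝ) (y h V k : E) :
    2 * (G.N p y * ‖V‖ ^ 2) - G.semiconvexity * ‖h‖ ^ 2 * ‖V‖ ^ 2 ≤
      G.N p (y + h) * ‖V + k‖ ^ 2 + G.N p (y - h) * ‖V - k‖ ^ 2 := by
  rw [@norm_add_sq_real, @norm_sub_sq_real]
  have h1 := G.abs_weight_sub_le p y h
  have h2 := G.N_semiconvex p y h
  have h3 := abs_real_inner_le_norm V k
  have ha := G.N_pos p (y + h)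
  have hb := G.N_pos p (y - h)
  have ha' := G.N_le p (y + h)
  have hb' := G.N_le p (y - h)
  set a := G.N p (y + h)
  set b := G.N p (y - h)
  set i := inner ℝ V k
  have h4 : |(a - b) * i| ≤ (a + b) * (2 * G.C * ‖h‖) * (‖V‖ * ‖k‖) := by
    rw [abs_mul]
    exact mul_le_mul h1 h3 (abs_nonneg _) ((abs_nonneg _).trans h1)
  have h5 := (abs_le.1 h4).1
  have h6 : (a + b) * (2 * G.C * ‖h‖) * (‖V‖ * ‖k‖) * 2 ≤
      (a + b) * (‖k‖ ^ 2 + 4 * G.C ^ 2 * ‖h‖ ^ 2 * ‖V‖ ^ 2) := by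
    have : 0 ≤ (a + b) * (‖k‖ - 2 * G.C * ‖h‖ * ‖V‖) ^ 2 := by positivity
    nlinarith
  have h7 : (a + b) * (4 * G.C ^ 2 * ‖h‖ ^ 2 * ‖V‖ ^ 2) ≤
      (2 * G.M) * (4 * G.C ^ 2 * ‖h‖ ^ 2 * ‖V‖ ^ 2) := by
    refine mul_le_mul_of_nonneg_right (by linarith) (by positivity)
  have h8 := mul_le_mul_of_nonneg_right h2 (sq_nonneg ‖V‖)
  unfold semiconvexity
  nlinarith

/-- The kinetic part obeys the parallelogram law, which yields the gain `δ∫‖k‖²`. The interaction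
and the final cost lose at most a multiple of the squared displacement. Keeping the bound `r` on it
separate serves two uses: `r` tends to `0` along a minimising sequence, and `r = T∫‖k‖²` for short
times. -/
theorem J_midpoint (x : E) {V k : ℝ → E} (hV : MemLp V 2 (timeMeasure T))
    (hk : MemLp k 2 (timeMeasure T)) {r D : ℝ} (hr : ∀ t, ‖primitive T k t‖ ^ 2 ≤ r)
    (hD : ∫ p, ‖V p.2 - G.w p‖ ^ 2 ∂G.prodMeasure ≤ D) :
    2 * G.J x V + G.δ * ∫ t, ‖k t‖ ^ 2 ∂timeMeasure T -
      (G.lam / 2 * (G.semiconvexity * D) + G.cΨ) * r ≤ G.J x (V + k) + G.J x (V - k) := by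
  have hVi := memLp_two_integrable hV
  have hki := memLp_two_integrable hk
  have hr0 : 0 ≤ r := (sq_nonneg _).trans (hr 0)
  have hkin : ∫ t, ‖(V + k) t‖ ^ 2 ∂timeMeasure T + ∫ t, ‖(V - k) t‖ ^ 2 ∂timeMeasure T =
      2 * ∫ t, ‖V t‖ ^ 2 ∂timeMeasure T + 2 * ∫ t, ‖k t‖ ^ 2 ∂timeMeasure T := by
    rw [← integral_add (hV.add hk).norm.integrable_sq (hV.sub hk).norm.integrable_sq,
      ← integral_const_mul, ← integral_const_mul,
      ← integral_add (hV.norm.integrable_sq.const_mul _) (hk.norm.integrable_sq.const_mul _)]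
    refine integral_congr_ae (.of_forall fun t => ?_)
    simp only [Pi.add_apply, Pi.sub_apply]
    have := parallelogram_law_with_norm ℝ (V t) (k t)
    nlinarith
  have hy := measurable_curve hV x
  have hyp := measurable_curve (hV.add hk) x
  have hym := measurable_curve (hV.sub hk) x
  have hep : ∀ t, x + primitive T (V + k) t = (x + primitive T V t) + primitive T k t := fun t => by
    rw [primitive_add hVi hki, add_assoc]
  have hem : ∀ t, x + primitive T (V - k) t = (x + primitive T V t) - primitive T k t := fun t => by
    rw [primitive_sub hVi hki, add_sub_assoc]
  have hint : 2 * G.inter (fun t => x + primitive T V t) V - G.semiconvexity * r * D ≤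
      G.inter (fun t => x + primitive T (V + k) t) (V + k) +
        G.inter (fun t => x + primitive T (V - k) t) (V - k) := by
    have hc := G.semiconvexity_nonneg
    have hsq := (G.memLp_sub_w hV).norm.integrable_sq
    calc _ ≤ 2 * G.inter (fun t => x + primitive T V t) V - G.semiconvexity * r *
          ∫ p, ‖V p.2 - G.w p‖ ^ 2 ∂G.prodMeasure := by
          have := mul_le_mul_of_nonneg_left hD (mul_nonneg hc hr0)
          linarith
      _ = ∫ p, (2 * (G.N p (x + primitive T V p.2) * ‖V p.2 - G.w p‖ ^ 2) -
            G.semiconvexity * r * ‖V p.2 - G.w p‖ ^ 2) ∂G.prodMeasure := by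
          rw [integral_sub ((G.integrable_inter hy hV).const_mul 2) (hsq.const_mul _),
            integral_const_mul, integral_const_mul]
          rfl
      _ ≤ ∫ p, (G.N p (x + primitive T (V + k) p.2) * ‖(V + k) p.2 - G.w p‖ ^ 2 +
            G.N p (x + primitive T (V - k) p.2) * ‖(V - k) p.2 - G.w p‖ ^ 2) ∂G.prodMeasure := by
          refine integral_mono (((G.integrable_inter hy hV).const_mul 2).sub (hsq.const_mul _))
            ((G.integrable_inter hyp (hV.add hk)).add (G.integrable_inter hym (hV.sub hk)))
            fun p => ?_
          have := G.weight_midpoint p (x + primitive T V p.2) (primitive T k p.2)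
            (V p.2 - G.w p) (k p.2)
          simp only [hep, hem, Pi.add_apply, Pi.sub_apply]
          rw [add_sub_right_comm, sub_right_comm]
          refine le_trans ?_ this
          have := mul_le_mul_of_nonneg_right (mul_le_mul_of_nonneg_left (hr p.2) hc)
            (sq_nonneg ‖V p.2 - G.w p‖)
          linarith
      _ = _ := integral_add (G.integrable_inter hyp (hV.add hk))
            (G.integrable_inter hym (hV.sub hk))
  have hΨ := G.Ψ_semiconvex (x + primitive T V T) (primitive T k T)
  rw [← hep, ← hem] at hΨ
  have hΨ' := mul_le_mul_of_nonneg_left (hr T) G.cΨ_nonneg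
  have hint' := mul_le_mul_of_nonneg_left hint (half_pos G.lam_pos).le
  unfold J
  linear_combination hint' + hΨ + hΨ' + (-G.δ / 2) * hkin

/-- The midpoint inequality for two velocities. -/
theorem J_midpoint' (x : E) {v₀ v₁ : ℝ → E} (h₀ : MemLp v₀ 2 (timeMeasure T))
    (h₁ : MemLp v₁ 2 (timeMeasure T)) {r D : ℝ}
    (hr : ∀ t, ‖primitive T ((1 / 2 : ℝ) • (v₀ - v₁)) t‖ ^ 2 ≤ r)
    (hD : ∫ p, ‖((1 / 2 : ℝ) • (v₀ + v₁)) p.2 - G.w p‖ ^ 2 ∂G.prodMeasure ≤ D) :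
    2 * G.J x ((1 / 2 : ℝ) • (v₀ + v₁)) +
      G.δ * ∫ t, ‖((1 / 2 : ℝ) • (v₀ - v₁)) t‖ ^ 2 ∂timeMeasure T -
      (G.lam / 2 * (G.semiconvexity * D) + G.cΨ) * r ≤ G.J x v₀ + G.J x v₁ := by
  have := G.J_midpoint x ((h₀.add h₁).const_smul (1 / 2 : ℝ))
    ((h₀.sub h₁).const_smul (1 / 2 : ℝ)) hr hD
  have e0 : (1 / 2 : ℝ) • (v₀ + v₁) + (1 / 2 : ℝ) • (v₀ - v₁) = v₀ := by module
  have e1 : (1 / 2 : ℝ) • (v₀ + v₁) - (1 / 2 : ℝ) • (v₀ - v₁) = v₁ := by module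
  rwa [e0, e1] at this

/-! ### Bounds on the cost -/

theorem Ψ_sub_le (x y : E) : G.Ψ x - G.L * ‖y‖ ≤ G.Ψ (x + y) := by
  have := (abs_le.1 (G.Ψ_lip x (x + y))).2
  rw [show x - (x + y) = -y by abel, norm_neg] at this
  linarith

theorem J_lower_bound (x : E) {v : ℝ → E} (hv : MemLp v 2 (timeMeasure T)) :
    G.Ψ x + G.δ / 4 * ∫ s, ‖v s‖ ^ 2 ∂timeMeasure T +
      G.lam / 2 * G.inter (fun t => x + primitive T v t) v - G.L ^ 2 * T / G.δ ≤ G.J x v := by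
  -- With `ε = δ/4`, half of the kinetic term `δ/2 ∫‖v‖²` is spent on the final cost.
  have h1 := mul_norm_primitive_le G.L hv T (ε := G.δ / 4) (by linarith [G.δ_pos])
  have h2 := G.Ψ_sub_le x (primitive T v T)
  rw [show 4 * (G.δ / 4) = G.δ by ring] at h1
  unfold J
  linarith

theorem J_zero_le (x : E) :
    G.J x 0 ≤ G.Ψ x + G.lam / 2 * (G.M * ∫ p, ‖G.w p‖ ^ 2 ∂G.prodMeasure) := by
  have h0 : MemLp (0 : ℝ → E) 2 (timeMeasure T) := MemLp.zero
  have h1 := G.inter_le (measurable_curve h0 x) h0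
  have h2 : primitive T (0 : ℝ → E) T = 0 := by simp [primitive]
  have h3 := mul_le_mul_of_nonneg_left h1 (half_pos G.lam_pos).le
  simp only [Pi.zero_apply, zero_sub, norm_neg] at h3
  unfold J
  rw [h2]
  simp only [Pi.zero_apply, norm_zero, add_zero]
  norm_num
  linarith

end InteractionData
end VelocityMFG
end

/-! ### Existence of minimisers by compactness and strong convergence -/

noncomputable section

namespace VelocityMFG

set_option linter.unusedSectionVars false

/-! ### Compactness of primitives -/

section Compactness

variable {E : Type*} [NormedAddCommGroup E] [InnerProductSpace ℝ E] {T : ℝ≥0}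

theorem primitive_clamp {v : ℝ → E} (hv : Integrable v (timeMeasure T)) (t : ℝ) :
    primitive T v (max 0 (min (T : ℝ) t)) = primitive T v t := by
  rw [← sub_eq_zero, primitive, primitive,
    intervalIntegral.integral_interval_sub_left hv.intervalIntegrable hv.intervalIntegrable,
    intervalIntegral.intervalIntegral_eq_integral_uIoc]
  suffices h : (timeMeasure T) (Set.uIoc t (max 0 (min (T : ℝ) t))) = 0 by
    rw [Measure.restrict_eq_zero.2 h]; simp
  rw [timeMeasure, Measure.restrict_apply measurableSet_uIoc]
  -- Outside `[0,T]` there is no mass. The half-open interval between `t` and its clamp meets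
  -- `[0,T]` at most at `0`, which happens when `t < 0`.
  refine measure_mono_null (t := {0}) (fun s hs => ?_) (by simp)
  obtain ⟨h1, h2⟩ := hs
  rw [Set.mem_uIoc] at h1
  have hT : (0 : ℝ) ≤ T := T.2
  simp only [Set.mem_Icc, Set.mem_singleton_iff] at *
  rcases le_total t 0 with h | h
  · rw [min_eq_right (h.trans hT), max_eq_left h] at h1
    rcases h1 with h1 | h1
    · linarith
    · linarith
  · rcases le_total t T with h' | h'
    · rw [min_eq_right h', max_eq_right h] at h1
      rcases h1 with h1 | h1 <;> linarith
    · rw [min_eq_left h', max_eq_right hT] at h1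
      rcases h1 with h1 | h1
      · linarith
      · linarith

/-- Bounded energy makes the primitives uniformly bounded and uniformly Hölder of exponent `1/2`, so
Arzelà–Ascoli applies. -/
theorem exists_subseq_primitive_cauchy [FiniteDimensional ℝ E] {v : ℕ → ℝ → E} {R : ℝ}
    (hv : ∀ n, MemLp (v n) 2 (timeMeasure T)) (hR : ∀ n, ∫ t, ‖v n t‖ ^ 2 ∂timeMeasure T ≤ R) :
    ∃ φ : ℕ → ℕ, StrictMono φ ∧ ∀ ε > 0, ∃ n₀, ∀ i ≥ n₀, ∀ j ≥ n₀, ∀ t,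
      ‖primitive T (v (φ i)) t - primitive T (v (φ j)) t‖ ≤ ε := by
  have hR0 : 0 ≤ R := le_trans (integral_nonneg fun _ => sq_nonneg _) (hR 0)
  let f : ℕ → BoundedContinuousFunction (Set.Icc (0 : ℝ) T) E := fun n =>
    BoundedContinuousFunction.mkOfCompact ⟨fun t => primitive T (v n) t,
      (continuous_primitive (memLp_two_integrable (hv n))).comp continuous_subtype_val⟩
  have hf : ∀ n t, f n t = primitive T (v n) t := fun n t => rfl
  have hmod : ∀ (x y : Set.Icc (0 : ℝ) T) (n : ℕ), dist (f n x) (f n y) ≤ √(dist x y * R) := by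
    intro x y n
    refine Real.le_sqrt_of_sq_le ?_
    rw [hf, hf, dist_eq_norm]
    refine (norm_primitive_sub_sq_le (hv n) y x).trans ?_
    exact mul_le_mul_of_nonneg_left (hR n) (abs_nonneg _)
  have heq : Equicontinuous fun (g : Set.range f) => (g.1 : Set.Icc (0 : ℝ) T → E) := by
    refine Metric.equicontinuous_of_continuity_modulus (fun s => √(s * R)) ?_ _ ?_
    · have : Continuous fun s : ℝ => √(s * R) := by fun_prop
      simpa using this.tendsto 0
    · rintro x y ⟨_, n, rfl⟩
      exact hmod x y n
  have hcomp := BoundedContinuousFunction.arzela_ascoli (Metric.closedBall (0 : E) √(T * R))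
    (isCompact_closedBall _ _) (Set.range f) (by
      rintro _ x ⟨n, rfl⟩
      rw [mem_closedBall_zero_iff]
      refine Real.le_sqrt_of_sq_le ((norm_primitive_sq_le (hv n) x).trans ?_)
      exact mul_le_mul_of_nonneg_left (hR n) T.2) heq
  obtain ⟨g, -, φ, hφ, hlim⟩ := hcomp.tendsto_subseq (x := f)
    fun n => subset_closure (Set.mem_range_self n)
  refine ⟨φ, hφ, fun ε hε => ?_⟩
  obtain ⟨n₀, hn₀⟩ := Metric.cauchySeq_iff.1 hlim.cauchySeq ε hε
  refine ⟨n₀, fun i hi j hj t => ?_⟩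
  rw [← primitive_clamp (memLp_two_integrable (hv (φ i))),
    ← primitive_clamp (memLp_two_integrable (hv (φ j))), ← dist_eq_norm]
  exact ((f (φ i)).dist_coe_le_dist (g := f (φ j)) (Set.projIcc (0 : ℝ) T T.2 t)).trans (hn₀ i hi j hj).le

theorem norm_toLp_sq {α : Type*} [MeasurableSpace α] {μ : Measure α} {v : α → E}
    (hv : MemLp v 2 μ) : ‖hv.toLp v‖ ^ 2 = ∫ t, ‖v t‖ ^ 2 ∂μ := by
  rw [← real_inner_self_eq_norm_sq, L2.inner_def]
  refine integral_congr_ae ?_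
  filter_upwards [hv.coeFn_toLp] with t ht
  rw [ht, real_inner_self_eq_norm_sq]

theorem exists_limit_of_cauchy_sq [CompleteSpace E] {α : Type*} [MeasurableSpace α]
    {μ : Measure α} {v : ℕ → α → E}
    (hv : ∀ n, MemLp (v n) 2 μ)
    (hc : ∀ ε > 0, ∃ n₀, ∀ i ≥ n₀, ∀ j ≥ n₀, ∫ t, ‖v i t - v j t‖ ^ 2 ∂μ < ε) :
    ∃ u, MemLp u 2 μ ∧
      Filter.Tendsto (fun n => ∫ t, ‖u t - v n t‖ ^ 2 ∂μ) Filter.atTop (𝓝 0) := by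
  have hcs : CauchySeq fun n => (hv n).toLp (v n) := by
    refine Metric.cauchySeq_iff.2 fun ε hε => ?_
    obtain ⟨n₀, hn₀⟩ := hc (ε ^ 2) (by positivity)
    refine ⟨n₀, fun i hi j hj => ?_⟩
    rw [dist_eq_norm, ← MemLp.toLp_sub]
    refine lt_of_pow_lt_pow_left₀ 2 hε.le ?_
    rw [norm_toLp_sq]
    exact hn₀ i hi j hj
  obtain ⟨u, hu⟩ := cauchySeq_tendsto_of_complete hcs
  refine ⟨u, Lp.memLp u, ?_⟩
  have h1 : Filter.Tendsto (fun n => ‖u - (hv n).toLp (v n)‖ ^ 2) Filter.atTop (𝓝 0) := by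
    have := (tendsto_const_nhds (x := u)).sub hu
    simpa using this.norm.pow 2
  refine h1.congr fun n => ?_
  have : u - (hv n).toLp (v n) = ((Lp.memLp u).sub (hv n)).toLp _ := by
    rw [MemLp.toLp_sub (Lp.memLp u), Lp.toLp_coeFn]
  rw [this, norm_toLp_sq]
  rfl

end Compactness

namespace InteractionData

variable {E A : Type*} [NormedAddCommGroup E] [InnerProductSpace ℝ E] [FiniteDimensional ℝ E]
  [MeasurableSpace E] [BorelSpace E] [MeasurableSpace A] {T : ℝ≥0}

variable (G : InteractionData E A T)

/-! ### Continuity of the cost and existence of optimal curves -/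

theorem norm_sq_le_add {F : Type*} [NormedAddCommGroup F] (a b : F) {s : ℝ} (hs : 0 < s) :
    ‖a‖ ^ 2 ≤ (1 + s) * ‖b‖ ^ 2 + (1 + 1 / s) * ‖a - b‖ ^ 2 := by
  have h1 : ‖a‖ ≤ ‖b‖ + ‖a - b‖ := by simpa using norm_add_le b (a - b)
  have h2 : ‖a‖ ^ 2 ≤ (‖b‖ + ‖a - b‖) ^ 2 := by gcongr
  have h3 : 0 ≤ s * ‖b‖ ^ 2 + 1 / s * ‖a - b‖ ^ 2 - 2 * ‖b‖ * ‖a - b‖ := by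
    have : s * ‖b‖ ^ 2 + 1 / s * ‖a - b‖ ^ 2 - 2 * ‖b‖ * ‖a - b‖ =
      1 / s * (s * ‖b‖ - ‖a - b‖) ^ 2 := by field_simp; ring
    rw [this]; positivity
  nlinarith

theorem integral_prod_norm_sq (u : ℝ → E) :
    ∫ p : A × ℝ, ‖u p.2‖ ^ 2 ∂G.prodMeasure = ∫ t, ‖u t‖ ^ 2 ∂timeMeasure T := by
  have := integral_fun_snd (μ := G.P) (ν := timeMeasure T) fun t => ‖u t‖ ^ 2
  simpa [prodMeasure] using this

theorem integral_sub_w_sq_le {u : ℝ → E} (hu : MemLp u 2 (timeMeasure T)) :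
    ∫ p, ‖u p.2 - G.w p‖ ^ 2 ∂G.prodMeasure ≤
      2 * ∫ t, ‖u t‖ ^ 2 ∂timeMeasure T + 2 * ∫ p, ‖G.w p‖ ^ 2 ∂G.prodMeasure := by
  rw [← G.integral_prod_norm_sq, ← integral_const_mul, ← integral_const_mul, ← integral_add
    ((G.memLp_comp_snd hu).norm.integrable_sq.const_mul _) (G.memLp_w.norm.integrable_sq.const_mul _)]
  refine integral_mono (G.memLp_sub_w hu).norm.integrable_sq
    (((G.memLp_comp_snd hu).norm.integrable_sq.const_mul _).add
      (G.memLp_w.norm.integrable_sq.const_mul _)) fun p => ?_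
  have h := norm_sub_le (u p.2) (G.w p)
  have : ‖u p.2 - G.w p‖ ^ 2 ≤ (‖u p.2‖ + ‖G.w p‖) ^ 2 := by gcongr
  simp only
  nlinarith [sq_nonneg (‖u p.2‖ - ‖G.w p‖)]

theorem integral_half_add_sq_le {u v : ℝ → E} (hu : MemLp u 2 (timeMeasure T))
    (hv : MemLp v 2 (timeMeasure T)) :
    ∫ t, ‖((1 / 2 : ℝ) • (u + v)) t‖ ^ 2 ∂timeMeasure T ≤
      1 / 2 * ∫ t, ‖u t‖ ^ 2 ∂timeMeasure T + 1 / 2 * ∫ t, ‖v t‖ ^ 2 ∂timeMeasure T := by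
  rw [← integral_const_mul, ← integral_const_mul, ← integral_add
    (hu.norm.integrable_sq.const_mul _) (hv.norm.integrable_sq.const_mul _)]
  refine integral_mono ((hu.add hv).const_smul (1 / 2 : ℝ)).norm.integrable_sq
    ((hu.norm.integrable_sq.const_mul _).add (hv.norm.integrable_sq.const_mul _)) fun t => ?_
  simp only [Pi.smul_apply, Pi.add_apply, norm_smul]
  have h := norm_add_le (u t) (v t)
  have : ‖u t + v t‖ ^ 2 ≤ (‖u t‖ + ‖v t‖) ^ 2 := by gcongr
  norm_num
  nlinarith [sq_nonneg (‖u t‖ - ‖v t‖)]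

theorem integral_half_sub_sq (u v : ℝ → E) :
    ∫ t, ‖((1 / 2 : ℝ) • (u - v)) t‖ ^ 2 ∂timeMeasure T =
      1 / 4 * ∫ t, ‖u t - v t‖ ^ 2 ∂timeMeasure T := by
  rw [← integral_const_mul]
  refine integral_congr_ae (.of_forall fun t => ?_)
  simp only [Pi.smul_apply, Pi.sub_apply, norm_smul]
  norm_num
  ring

theorem inter_le_of_near {y y' u u' : ℝ → E} (hy : Measurable y) (hy' : Measurable y')
    (hu : MemLp u 2 (timeMeasure T)) (hu' : MemLp u' 2 (timeMeasure T)) {r s : ℝ}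
    (hr : ∀ t, ‖y t - y' t‖ ≤ r) (hs : 0 < s) :
    G.inter y u ≤ Real.exp (G.C * r) * ((1 + s) * G.inter y' u' +
      (1 + 1 / s) * (G.M * ∫ t, ‖u t - u' t‖ ^ 2 ∂timeMeasure T)) := by
  refine (G.inter_le_exp hy hy' hu hr).trans
    (mul_le_mul_of_nonneg_left ?_ (Real.exp_pos _).le)
  have hd : Integrable (fun p : A × ℝ => ‖u p.2 - u' p.2‖ ^ 2) G.prodMeasure :=
    (G.memLp_comp_snd (hu.sub hu')).norm.integrable_sq
  rw [← G.integral_prod_norm_sq (fun t => u t - u' t), ← integral_const_mul, ← integral_const_mul,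
    inter, inter, ← integral_const_mul, ← integral_add ((G.integrable_inter hy' hu').const_mul _)
      ((hd.const_mul _).const_mul _)]
  refine integral_mono (G.integrable_inter hy' hu)
    (((G.integrable_inter hy' hu').const_mul _).add ((hd.const_mul _).const_mul _)) fun p => ?_
  have h1 := norm_sq_le_add (u p.2 - G.w p) (u' p.2 - G.w p) hs
  rw [sub_sub_sub_cancel_right] at h1
  have h2 := mul_le_mul_of_nonneg_left h1 (G.N_pos p (y' p.2)).le
  have h3 : G.N p (y' p.2) * ‖u p.2 - u' p.2‖ ^ 2 ≤ G.M * ‖u p.2 - u' p.2‖ ^ 2 :=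
    mul_le_mul_of_nonneg_right (G.N_le _ _) (sq_nonneg _)
  have h4 : (0 : ℝ) ≤ 1 + 1 / s := by positivity
  have h5 := mul_le_mul_of_nonneg_left h3 h4
  simp only
  linarith

/-- A quantitative upper semicontinuity. The free parameter `s` comes from `‖a‖² ≤ (1+s)‖b‖² +
(1+1/s)‖a-b‖²`; with `s` fixed, the terms with `1/s` vanish as `u'` tends to `u`, and `s` is sent to
`0` afterwards. -/
theorem J_le_of_near (x : E) {u u' : ℝ → E}
    (hu : MemLp u 2 (timeMeasure T)) (hu' : MemLp u' 2 (timeMeasure T)) {r s K I : ℝ}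
    (hr : ∀ t, ‖primitive T u t - primitive T u' t‖ ≤ r) (hs : 0 < s)
    (hK : ∫ t, ‖u' t‖ ^ 2 ∂timeMeasure T ≤ K) (hI : G.inter (fun t => x + primitive T u' t) u' ≤ I) :
    G.J x u ≤ G.J x u' + (G.δ / 2 * (s * K + (1 + 1 / s) * ∫ t, ‖u t - u' t‖ ^ 2 ∂timeMeasure T) +
      G.lam / 2 * ((Real.exp (G.C * r) * (1 + s) - 1) * I +
        Real.exp (G.C * r) * ((1 + 1 / s) * (G.M * ∫ t, ‖u t - u' t‖ ^ 2 ∂timeMeasure T))) +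
      G.L * r) := by
  have hr0 : 0 ≤ r := (norm_nonneg _).trans (hr 0)
  have hd : Integrable (fun t => ‖u t - u' t‖ ^ 2) (timeMeasure T) :=
    (hu.sub hu').norm.integrable_sq
  have hkin : ∫ t, ‖u t‖ ^ 2 ∂timeMeasure T ≤ (1 + s) * ∫ t, ‖u' t‖ ^ 2 ∂timeMeasure T +
      (1 + 1 / s) * ∫ t, ‖u t - u' t‖ ^ 2 ∂timeMeasure T := by
    rw [← integral_const_mul, ← integral_const_mul, ← integral_add
      (hu'.norm.integrable_sq.const_mul _) (hd.const_mul _)]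
    exact integral_mono hu.norm.integrable_sq ((hu'.norm.integrable_sq.const_mul _).add
      (hd.const_mul _)) fun t => norm_sq_le_add _ _ hs
  have hint := G.inter_le_of_near (measurable_curve hu x) (measurable_curve hu' x) hu hu'
    (r := r) (fun t => by simpa using hr t) hs
  have hΨ := (abs_le.1 (G.Ψ_lip (x + primitive T u T) (x + primitive T u' T))).2
  rw [add_sub_add_left_eq_sub] at hΨ
  have hΨ' := mul_le_mul_of_nonneg_left (hr T) G.L_nonneg
  have h1 := mul_le_mul_of_nonneg_left hkin (half_pos G.δ_pos).le
  have h2 := mul_le_mul_of_nonneg_left hint (half_pos G.lam_pos).le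
  have h3 := mul_le_mul_of_nonneg_left (mul_le_mul_of_nonneg_left hK hs.le) (half_pos G.δ_pos).le
  have h4 : 0 ≤ Real.exp (G.C * r) * (1 + s) - 1 := by
    have := Real.one_le_exp (mul_nonneg G.C_nonneg hr0)
    nlinarith
  have h5 := mul_le_mul_of_nonneg_left (mul_le_mul_of_nonneg_left hI h4) (half_pos G.lam_pos).le
  unfold J
  linarith

theorem bddBelow_J (x : E) : BddBelow (G.J x '' {v | MemLp v 2 (timeMeasure T)}) := by
  refine ⟨G.Ψ x - G.L ^ 2 * T / G.δ, ?_⟩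
  rintro _ ⟨v, hv, rfl⟩
  refine le_trans ?_ (G.J_lower_bound x hv)
  have h1 := G.inter_nonneg (fun t => x + primitive T v t) v
  have h2 : 0 ≤ ∫ s, ‖v s‖ ^ 2 ∂timeMeasure T := integral_nonneg fun _ => sq_nonneg _
  have h3 := G.δ_pos
  have h4 := G.lam_pos
  have : 0 ≤ G.δ / 4 * ∫ s, ‖v s‖ ^ 2 ∂timeMeasure T +
      G.lam / 2 * G.inter (fun t => x + primitive T v t) v := by positivity
  linarith

/-- Weak convergence of velocities is not needed. Along a subsequence of a minimising sequence the
curves are uniformly Cauchy, so the loss in the midpoint inequality is small; as midpoints cost at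
least the infimum, the gain forces the velocities to be Cauchy in `L²`. -/
theorem exists_isMin (x : E) : ∃ v, G.IsMin x v := by
  set S := G.J x '' {v | MemLp v 2 (timeMeasure T)} with hS
  have hne : S.Nonempty := ⟨_, 0, MemLp.zero, rfl⟩
  have hbdd : BddBelow S := G.bddBelow_J x
  set m := sInf S
  have hm : ∀ v, MemLp v 2 (timeMeasure T) → m ≤ G.J x v := fun v hv =>
    csInf_le hbdd ⟨v, hv, rfl⟩
  have hseq : ∀ n : ℕ, ∃ v, MemLp v 2 (timeMeasure T) ∧ G.J x v < m + 1 / ((n : ℝ) + 1) := by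
    intro n
    obtain ⟨_, ⟨v, hv, rfl⟩, h⟩ := exists_lt_of_csInf_lt hne
      (show m < m + 1 / ((n : ℝ) + 1) by linarith [Nat.one_div_pos_of_nat (α := ℝ) (n := n)])
    exact ⟨v, hv, h⟩
  choose v₀ hv₀ hJ₀ using hseq
  have hδ := G.δ_pos
  have hlam := G.lam_pos
  set Kb : ℝ := 4 / G.δ * (m + 1 - G.Ψ x + G.L ^ 2 * T / G.δ) with hKb
  set Ib : ℝ := 2 / G.lam * (m + 1 - G.Ψ x + G.L ^ 2 * T / G.δ) with hIb
  have hbd : ∀ n, ∫ t, ‖v₀ n t‖ ^ 2 ∂timeMeasure T ≤ Kb ∧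
      G.inter (fun t => x + primitive T (v₀ n) t) (v₀ n) ≤ Ib := by
    intro n
    have h1 := G.J_lower_bound x (hv₀ n)
    have h2 := hJ₀ n
    have h3 : 1 / ((n : ℝ) + 1) ≤ 1 := by
      rw [div_le_one (by positivity)]; linarith [Nat.cast_nonneg (α := ℝ) n]
    have h4 := G.inter_nonneg (fun t => x + primitive T (v₀ n) t) (v₀ n)
    have h5 : 0 ≤ ∫ s, ‖v₀ n s‖ ^ 2 ∂timeMeasure T := integral_nonneg fun _ => sq_nonneg _
    have h6 := mul_nonneg (half_pos hlam).le h4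
    have h7 : 0 ≤ G.δ / 4 * ∫ s, ‖v₀ n s‖ ^ 2 ∂timeMeasure T := by positivity
    constructor
    · rw [hKb, div_mul_eq_mul_div, le_div_iff₀ hδ]; linarith
    · rw [hIb, div_mul_eq_mul_div, le_div_iff₀ hlam]; linarith
  obtain ⟨φ, hφ, hunif⟩ := exists_subseq_primitive_cauchy hv₀ fun n => (hbd n).1
  set v : ℕ → ℝ → E := fun n => v₀ (φ n)
  have hv : ∀ n, MemLp (v n) 2 (timeMeasure T) := fun n => hv₀ _
  have hJlim : Filter.Tendsto (fun n => G.J x (v n)) Filter.atTop (𝓝 m) := by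
    have h0 : Filter.Tendsto (fun n => G.J x (v₀ n)) Filter.atTop (𝓝 m) := by
      refine tendsto_of_tendsto_of_tendsto_of_le_of_le tendsto_const_nhds
        (h := fun n : ℕ => m + 1 / ((n : ℝ) + 1)) ?_ (fun n => hm _ (hv₀ n)) (fun n => (hJ₀ n).le)
      simpa using tendsto_one_div_add_atTop_nhds_zero_nat.const_add m
    exact h0.comp hφ.tendsto_atTop
  set W := ∫ p, ‖G.w p‖ ^ 2 ∂G.prodMeasure
  set B := G.lam / 2 * (G.semiconvexity * (2 * Kb + 2 * W)) + G.cΨ with hB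
  have hKb0 : 0 ≤ Kb := le_trans (integral_nonneg fun _ => sq_nonneg _) (hbd 0).1
  have hW0 : 0 ≤ W := integral_nonneg fun _ => sq_nonneg _
  have hB0 : 0 ≤ B := by
    have h1 := G.semiconvexity_nonneg
    have h2 := G.cΨ_nonneg
    positivity
  have hcauchy : ∀ ε > 0, ∃ n₀, ∀ i ≥ n₀, ∀ j ≥ n₀,
      ∫ t, ‖v i t - v j t‖ ^ 2 ∂timeMeasure T < ε := by
    intro ε hε
    -- Both costs are below `m + η` and the loss is at most `η`, so `δ/4 ∫‖vᵢ - vⱼ‖² < 3η`, which is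
    -- less than `δε/4`.
    set η := G.δ * ε / 16
    have hη : 0 < η := by positivity
    obtain ⟨n₁, h₁⟩ := hunif (√(η / (B + 1))) (by positivity)
    obtain ⟨n₂, h₂⟩ := Filter.eventually_atTop.1 (hJlim.eventually_lt_const
      (show m < m + η by linarith))
    refine ⟨max n₁ n₂, fun i hi j hj => ?_⟩
    have hi₂ := h₂ i (le_of_max_le_right hi)
    have hj₂ := h₂ j (le_of_max_le_right hj)
    have hij := h₁ i (le_of_max_le_left hi) j (le_of_max_le_left hj)
    have hmid := hm _ (((hv i).add (hv j)).const_smul (1 / 2 : ℝ))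
    have key := G.J_midpoint' x (hv i) (hv j) (r := η / (B + 1)) (D := 2 * Kb + 2 * W) ?_ ?_
    · rw [integral_half_sub_sq, ← hB] at key
      have h3 : B * (η / (B + 1)) ≤ η := by
        rw [mul_div_assoc', div_le_iff₀ (by linarith)]; nlinarith
      have h4 : G.δ * ∫ t, ‖v i t - v j t‖ ^ 2 ∂timeMeasure T < G.δ * ε := by
        have : η = G.δ * ε / 16 := rfl
        linarith
      exact lt_of_mul_lt_mul_left h4 hδ.le
    · intro t
      rw [primitive_smul, primitive_sub (memLp_two_integrable (hv i)) (memLp_two_integrable (hv j)),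
        norm_smul]
      have h5 : (0 : ℝ) ≤ η / (B + 1) := by positivity
      have h6 := hij t
      have h7 : ‖primitive T (v i) t - primitive T (v j) t‖ ^ 2 ≤ η / (B + 1) := by
        rw [← Real.sq_sqrt h5]; gcongr
      norm_num
      nlinarith [sq_nonneg ‖primitive T (v i) t - primitive T (v j) t‖]
    · refine (G.integral_sub_w_sq_le (((hv i).add (hv j)).const_smul (1 / 2 : ℝ))).trans ?_
      have h5 := integral_half_add_sq_le (hv i) (hv j)
      have h6 := (hbd (φ i)).1
      have h7 := (hbd (φ j)).1
      simp only [v] at h5 ⊢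
      linarith
  obtain ⟨u, hu, hlim⟩ := exists_limit_of_cauchy_sq hv hcauchy
  refine ⟨u, hu, fun v' hv' => le_trans ?_ (hm v' hv')⟩
  set e : ℕ → ℝ := fun n => ∫ t, ‖u t - v n t‖ ^ 2 ∂timeMeasure T with he
  have hIb0 : 0 ≤ Ib := (G.inter_nonneg _ _).trans (hbd 0).2
  -- Passage to the limit in `n` for fixed `s`; only the terms of order `s` survive.
  have hs : ∀ s > 0, G.J x u ≤ m + s * (G.δ / 2 * Kb + G.lam / 2 * Ib) := by
    intro s hs
    have hr0 : Filter.Tendsto (fun n => √(T * e n)) Filter.atTop (𝓝 0) := by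
      have : Continuous fun a : ℝ => √(T * a) := by fun_prop
      simpa [Function.comp_def] using (this.tendsto 0).comp hlim
    have hexp : Filter.Tendsto (fun n => Real.exp (G.C * √(T * e n))) Filter.atTop (𝓝 1) := by
      have : Continuous fun a : ℝ => Real.exp (G.C * a) := by fun_prop
      simpa [Function.comp_def] using (this.tendsto 0).comp hr0
    have hlim' := hJlim.add ((((hlim.const_mul (1 + 1 / s)).const_add (s * Kb)).const_mul
      (G.δ / 2)).add (((((hexp.mul_const (1 + s)).sub_const 1).mul_const Ib).add
        (hexp.mul ((hlim.const_mul G.M).const_mul (1 + 1 / s)))).const_mul (G.lam / 2))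
        |>.add (hr0.const_mul G.L))
    refine (ge_of_tendsto' hlim' fun n => ?_).trans (le_of_eq (by ring))
    refine G.J_le_of_near x hu (hv n) (fun t => ?_) hs (hbd _).1 (hbd _).2
    refine Real.le_sqrt_of_sq_le ?_
    rw [← primitive_sub (memLp_two_integrable hu) (memLp_two_integrable (hv n))]
    exact norm_primitive_sq_le (hu.sub (hv n)) t
  refine le_of_forall_pos_le_add fun ε hε => ?_
  set c := G.δ / 2 * Kb + G.lam / 2 * Ib with hc
  have hc0 : 0 ≤ c := by positivity
  refine (hs (ε / (c + 1)) (by positivity)).trans ?_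
  have : ε / (c + 1) * c ≤ ε := by
    rw [div_mul_eq_mul_div, div_le_iff₀ (by linarith)]; nlinarith
  linarith

end InteractionData
end VelocityMFG
end

/-! ### First variation, uniqueness and stability of minimisers -/

noncomputable section

namespace VelocityMFG

set_option linter.unusedSectionVars false

theorem nonneg_of_hasDerivAt_of_nonneg {g : ℝ → ℝ} {g' : ℝ} (hg : HasDerivAt g g' 0) (h0 : g 0 = 0)
    (h : ∀ ε > 0, 0 ≤ g ε) : 0 ≤ g' := by
  refine ge_of_tendsto hg.tendsto_slope_zero_right ?_
  filter_upwards [self_mem_nhdsWithin] with ε hε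
  have hε' : 0 < ε := hε
  rw [zero_add, h0, sub_zero]
  exact smul_nonneg (inv_nonneg.2 hε'.le) (h ε hε')

theorem MemLp.integrable_real_inner {α E : Type*} [MeasurableSpace α] [NormedAddCommGroup E]
    [InnerProductSpace ℝ E] {μ : Measure α} {u v : α → E} (hu : MemLp u 2 μ) (hv : MemLp v 2 μ) :
    Integrable (fun t => inner ℝ (u t) (v t)) μ := by
  refine Integrable.mono' (hu.norm.integrable_sq.add hv.norm.integrable_sq)
    (hu.aestronglyMeasurable.inner hv.aestronglyMeasurable) (.of_forall fun t => ?_)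
  refine (norm_inner_le_norm _ _).trans ?_
  simp only [Pi.add_apply]
  nlinarith [sq_nonneg (‖u t‖ - ‖v t‖), sq_nonneg (‖u t‖ + ‖v t‖)]

namespace InteractionData

variable {E A : Type*} [NormedAddCommGroup E] [InnerProductSpace ℝ E] [FiniteDimensional ℝ E]
  [MeasurableSpace E] [BorelSpace E] [MeasurableSpace A] {T : ℝ≥0}

variable (G : InteractionData E A T)

/-! ### The first variation and the bound on the momentum -/

/-- The momentum of the curve which starts from `x` with velocity `v`. -/
def z (x : E) (v : ℝ → E) (t : ℝ) : E :=
  G.δ • v t + G.lam • ∫ a, G.N (a, t) (x + primitive T v t) • (v t - G.w (a, t)) ∂G.P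

/-- The interaction energy after time `s`. -/
def interFrom (s : ℝ) (y u : ℝ → E) : ℝ :=
  ∫ p in {p : A × ℝ | s ≤ p.2}, G.N p (y p.2) * ‖u p.2 - G.w p‖ ^ 2 ∂G.prodMeasure

theorem measurableSet_after (s : ℝ) : MeasurableSet {p : A × ℝ | s ≤ p.2} :=
  measurableSet_le measurable_const measurable_snd

theorem interFrom_nonneg (s : ℝ) (y u : ℝ → E) : 0 ≤ G.interFrom s y u :=
  integral_nonneg fun _ => mul_nonneg (G.N_pos _ _).le (sq_nonneg _)

theorem interFrom_le_inter (s : ℝ) {y u : ℝ → E} (hy : Measurable y)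
    (hu : MemLp u 2 (timeMeasure T)) : G.interFrom s y u ≤ G.inter y u :=
  setIntegral_le_integral (G.integrable_inter hy hu)
    (.of_forall fun _ => mul_nonneg (G.N_pos _ _).le (sq_nonneg _))

theorem ae_mem_prodMeasure : ∀ᵐ p ∂G.prodMeasure, p.2 ∈ Set.Icc (0 : ℝ) T :=
  (measurePreserving_snd (μ := G.P) (ν := timeMeasure T)).quasiMeasurePreserving.ae
    ae_mem_timeMeasure

theorem integrable_weight_inner {y u ψ : ℝ → E} (hy : Measurable y)
    (hu : MemLp u 2 (timeMeasure T)) (hψ : MemLp ψ 2 (timeMeasure T)) :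
    Integrable (fun p => G.N p (y p.2) * inner ℝ (u p.2 - G.w p) (ψ p.2)) G.prodMeasure :=
  G.integrable_weight_mul hy (MemLp.integrable_real_inner (G.memLp_sub_w hu) (G.memLp_comp_snd hψ))

/-- The weight is bounded by `e^{Crε}` times its old value, and the position is unchanged before `s`
because `ψ` vanishes there. The factor `e^{Crε} - 1` therefore multiplies only the energy spent
after `s`. -/
theorem inter_variation_le {x : E} {v ψ : ℝ → E} (hv : MemLp v 2 (timeMeasure T))
    (hψ : MemLp ψ 2 (timeMeasure T)) {s : ℝ} (hs : ∀ t < s, ψ t = 0) {r : ℝ}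
    (hr : ∀ t, ‖primitive T ψ t‖ ≤ r) {ε : ℝ} (hε : 0 < ε) :
    G.inter (fun t => x + primitive T (v + ε • ψ) t) (v + ε • ψ) ≤
      G.inter (fun t => x + primitive T v t) v +
      (2 * ε * ∫ p, G.N p (x + primitive T v p.2) * inner ℝ (v p.2 - G.w p) (ψ p.2) ∂G.prodMeasure +
        ε ^ 2 * ∫ p, G.N p (x + primitive T v p.2) * ‖ψ p.2‖ ^ 2 ∂G.prodMeasure) +
      (Real.exp (G.C * r * ε) - 1) * (G.interFrom s (fun t => x + primitive T v t) v +
      (2 * ε * ∫ p in {p : A × ℝ | s ≤ p.2}, G.N p (x + primitive T v p.2) *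
          inner ℝ (v p.2 - G.w p) (ψ p.2) ∂G.prodMeasure +
        ε ^ 2 * ∫ p in {p : A × ℝ | s ≤ p.2}, G.N p (x + primitive T v p.2) *
          ‖ψ p.2‖ ^ 2 ∂G.prodMeasure)) := by
  have hvi := memLp_two_integrable hv
  have hψi := memLp_two_integrable hψ
  have hy := measurable_curve hv x
  have i1 := G.integrable_inter hy hv
  have i2 := G.integrable_weight_inner hy hv hψ
  have i3 := G.integrable_weight_mul hy (G.memLp_comp_snd hψ).norm.integrable_sq
  have i4 : Integrable (fun p => 2 * ε * (G.N p (x + primitive T v p.2) *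
      inner ℝ (v p.2 - G.w p) (ψ p.2)) + ε ^ 2 * (G.N p (x + primitive T v p.2) * ‖ψ p.2‖ ^ 2))
      G.prodMeasure := (i2.const_mul _).add (i3.const_mul _)
  have i5 : Integrable (fun p => G.N p (x + primitive T v p.2) * ‖v p.2 - G.w p‖ ^ 2 +
      (2 * ε * (G.N p (x + primitive T v p.2) * inner ℝ (v p.2 - G.w p) (ψ p.2)) +
        ε ^ 2 * (G.N p (x + primitive T v p.2) * ‖ψ p.2‖ ^ 2))) G.prodMeasure := i1.add i4
  have i6 := (i5.const_mul (Real.exp (G.C * r * ε) - 1)).indicator (measurableSet_after s)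
  have hvψ := hv.add (hψ.const_smul ε)
  have hr0 : 0 ≤ r := (norm_nonneg _).trans (hr 0)
  rw [interFrom, ← integral_const_mul, ← integral_const_mul, ← integral_const_mul,
    ← integral_const_mul, ← integral_add (i2.const_mul _) (i3.const_mul _),
    ← integral_add (i2.const_mul _).integrableOn (i3.const_mul _).integrableOn,
    ← integral_add i1.integrableOn i4.integrableOn,
    inter, inter, ← integral_add i1 i4, ← integral_const_mul,
    ← integral_indicator (measurableSet_after s), ← integral_add i5 i6]
  refine integral_mono_ae (G.integrable_inter (measurable_curve hvψ x) hvψ) (i5.add i6) ?_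
  filter_upwards [G.ae_mem_prodMeasure] with p hp
  have hprim : primitive T (v + ε • ψ) p.2 = primitive T v p.2 + ε • primitive T ψ p.2 := by
    rw [primitive_add hvi (hψi.smul ε), primitive_smul]
  have hsq : ‖(v + ε • ψ) p.2 - G.w p‖ ^ 2 = ‖v p.2 - G.w p‖ ^ 2 +
      (2 * ε * inner ℝ (v p.2 - G.w p) (ψ p.2) + ε ^ 2 * ‖ψ p.2‖ ^ 2) := by
    rw [show (v + ε • ψ) p.2 - G.w p = (v p.2 - G.w p) + ε • ψ p.2 by
      simp only [Pi.add_apply, Pi.smul_apply]; abel, @norm_add_sq_real, inner_smul_right,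
      norm_smul, Real.norm_eq_abs, abs_of_pos hε]
    ring
  by_cases hps : s ≤ p.2
  · rw [Set.indicator_of_mem (show p ∈ {p : A × ℝ | s ≤ p.2} from hps)]
    have h1 := G.N_le_exp p (x + primitive T (v + ε • ψ) p.2) (x + primitive T v p.2)
    have h2 : Real.exp (G.C * ‖x + primitive T (v + ε • ψ) p.2 - (x + primitive T v p.2)‖) ≤
        Real.exp (G.C * r * ε) := by
      refine Real.exp_le_exp.2 ?_
      rw [hprim, mul_assoc]
      refine mul_le_mul_of_nonneg_left ?_ G.C_nonneg
      rw [show x + (primitive T v p.2 + ε • primitive T ψ p.2) - (x + primitive T v p.2) =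
        ε • primitive T ψ p.2 by abel, norm_smul, Real.norm_eq_abs, abs_of_pos hε, mul_comm]
      exact mul_le_mul_of_nonneg_right (hr _) hε.le
    have h3 := h1.trans (mul_le_mul_of_nonneg_right h2 (G.N_pos _ _).le)
    refine (mul_le_mul_of_nonneg_right h3 (sq_nonneg _)).trans (le_of_eq ?_)
    rw [hsq]
    ring
  · rw [Set.indicator_of_notMem (show p ∉ {p : A × ℝ | s ≤ p.2} from hps)]
    have h0 : primitive T ψ p.2 = 0 := by
      rw [primitive, intervalIntegral.integral_of_le hp.1]
      refine setIntegral_eq_zero_of_forall_eq_zero fun t ht => hs t ?_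
      exact ht.2.trans_lt (not_le.1 hps)
    rw [hprim, h0, smul_zero, add_zero, hsq]
    refine le_of_eq ?_
    ring

/-- The increment of the cost in the direction `ψ` is dominated by an explicit smooth function of
`ε` vanishing at `0`. Minimality makes that function nonnegative for `ε > 0`, and the claim is that
its derivative at `0` is nonnegative. -/
theorem IsMin.first_variation {x : E} {v ψ : ℝ → E} (hmin : G.IsMin x v)
    (hψ : MemLp ψ 2 (timeMeasure T)) {s : ℝ} (hs : ∀ t < s, ψ t = 0) :
    0 ≤ G.δ * ∫ t, inner ℝ (v t) (ψ t) ∂timeMeasure T +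
      G.lam * ∫ p, G.N p (x + primitive T v p.2) * inner ℝ (v p.2 - G.w p) (ψ p.2) ∂G.prodMeasure +
      (G.L + G.lam / 2 * G.C * G.interFrom s (fun t => x + primitive T v t) v) *
        ∫ t, ‖ψ t‖ ∂timeMeasure T := by
  obtain ⟨hv, hopt⟩ := hmin
  have hvi := memLp_two_integrable hv
  have hψi := memLp_two_integrable hψ
  set r := ∫ t, ‖ψ t‖ ∂timeMeasure T
  have hr : ∀ t, ‖primitive T ψ t‖ ≤ r := norm_primitive_le_integral hψi
  set A1 := ∫ t, inner ℝ (v t) (ψ t) ∂timeMeasure T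
  set A2 := ∫ t, ‖ψ t‖ ^ 2 ∂timeMeasure T
  set B1 := ∫ p, G.N p (x + primitive T v p.2) * inner ℝ (v p.2 - G.w p) (ψ p.2) ∂G.prodMeasure
  set B2 := ∫ p, G.N p (x + primitive T v p.2) * ‖ψ p.2‖ ^ 2 ∂G.prodMeasure
  set D0 := G.interFrom s (fun t => x + primitive T v t) v
  set D1 := ∫ p in {p : A × ℝ | s ≤ p.2}, G.N p (x + primitive T v p.2) *
    inner ℝ (v p.2 - G.w p) (ψ p.2) ∂G.prodMeasure
  set D2 := ∫ p in {p : A × ℝ | s ≤ p.2}, G.N p (x + primitive T v p.2) *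
    ‖ψ p.2‖ ^ 2 ∂G.prodMeasure
  let g : ℝ → ℝ := fun ε => G.δ / 2 * (2 * ε * A1 + ε ^ 2 * A2) +
    G.lam / 2 * ((2 * ε * B1 + ε ^ 2 * B2) +
      (Real.exp (G.C * r * ε) - 1) * (D0 + (2 * ε * D1 + ε ^ 2 * D2))) + G.L * r * ε
  have hg : HasDerivAt g (G.δ * A1 + G.lam * B1 + (G.L + G.lam / 2 * G.C * D0) * r) 0 := by
    have q : ∀ a b : ℝ, HasDerivAt (fun ε : ℝ => 2 * ε * a + ε ^ 2 * b) (2 * a) 0 := by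
      intro a b
      have h1 := (((hasDerivAt_id (0 : ℝ)).const_mul 2).mul_const a).add
        (((hasDerivAt_id (0 : ℝ)).pow 2).mul_const b)
      exact h1.congr_deriv (by simp)
    have he : HasDerivAt (fun ε : ℝ => Real.exp (G.C * r * ε) - 1) (G.C * r) 0 := by
      have := (((hasDerivAt_id (0 : ℝ)).const_mul (G.C * r)).exp).sub_const 1
      simpa using this
    have h := (((q A1 A2).const_mul (G.δ / 2)).add (((q B1 B2).add
      (he.mul ((q D1 D2).const_add D0))).const_mul (G.lam / 2))).add
      ((hasDerivAt_id (0 : ℝ)).const_mul (G.L * r))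
    convert! h using 1
    simp
    ring
  refine nonneg_of_hasDerivAt_of_nonneg hg (by simp [g]) fun ε hε => ?_
  have hvψ := hv.add (hψ.const_smul ε)
  have h1 := hopt _ hvψ
  have h2 := mul_le_mul_of_nonneg_left (G.inter_variation_le (x := x) hv hψ hs hr hε)
    (half_pos G.lam_pos).le
  have h3 : ∫ t, ‖(v + ε • ψ) t‖ ^ 2 ∂timeMeasure T = ∫ t, ‖v t‖ ^ 2 ∂timeMeasure T +
      (2 * ε * A1 + ε ^ 2 * A2) := by
    have i1 := hv.norm.integrable_sq
    have i2 := MemLp.integrable_real_inner hv hψ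
    have i3 := hψ.norm.integrable_sq
    have i4 : Integrable (fun t => 2 * ε * inner ℝ (v t) (ψ t) + ε ^ 2 * ‖ψ t‖ ^ 2)
      (timeMeasure T) := (i2.const_mul _).add (i3.const_mul _)
    rw [← integral_const_mul, ← integral_const_mul, ← integral_add (i2.const_mul _)
      (i3.const_mul _), ← integral_add i1 i4]
    refine integral_congr_ae (.of_forall fun t => ?_)
    simp only [Pi.add_apply, Pi.smul_apply]
    rw [@norm_add_sq_real, inner_smul_right, norm_smul, Real.norm_eq_abs, abs_of_pos hε]
    ring
  have h4 := (abs_le.1 (G.Ψ_lip (x + primitive T (v + ε • ψ) T) (x + primitive T v T))).2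
  rw [primitive_add hvi (hψi.smul ε), primitive_smul, ← add_assoc x, add_sub_cancel_left,
    norm_smul, Real.norm_eq_abs, abs_of_pos hε] at h4
  have h5 := mul_le_mul_of_nonneg_left (hr T) (mul_nonneg G.L_nonneg hε.le)
  unfold J at h1
  rw [h3, primitive_add hvi (hψi.smul ε), primitive_smul, ← add_assoc x] at h1
  simp only [g]
  linarith

theorem integrable_weight_smul {x : E} {v : ℝ → E} (hv : MemLp v 2 (timeMeasure T)) :
    Integrable (fun p => G.N p (x + primitive T v p.2) • (v p.2 - G.w p)) G.prodMeasure := by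
  refine ((G.memLp_sub_w hv).integrable one_le_two).bdd_smul G.M
    (G.measurable_weight (measurable_curve hv x)).aestronglyMeasurable (.of_forall fun p => ?_)
  rw [Real.norm_eq_abs, abs_of_pos (G.N_pos _ _)]
  exact G.N_le _ _

theorem integrable_z {x : E} {v : ℝ → E} (hv : MemLp v 2 (timeMeasure T)) :
    Integrable (G.z x v) (timeMeasure T) :=
  ((memLp_two_integrable hv).smul G.δ).add
    ((Integrable.integral_prod_right (G.integrable_weight_smul hv)).smul G.lam)

theorem integral_inner_z {x : E} {v ψ : ℝ → E} (hv : MemLp v 2 (timeMeasure T))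
    (hψ : MemLp ψ 2 (timeMeasure T)) :
    ∫ t, inner ℝ (G.z x v t) (ψ t) ∂timeMeasure T =
      G.δ * ∫ t, inner ℝ (v t) (ψ t) ∂timeMeasure T +
      G.lam * ∫ p, G.N p (x + primitive T v p.2) *
        inner ℝ (v p.2 - G.w p) (ψ p.2) ∂G.prodMeasure := by
  have i1 := MemLp.integrable_real_inner hv hψ
  have i2 := G.integrable_weight_inner (measurable_curve hv x) hv hψ
  have i3 : Integrable (fun p => G.N p (x + primitive T v p.2) • (v p.2 - G.w p))
    (G.P.prod (timeMeasure T)) := G.integrable_weight_smul hv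
  have i4 : Integrable (fun t => ∫ a, G.N (a, t) (x + primitive T v t) *
      inner ℝ (v t - G.w (a, t)) (ψ t) ∂G.P) (timeMeasure T) := Integrable.integral_prod_right i2
  rw [prodMeasure, integral_prod_symm _ i2, ← integral_const_mul, ← integral_const_mul,
    ← integral_add (i1.const_mul _) (i4.const_mul _)]
  refine integral_congr_ae ?_
  filter_upwards [i3.prod_left_ae] with t ht
  have e : inner ℝ (∫ a, G.N (a, t) (x + primitive T v t) • (v t - G.w (a, t)) ∂G.P) (ψ t) =
      ∫ a, G.N (a, t) (x + primitive T v t) * inner ℝ (v t - G.w (a, t)) (ψ t) ∂G.P := by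
    rw [real_inner_comm, ← integral_inner ht]
    refine integral_congr_ae (.of_forall fun a => ?_)
    simp only
    rw [inner_smul_right, real_inner_comm]
  simp only [z]
  rw [inner_add_left, real_inner_smul_left, real_inner_smul_left, e]

/-- Duality between `L^∞` and `L¹`: the first variation bounds `-∫⟨z,ψ⟩` by `B∫‖ψ‖`, and it is
tested with the direction opposite to `z` on the set where the bound fails. -/
theorem IsMin.norm_z_le {x : E} {v : ℝ → E} (hmin : G.IsMin x v) (s : ℝ) :
    ∀ᵐ t ∂timeMeasure T, s ≤ t →
      ‖G.z x v t‖ ≤ G.L + G.lam / 2 * G.C * G.interFrom s (fun t => x + primitive T v t) v := by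
  set B := G.L + G.lam / 2 * G.C * G.interFrom s (fun t => x + primitive T v t) v with hB
  have hB0 : 0 ≤ B := by
    have h1 := G.L_nonneg
    have h2 := G.lam_pos
    have h3 := G.C_nonneg
    have h4 := G.interFrom_nonneg s (fun t => x + primitive T v t) v
    positivity
  have hz := G.integrable_z (x := x) hmin.1
  -- A measurable representative is needed for the exceptional set and the test direction to be
  -- measurable.
  set z' := hz.aestronglyMeasurable.mk
  have hz'm : StronglyMeasurable z' := hz.aestronglyMeasurable.stronglyMeasurable_mk
  have hzz : G.z x v =ᵐ[timeMeasure T] z' := hz.aestronglyMeasurable.ae_eq_mk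
  set S : Set ℝ := {t | s ≤ t ∧ B < ‖z' t‖} with hS
  have hSm : MeasurableSet S :=
    (measurableSet_le measurable_const measurable_id).inter
      (measurableSet_lt measurable_const hz'm.measurable.norm)
  set ψ : ℝ → E := S.indicator fun t => -(‖z' t‖⁻¹ • z' t) with hψ
  have hnorm : ∀ t, ‖ψ t‖ = S.indicator 1 t := by
    intro t
    by_cases ht : t ∈ S
    · have : ‖z' t‖ ≠ 0 := (hB0.trans_lt ht.2).ne'
      simp [hψ, ht, norm_smul, this]
    · simp [hψ, ht]
  have hψm : Measurable ψ :=
    ((hz'm.measurable.norm.inv.smul hz'm.measurable).neg).indicator hSm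
  have hψL : MemLp ψ 2 (timeMeasure T) := by
    refine MemLp.of_bound hψm.aestronglyMeasurable 1 (.of_forall fun t => ?_)
    rw [hnorm]
    exact Set.indicator_apply_le' (fun _ => le_rfl) fun _ => zero_le_one
  have hψs : ∀ t < s, ψ t = 0 := fun t ht =>
    Set.indicator_of_notMem (fun h => absurd h.1 (not_le.2 ht)) _
  have key := hmin.first_variation G hψL hψs
  rw [← G.integral_inner_z hmin.1 hψL, ← hB] at key
  have i1 : Integrable (fun t => inner ℝ (G.z x v t) (ψ t)) (timeMeasure T) := by
    refine Integrable.mono' hz.norm (hz.aestronglyMeasurable.inner hψm.aestronglyMeasurable)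
      (.of_forall fun t => ?_)
    refine (norm_inner_le_norm _ _).trans (mul_le_of_le_one_right (norm_nonneg _) ?_)
    rw [hnorm]
    exact Set.indicator_apply_le' (fun _ => le_rfl) fun _ => zero_le_one
  have i2 : Integrable (fun t => ‖ψ t‖) (timeMeasure T) := (memLp_two_integrable hψL).norm
  rw [← integral_const_mul, ← integral_add i1 (i2.const_mul _)] at key
  -- This function equals `‖z‖ - B > 0` on the exceptional set and `0` elsewhere, almost everywhere,
  -- while its integral is nonpositive by the first variation; so the set is null.
  set f : ℝ → ℝ := fun t => -(inner ℝ (G.z x v t) (ψ t) + B * ‖ψ t‖) with hf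
  have hfS : ∀ᵐ t ∂timeMeasure T, f t = S.indicator (fun t => ‖z' t‖ - B) t := by
    filter_upwards [hzz] with t ht
    rw [hf]
    simp only [hnorm, ht]
    by_cases hts : t ∈ S
    · have h1 : ‖z' t‖ ≠ 0 := (hB0.trans_lt hts.2).ne'
      simp only [hψ, hts, Set.indicator_of_mem, Pi.one_apply, inner_neg_right, inner_smul_right,
        real_inner_self_eq_norm_sq]
      field_simp
      ring
    · simp [hψ, hts]
  have hf0 : 0 ≤ᵐ[timeMeasure T] f := by
    filter_upwards [hfS] with t ht
    rw [ht]
    exact Set.indicator_nonneg (fun t ht => sub_nonneg.2 ht.2.le) t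
  have hfi : Integrable f (timeMeasure T) := (i1.add (i2.const_mul _)).neg
  have hint : ∫ t, f t ∂timeMeasure T = 0 := by
    refine le_antisymm ?_ (integral_nonneg_of_ae hf0)
    rw [hf, integral_neg]
    linarith
  filter_upwards [(integral_eq_zero_iff_of_nonneg_ae hf0 hfi).1 hint, hfS, hzz] with t h1 h2 h3 hst
  by_contra hlt
  rw [h3, not_le] at hlt
  have hts : t ∈ S := ⟨hst, hlt⟩
  rw [h1, Set.indicator_of_mem hts] at h2
  simp only [Pi.zero_apply] at h2
  linarith

/-- Comparison with the curve at rest. -/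
theorem IsMin.inter_le {x : E} {v : ℝ → E} (hmin : G.IsMin x v) :
    G.lam / 2 * G.inter (fun t => x + primitive T v t) v ≤
      G.lam / 2 * (G.M * ∫ p, ‖G.w p‖ ^ 2 ∂G.prodMeasure) + G.L ^ 2 * T / G.δ := by
  have h1 := G.J_lower_bound x hmin.1
  have h2 := G.J_zero_le x
  have h3 := hmin.2 0 MemLp.zero
  have h4 : 0 ≤ G.δ / 4 * ∫ s, ‖v s‖ ^ 2 ∂timeMeasure T :=
    mul_nonneg (by linarith [G.δ_pos]) (integral_nonneg fun _ => sq_nonneg _)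
  linarith

theorem prodMeasure_real_univ : G.prodMeasure.real Set.univ = T := by
  rw [prodMeasure, measureReal_def, Measure.prod_apply .univ]
  simp [timeMeasure]

/-- The energy after `s₀` is split at `s₁`: a good bound `R₁` holds later, and only a crude bound
`R` holds on the strip `[s₀, s₁)`, whose short length compensates it. -/
theorem interFrom_le {y u : ℝ → E} (hy : Measurable y) (hu : MemLp u 2 (timeMeasure T))
    {s₀ s₁ R₁ R : ℝ} (hs : s₀ ≤ s₁)
    (hR₁ : ∀ᵐ p ∂G.prodMeasure, s₁ ≤ p.2 → ‖u p.2 - G.w p‖ ≤ R₁)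
    (hR : ∀ᵐ p ∂G.prodMeasure, ‖u p.2 - G.w p‖ ≤ R) :
    G.interFrom s₀ y u ≤ G.M * (R₁ ^ 2 * T + R ^ 2 * (s₁ - s₀)) := by
  have hM := G.M_pos
  set U : Set (A × ℝ) := Set.univ ×ˢ Set.Ico s₀ s₁
  have hU : MeasurableSet U := MeasurableSet.univ.prod measurableSet_Ico
  have hUm : G.prodMeasure.real U ≤ s₁ - s₀ := by
    rw [prodMeasure, measureReal_prod_prod]
    simp only [probReal_univ, one_mul]
    calc (timeMeasure T).real (Set.Ico s₀ s₁) ≤ (volume : Measure ℝ).real (Set.Ico s₀ s₁) :=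
          ENNReal.toReal_mono (by simp) (Measure.restrict_apply_le _ _)
      _ = s₁ - s₀ := by simp [Measure.real, hs]
  rw [interFrom, ← integral_indicator (measurableSet_after s₀)]
  calc _ ≤ ∫ p, (G.M * R₁ ^ 2 + U.indicator (fun _ => G.M * R ^ 2) p) ∂G.prodMeasure := by
        refine integral_mono_ae ((G.integrable_inter hy hu).indicator (measurableSet_after s₀))
          ((integrable_const _).add ((integrable_const _).indicator hU)) ?_
        filter_upwards [hR₁, hR] with p h1 h2
        by_cases hp : s₀ ≤ p.2
        · rw [Set.indicator_of_mem (show p ∈ {p : A × ℝ | s₀ ≤ p.2} from hp)]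
          refine (mul_le_mul_of_nonneg_right (G.N_le p (y p.2)) (sq_nonneg _)).trans ?_
          by_cases hp₁ : s₁ ≤ p.2
          · have h3 : ‖u p.2 - G.w p‖ ^ 2 ≤ R₁ ^ 2 := by gcongr; exact h1 hp₁
            have h4 : 0 ≤ U.indicator (fun _ => G.M * R ^ 2) p :=
              Set.indicator_nonneg (fun _ _ => by positivity) _
            have := mul_le_mul_of_nonneg_left h3 hM.le
            linarith
          · rw [Set.indicator_of_mem (show p ∈ U from ⟨trivial, hp, not_le.1 hp₁⟩)]
            have h3 : ‖u p.2 - G.w p‖ ^ 2 ≤ R ^ 2 := by gcongr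
            have := mul_le_mul_of_nonneg_left h3 hM.le
            have h4 : 0 ≤ G.M * R₁ ^ 2 := by positivity
            linarith
        · rw [Set.indicator_of_notMem (show p ∉ {p : A × ℝ | s₀ ≤ p.2} from hp)]
          exact add_nonneg (by positivity) (Set.indicator_nonneg (fun _ _ => by positivity) _)
    _ = G.M * R₁ ^ 2 * T + G.prodMeasure.real U * (G.M * R ^ 2) := by
        rw [integral_add (integrable_const _) ((integrable_const _).indicator hU), integral_const,
          integral_indicator hU, setIntegral_const, prodMeasure_real_univ, smul_eq_mul, smul_eq_mul]
        ring
    _ ≤ _ := by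
        have h1 : 0 ≤ G.M * R ^ 2 := by positivity
        have := mul_le_mul_of_nonneg_right hUm h1
        linarith

/-! ### Strict convexity and stability for bounded velocities -/

theorem J_strict_midpoint (x : E) {v₀ v₁ : ℝ → E} (h₀ : MemLp v₀ 2 (timeMeasure T))
    (h₁ : MemLp v₁ 2 (timeMeasure T)) {R : ℝ}
    (hR₀ : ∀ᵐ t ∂timeMeasure T, ‖v₀ t‖ ≤ R) (hR₁ : ∀ᵐ t ∂timeMeasure T, ‖v₁ t‖ ≤ R)
    (hRw : ∀ᵐ p ∂G.prodMeasure, ‖G.w p‖ ≤ R)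
    (hT : (G.lam / 2 * (G.semiconvexity * (4 * R ^ 2 * T)) + G.cΨ) * T ≤ G.δ / 2) :
    2 * G.J x ((1 / 2 : ℝ) • (v₀ + v₁)) +
      G.δ / 8 * ∫ t, ‖v₀ t - v₁ t‖ ^ 2 ∂timeMeasure T ≤ G.J x v₀ + G.J x v₁ := by
  have hk := (h₀.sub h₁).const_smul (1 / 2 : ℝ)
  have hV := (h₀.add h₁).const_smul (1 / 2 : ℝ)
  -- The displacement bound is `T∫‖k‖²` with `k = (v₀ - v₁)/2`. The hypothesis on `T` makes the loss
  -- at most half of the gain `δ∫‖k‖²`, and `δ/8 ∫‖v₀ - v₁‖²` remains. Relative velocities are at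
  -- most `2R`, on a space of mass `T`, whence `D = 4R²T`.
  have key := G.J_midpoint' x h₀ h₁ (fun t => norm_primitive_sq_le hk t)
    (D := 4 * R ^ 2 * T) ?_
  · rw [integral_half_sub_sq] at key
    have h2 : 0 ≤ 1 / 4 * ∫ t, ‖v₀ t - v₁ t‖ ^ 2 ∂timeMeasure T :=
      mul_nonneg (by norm_num) (integral_nonneg fun _ => sq_nonneg _)
    have h3 := mul_le_mul_of_nonneg_right hT h2
    linarith
  · calc _ ≤ ∫ _p, 4 * R ^ 2 ∂G.prodMeasure := by
          refine integral_mono_ae (G.memLp_sub_w hV).norm.integrable_sq (integrable_const _) ?_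
          have e0 := (measurePreserving_snd (μ := G.P)
            (ν := timeMeasure T)).quasiMeasurePreserving.ae hR₀
          have e1 := (measurePreserving_snd (μ := G.P)
            (ν := timeMeasure T)).quasiMeasurePreserving.ae hR₁
          filter_upwards [e0, e1, hRw] with p h1 h2 h3
          have h4 : ‖((1 / 2 : ℝ) • (v₀ + v₁)) p.2‖ ≤ R := by
            simp only [Pi.smul_apply, Pi.add_apply, norm_smul]
            have := norm_add_le (v₀ p.2) (v₁ p.2)
            norm_num
            linarith
          have h5 := norm_sub_le (((1 / 2 : ℝ) • (v₀ + v₁)) p.2) (G.w p)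
          calc _ ≤ (2 * R) ^ 2 := by gcongr; linarith
            _ = _ := by ring
      _ = 4 * R ^ 2 * T := by
          rw [integral_const, prodMeasure_real_univ, smul_eq_mul]; ring

theorem IsMin.ae_eq {x : E} {v₀ v₁ : ℝ → E} (h₀ : G.IsMin x v₀) (h₁ : G.IsMin x v₁) {R : ℝ}
    (hR₀ : ∀ᵐ t ∂timeMeasure T, ‖v₀ t‖ ≤ R) (hR₁ : ∀ᵐ t ∂timeMeasure T, ‖v₁ t‖ ≤ R)
    (hRw : ∀ᵐ p ∂G.prodMeasure, ‖G.w p‖ ≤ R)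
    (hT : (G.lam / 2 * (G.semiconvexity * (4 * R ^ 2 * T)) + G.cΨ) * T ≤ G.δ / 2) :
    v₀ =ᵐ[timeMeasure T] v₁ := by
  have key := G.J_strict_midpoint x h₀.1 h₁.1 hR₀ hR₁ hRw hT
  have hm₀ := h₀.2 _ ((h₀.1.add h₁.1).const_smul (1 / 2 : ℝ))
  have hm₁ := h₁.2 _ ((h₀.1.add h₁.1).const_smul (1 / 2 : ℝ))
  have hd : 0 ≤ ∫ t, ‖v₀ t - v₁ t‖ ^ 2 ∂timeMeasure T := integral_nonneg fun _ => sq_nonneg _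
  have h0 : ∫ t, ‖v₀ t - v₁ t‖ ^ 2 ∂timeMeasure T = 0 := by
    have h8 : 0 < G.δ / 8 := by linarith [G.δ_pos]
    have : G.δ / 8 * ∫ t, ‖v₀ t - v₁ t‖ ^ 2 ∂timeMeasure T ≤ 0 := by linarith
    nlinarith
  have := (integral_eq_zero_iff_of_nonneg (fun _ => sq_nonneg _)
    (h₀.1.sub h₁.1).norm.integrable_sq).1 h0
  filter_upwards [this] with t ht
  have h1 : ‖v₀ t - v₁ t‖ ^ 2 = 0 := ht
  exact sub_eq_zero.1 (norm_eq_zero.1 (by simpa using h1))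

theorem J_translate_le (x x' : E) {v : ℝ → E} (hv : MemLp v 2 (timeMeasure T)) :
    G.J x v ≤ G.J x' v + ((Real.exp (G.C * ‖x - x'‖) - 1) *
      (G.lam / 2 * G.inter (fun t => x' + primitive T v t) v) + G.L * ‖x - x'‖) := by
  have h1 := G.inter_le_exp (measurable_curve hv x) (measurable_curve hv x') hv
    (r := ‖x - x'‖) fun t => by rw [add_sub_add_right_eq_sub]
  have h2 := (abs_le.1 (G.Ψ_lip (x + primitive T v T) (x' + primitive T v T))).2
  rw [add_sub_add_right_eq_sub] at h2
  have h3 := mul_le_mul_of_nonneg_left h1 (half_pos G.lam_pos).le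
  unfold J
  linarith

/-- Moving each velocity to the other starting point changes its cost by a small amount. So `v₁` is
almost optimal from `x`, and strict convexity keeps almost optimal velocities near `v₀`. -/
theorem IsMin.integral_sub_sq_le {x x' : E} {v₀ v₁ : ℝ → E} (h₀ : G.IsMin x v₀)
    (h₁ : G.IsMin x' v₁) {R : ℝ}
    (hR₀ : ∀ᵐ t ∂timeMeasure T, ‖v₀ t‖ ≤ R) (hR₁ : ∀ᵐ t ∂timeMeasure T, ‖v₁ t‖ ≤ R)
    (hRw : ∀ᵐ p ∂G.prodMeasure, ‖G.w p‖ ≤ R)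
    (hT : (G.lam / 2 * (G.semiconvexity * (4 * R ^ 2 * T)) + G.cΨ) * T ≤ G.δ / 2) :
    G.δ / 8 * ∫ t, ‖v₀ t - v₁ t‖ ^ 2 ∂timeMeasure T ≤
      2 * ((Real.exp (G.C * ‖x - x'‖) - 1) *
        (G.lam / 2 * (G.M * ∫ p, ‖G.w p‖ ^ 2 ∂G.prodMeasure) + G.L ^ 2 * T / G.δ) +
          G.L * ‖x - x'‖) := by
  have key := G.J_strict_midpoint x h₀.1 h₁.1 hR₀ hR₁ hRw hT
  have hm₀ := h₀.2 _ ((h₀.1.add h₁.1).const_smul (1 / 2 : ℝ))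
  have t1 := G.J_translate_le x x' h₁.1
  have t2 := G.J_translate_le x' x h₀.1
  have hm₁ := h₁.2 _ h₀.1
  rw [norm_sub_rev] at t2
  have he : 0 ≤ Real.exp (G.C * ‖x - x'‖) - 1 := by
    have := Real.one_le_exp (mul_nonneg G.C_nonneg (norm_nonneg (x - x')))
    linarith
  have b0 := mul_le_mul_of_nonneg_left (h₀.inter_le G) he
  have b1 := mul_le_mul_of_nonneg_left (h₁.inter_le G) he
  linarith

end InteractionData
end VelocityMFG
end

/-! ### From momenta to velocities, and curves as primitives -/

noncomputable section

namespace VelocityMFG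

set_option linter.unusedSectionVars false

/-! ### A maximum principle for the velocities -/

section MaximumPrinciple

variable {E A : Type*} [NormedAddCommGroup E] [InnerProductSpace ℝ E] [CompleteSpace E]
  [MeasurableSpace A]
  {P : Measure A} [IsProbabilityMeasure P] {δ lam M Z : ℝ}

theorem norm_mul_le_of_momentum_le (hlam : 0 < lam) {κ : A → ℝ} (hκ : Measurable κ)
    (hκ0 : ∀ b, 0 ≤ κ b) (hκM : ∀ b, κ b ≤ M) {w : A → E} (hw : Integrable w P) {u : E}
    (hu : ‖δ • u + lam • ∫ b, κ b • (u - w b) ∂P‖ ≤ Z) :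
    (δ + lam * ∫ b, κ b ∂P) * ‖u‖ ≤ Z + lam * ∫ b, κ b * ‖w b‖ ∂P := by
  have hb : ∀ᵐ b ∂P, ‖κ b‖ ≤ M := .of_forall fun b => by
    rw [Real.norm_eq_abs, abs_of_nonneg (hκ0 b)]; exact hκM b
  have i1 : Integrable κ P := Integrable.of_bound hκ.aestronglyMeasurable M hb
  have i2 : Integrable (fun b => κ b • w b) P := hw.bdd_smul M hκ.aestronglyMeasurable hb
  have e : ∫ b, κ b • (u - w b) ∂P = (∫ b, κ b ∂P) • u - ∫ b, κ b • w b ∂P := by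
    simp only [smul_sub]
    rw [integral_sub (i1.smul_const u) i2, integral_smul_const]
  rw [e] at hu
  have h1 : (δ + lam * ∫ b, κ b ∂P) • u =
      (δ • u + lam • ((∫ b, κ b ∂P) • u - ∫ b, κ b • w b ∂P)) + lam • ∫ b, κ b • w b ∂P := by
    module
  have h2 : ‖∫ b, κ b • w b ∂P‖ ≤ ∫ b, κ b * ‖w b‖ ∂P := by
    refine (norm_integral_le_integral_norm _).trans (le_of_eq ?_)
    simp only [norm_smul, Real.norm_eq_abs, abs_of_nonneg (hκ0 _)]
  calc (δ + lam * ∫ b, κ b ∂P) * ‖u‖ ≤ ‖(δ + lam * ∫ b, κ b ∂P) • u‖ := by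
        rw [norm_smul]
        exact mul_le_mul_of_nonneg_right (le_abs_self _) (norm_nonneg _)
    _ ≤ Z + lam * ∫ b, κ b * ‖w b‖ ∂P := by
        rw [h1]
        refine (norm_add_le _ _).trans (add_le_add hu ?_)
        rw [norm_smul, Real.norm_eq_abs, abs_of_pos hlam]
        exact mul_le_mul_of_nonneg_left h2 hlam.le

/-- With `a = ∫κ`, the relation gives `(δ + λa)‖u‖ ≤ Z + λa(Z/δ + D)`. The excess over `Z/δ` shrinks
by `λa/(δ + λa)`, which is monotone in `a` and so at most the value for `a = M`. -/
theorem norm_le_of_momentum_le_of_ae_bound (hδ : 0 < δ) (hlam : 0 < lam) {κ : A → ℝ}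
    (hκ : Measurable κ) (hκ0 : ∀ b, 0 ≤ κ b) (hκM : ∀ b, κ b ≤ M) {w : A → E} (hw : Integrable w P)
    {u : E} (hu : ‖δ • u + lam • ∫ b, κ b • (u - w b) ∂P‖ ≤ Z) {D : ℝ} (hD : 0 ≤ D)
    (hwD : ∀ᵐ b ∂P, ‖w b‖ ≤ Z / δ + D) : ‖u‖ ≤ Z / δ + lam * M / (δ + lam * M) * D := by
  have h1 := norm_mul_le_of_momentum_le hlam hκ hκ0 hκM hw hu
  have hb : ∀ᵐ b ∂P, ‖κ b‖ ≤ M := .of_forall fun b => by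
    rw [Real.norm_eq_abs, abs_of_nonneg (hκ0 b)]; exact hκM b
  have i1 : Integrable κ P := Integrable.of_bound hκ.aestronglyMeasurable M hb
  have h2 : ∫ b, κ b * ‖w b‖ ∂P ≤ (∫ b, κ b ∂P) * (Z / δ + D) := by
    rw [← integral_mul_const]
    refine integral_mono_ae (hw.norm.bdd_mul hκ.aestronglyMeasurable hb) (i1.mul_const _) ?_
    filter_upwards [hwD] with b hb'
    exact mul_le_mul_of_nonneg_left hb' (hκ0 b)
  set a := ∫ b, κ b ∂P
  have ha0 : 0 ≤ a := integral_nonneg hκ0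
  have haM : a ≤ M := by
    have : a ≤ ∫ _b, M ∂P := integral_mono i1 (integrable_const _) hκM
    simpa using this
  have hM : 0 ≤ M := ha0.trans haM
  have hda : 0 < δ + lam * a := by positivity
  have h3 : (δ + lam * a) * ‖u‖ ≤ (δ + lam * a) * (Z / δ) + lam * a * D := by
    have h4 : (δ + lam * a) * (Z / δ) = Z + lam * a * (Z / δ) := by field_simp
    have h5 := mul_le_mul_of_nonneg_left h2 hlam.le
    rw [h4]
    linarith
  have h6 : lam * a ≤ (δ + lam * a) * (lam * M / (δ + lam * M)) := by
    rw [mul_div_assoc', le_div_iff₀ (by positivity)]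
    have := mul_le_mul_of_nonneg_left haM hlam.le
    nlinarith
  have h7 := mul_le_mul_of_nonneg_right h6 hD
  have h8 : (δ + lam * a) * ‖u‖ ≤ (δ + lam * a) * (Z / δ + lam * M / (δ + lam * M) * D) := by
    linarith
  exact le_of_mul_le_mul_left h8 hda

/-- Integrability of `w` gives a first crude bound with excess `λM∫‖w‖/δ`; each application of the
previous lemma multiplies the excess by the same `ρ < 1`. No essential boundedness is assumed
beforehand. -/
theorem ae_norm_le_of_momentum_le (hδ : 0 < δ) (hlam : 0 < lam) {κ : A → A → ℝ}
    (hκ : ∀ a, Measurable (κ a)) (hκ0 : ∀ a b, 0 ≤ κ a b) (hκM : ∀ a b, κ a b ≤ M) {w : A → E}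
    (hw : Integrable w P)
    (hz : ∀ᵐ a ∂P, ‖δ • w a + lam • ∫ b, κ a b • (w a - w b) ∂P‖ ≤ Z) :
    ∀ᵐ a ∂P, ‖w a‖ ≤ Z / δ := by
  obtain ⟨a₀⟩ := nonempty_of_isProbabilityMeasure P
  have hM : 0 ≤ M := (hκ0 a₀ a₀).trans (hκM a₀ a₀)
  set I := ∫ b, ‖w b‖ ∂P
  have hI : 0 ≤ I := integral_nonneg fun _ => norm_nonneg _
  set D₀ := lam * M * I / δ
  have hD₀ : 0 ≤ D₀ := by positivity
  set ρ := lam * M / (δ + lam * M)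
  have hρ0 : 0 ≤ ρ := by positivity
  have hρ1 : ρ < 1 := by
    rw [div_lt_one (by positivity)]; linarith
  have hn : ∀ n : ℕ, ∀ᵐ a ∂P, ‖w a‖ ≤ Z / δ + ρ ^ n * D₀ := by
    intro n
    induction n with
    | zero =>
      filter_upwards [hz] with a ha
      have h1 := norm_mul_le_of_momentum_le hlam (hκ a) (hκ0 a) (hκM a) hw ha
      have h2 : ∫ b, κ a b * ‖w b‖ ∂P ≤ M * I := by
        rw [← integral_const_mul]
        refine integral_mono (hw.norm.bdd_mul (c := M) (hκ a).aestronglyMeasurable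
          (.of_forall fun b => ?_)) (hw.norm.const_mul _) fun b =>
            mul_le_mul_of_nonneg_right (hκM a b) (norm_nonneg _)
        rw [Real.norm_eq_abs, abs_of_nonneg (hκ0 a b)]; exact hκM a b
      have h3 : 0 ≤ (lam * ∫ b, κ a b ∂P) * ‖w a‖ :=
        mul_nonneg (mul_nonneg hlam.le (integral_nonneg (hκ0 a))) (norm_nonneg _)
      have h4 := mul_le_mul_of_nonneg_left h2 hlam.le
      rw [pow_zero, one_mul, ← add_div, le_div_iff₀ hδ]
      linarith
    | succ n ih =>
      filter_upwards [hz] with a ha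
      rw [pow_succ', mul_assoc]
      exact norm_le_of_momentum_le_of_ae_bound hδ hlam (hκ a) (hκ0 a) (hκM a) hw ha
        (by positivity) ih
  filter_upwards [ae_all_iff.2 hn] with a ha
  have hlim : Filter.Tendsto (fun n : ℕ => Z / δ + ρ ^ n * D₀) Filter.atTop (𝓝 (Z / δ)) := by
    simpa using ((tendsto_pow_atTop_nhds_zero_of_lt_one hρ0 hρ1).mul_const D₀).const_add (Z / δ)
  exact ge_of_tendsto' hlim ha

end MaximumPrinciple

/-! ### Curves with a given velocity -/

variable {d : ℕ} {k : DomainKind} {T : ℝ≥0}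

/-- The curve which starts from `x` with velocity `v`. -/
def curveOf (x : EuclideanSpace ℝ (Fin d)) (v : ℝ → EuclideanSpace ℝ (Fin d))
    (hv : Integrable v (timeMeasure T)) : Curve d k T where
  toFun t := ((x + primitive T v t : EuclideanSpace ℝ (Fin d)) : Domain d k)
  continuous_toFun :=
    continuous_mk.comp ((continuous_const.add (continuous_primitive hv)).comp continuous_subtype_val)

theorem curveOf_pos (x : EuclideanSpace ℝ (Fin d)) {v : ℝ → EuclideanSpace ℝ (Fin d)}
    (hv : Integrable v (timeMeasure T)) (t : ℝ) :
    (curveOf (k := k) x v hv).pos t = ((x + primitive T v t : EuclideanSpace ℝ (Fin d)) : Domain d k) := by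
  rw [← primitive_clamp hv t]
  rfl

theorem curveOf_pos_zero (x : EuclideanSpace ℝ (Fin d)) {v : ℝ → EuclideanSpace ℝ (Fin d)}
    (hv : Integrable v (timeMeasure T)) :
    (curveOf (k := k) x v hv).pos 0 = (x : Domain d k) := by
  rw [curveOf_pos, primitive_zero, add_zero]

theorem curveOf_path (x : EuclideanSpace ℝ (Fin d)) {v : ℝ → EuclideanSpace ℝ (Fin d)}
    (hv : Integrable v (timeMeasure T)) {t : ℝ} (ht : t ∈ Set.Icc (0 : ℝ) T) :
    (curveOf (k := k) x v hv).path t = primitive T v t := by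
  refine Curve.path_eq_of_lift _ (continuous_primitive hv).continuousOn (primitive_zero v)
    (fun t _ => ?_) ht
  rw [curveOf_pos, curveOf_pos_zero, QuotientAddGroup.mk_add]

theorem Curve.ext_pos {γ ω : Curve d k T} (h : ∀ t ∈ Set.Icc (0 : ℝ) T, γ.pos t = ω.pos t) :
    γ = ω := by
  ext t
  have e : Set.projIcc (0 : ℝ) T T.2 (t : ℝ) = t := Set.projIcc_val _ t
  exact (congrArg γ e).symm.trans ((h t t.2).trans (congrArg ω e))

theorem curveOf_congr (x : EuclideanSpace ℝ (Fin d)) {v v' : ℝ → EuclideanSpace ℝ (Fin d)}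
    (hv : Integrable v (timeMeasure T)) (hv' : Integrable v' (timeMeasure T))
    (h : v =ᵐ[timeMeasure T] v') : curveOf (k := k) x v hv = curveOf x v' hv' :=
  Curve.ext_pos fun t _ => by rw [curveOf_pos, curveOf_pos, primitive_congr h]

theorem velocity_curveOf (x : EuclideanSpace ℝ (Fin d)) {v : ℝ → EuclideanSpace ℝ (Fin d)}
    (hv : Integrable v (timeMeasure T)) :
    velocity (curveOf (k := k) x v hv) =ᵐ[timeMeasure T] v := by
  have hT : (0 : ℝ) ≤ T := T.2
  have hvol : IntervalIntegrable v volume 0 T := by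
    rw [intervalIntegrable_iff_integrableOn_Icc_of_le hT]
    exact hv
  have h := hvol.ae_hasDerivAt_integral
  -- Curves are extended by their end points outside `[0,T]`, so the formula for the path holds in a
  -- neighbourhood of `t` only at interior times.
  have h0 : ∀ᵐ t ∂timeMeasure T, t ≠ 0 := by simp [ae_iff, measure_singleton]
  have h1 : ∀ᵐ t ∂timeMeasure T, t ≠ (T : ℝ) := by simp [ae_iff, measure_singleton]
  filter_upwards [ae_restrict_of_ae (s := Set.Icc (0 : ℝ) T) h, ae_mem_timeMeasure, h0, h1]
    with t ht hmem ht0 ht1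
  rw [velocity_eq_deriv]
  have hd := ht (by rwa [Set.uIcc_of_le hT]) 0 Set.left_mem_uIcc
  refine (hd.congr_of_eventuallyEq ?_).deriv
  have hnhds : Set.Icc (0 : ℝ) T ∈ 𝓝 t :=
    Icc_mem_nhds (lt_of_le_of_ne hmem.1 (Ne.symm ht0)) (lt_of_le_of_ne hmem.2 ht1)
  filter_upwards [hnhds] with s hs
  rw [curveOf_path x hv hs, primitive_eq hs]

theorem isH1_curveOf (x : EuclideanSpace ℝ (Fin d)) {v : ℝ → EuclideanSpace ℝ (Fin d)}
    (hv : MemLp v 2 (timeMeasure T)) :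
    IsH1 (curveOf (k := k) x v (memLp_two_integrable hv)) := by
  refine ⟨v, hv, fun t ht => ?_⟩
  rw [curveOf_pos, curveOf_pos_zero, primitive_eq ht, QuotientAddGroup.mk_add]

theorem IsH1.exists_eq_curveOf {γ : Curve d k T} (hγ : IsH1 γ) {x : EuclideanSpace ℝ (Fin d)}
    (hx : (x : Domain d k) = γ.pos 0) :
    ∃ (v : ℝ → EuclideanSpace ℝ (Fin d)) (hv : MemLp v 2 (timeMeasure T)),
      γ = curveOf x v (memLp_two_integrable hv) := by
  obtain ⟨v, hv, h⟩ := hγ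
  refine ⟨v, hv, Curve.ext_pos fun t ht => ?_⟩
  rw [h t ht, curveOf_pos, primitive_eq ht, ← hx, QuotientAddGroup.mk_add]

theorem IsH1.memLp_velocity {γ : Curve d k T} (hγ : IsH1 γ) :
    MemLp (velocity γ) 2 (timeMeasure T) := by
  obtain ⟨x, hx⟩ := QuotientAddGroup.mk_surjective (γ.pos 0)
  obtain ⟨v, hv, rfl⟩ := hγ.exists_eq_curveOf hx
  exact hv.ae_eq (velocity_curveOf x _).symm

theorem IsH1.integrable_velocity {γ : Curve d k T} (hγ : IsH1 γ) :
    Integrable (velocity γ) (timeMeasure T) := memLp_two_integrable hγ.memLp_velocity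

theorem IsH1.eq_curveOf {γ : Curve d k T} (hγ : IsH1 γ) {x : EuclideanSpace ℝ (Fin d)}
    (hx : (x : Domain d k) = γ.pos 0) :
    γ = curveOf x (velocity γ) hγ.integrable_velocity := by
  obtain ⟨v, hv, h⟩ := hγ.exists_eq_curveOf hx
  conv_lhs => rw [h]
  refine curveOf_congr x _ _ ?_
  rw [h]
  exact (velocity_curveOf x _).symm

theorem IsH1.pos_eq {γ : Curve d k T} (hγ : IsH1 γ) {x : EuclideanSpace ℝ (Fin d)}
    (hx : (x : Domain d k) = γ.pos 0) (t : ℝ) :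
    γ.pos t = ((x + primitive T (velocity γ) t : EuclideanSpace ℝ (Fin d)) : Domain d k) := by
  conv_lhs => rw [hγ.eq_curveOf hx]
  rw [curveOf_pos]

theorem isH1_iff {γ : Curve d k T} : IsH1 γ ↔ MemLp (velocity γ) 2 (timeMeasure T) ∧
    ∀ t ∈ Set.Icc (0 : ℝ) T, γ.path t = primitive T (velocity γ) t := by
  refine ⟨fun h => ⟨h.memLp_velocity, fun t ht => ?_⟩, fun ⟨h1, h2⟩ => ⟨_, h1, fun t ht => ?_⟩⟩
  · obtain ⟨x, hx⟩ := QuotientAddGroup.mk_surjective (γ.pos 0)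
    conv_lhs => rw [h.eq_curveOf hx]
    rw [curveOf_path x _ ht]
  · rw [γ.pos_eq_add_path t, h2 t ht, primitive_eq ht]

theorem measurable_velocity_right (γ : Curve d k T) : Measurable (velocity γ) :=
  measurable_velocity.comp measurable_prodMk_left

theorem memLp_two_iff_lintegral {α E : Type*} [MeasurableSpace α] [NormedAddCommGroup E]
    {μ : Measure α} {v : α → E} (hv : AEStronglyMeasurable v μ) :
    MemLp v 2 μ ↔ ∫⁻ t, ‖v t‖ₑ ^ 2 ∂μ < ⊤ := by
  rw [MemLp, and_iff_right hv,
    eLpNorm_lt_top_iff_lintegral_rpow_enorm_lt_top two_ne_zero ENNReal.ofNat_ne_top]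
  simp

theorem measurable_lintegral_velocity :
    Measurable fun γ : Curve d k T => ∫⁻ t, ‖velocity γ t‖ₑ ^ 2 ∂timeMeasure T :=
  Measurable.lintegral_prod_right' (f := fun p : Curve d k T × ℝ => ‖velocity p.1 p.2‖ₑ ^ 2)
    (measurable_velocity.enorm.pow_const 2)

theorem measurable_primitive_velocity (t : ℝ) :
    Measurable fun γ : Curve d k T => primitive T (velocity γ) t := by
  have h : ∀ s : Set ℝ, Measurable fun γ : Curve d k T =>
      ∫ r in s, velocity γ r ∂timeMeasure T := fun s =>
    (StronglyMeasurable.integral_prod_right (f := fun (γ : Curve d k T) r => velocity γ r)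
      measurable_velocity.stronglyMeasurable).measurable
  exact (h _).sub (h _)

/-- By continuity, the identity between the lift and the primitive of its derivative need only be
checked at rational times, clamped to `[0,T]`. -/
theorem measurableSet_isH1 : MeasurableSet {γ : Curve d k T | IsH1 γ} := by
  have hT : (0 : ℝ) ≤ T := T.2
  have hc : ∀ t : ℝ, max 0 (min (T : ℝ) t) ∈ Set.Icc (0 : ℝ) T := fun t =>
    ⟨le_max_left _ _, max_le hT (min_le_left _ _)⟩
  have : {γ : Curve d k T | IsH1 γ} =
      {γ | ∫⁻ t, ‖velocity γ t‖ₑ ^ 2 ∂timeMeasure T < ⊤} ∩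
        ⋂ q : ℚ, {γ | γ.path (max 0 (min (T : ℝ) q)) =
          primitive T (velocity γ) (max 0 (min (T : ℝ) q))} := by
    ext γ
    simp only [Set.mem_ofPred_eq, Set.mem_inter_iff, Set.mem_iInter]
    rw [isH1_iff, memLp_two_iff_lintegral (measurable_velocity_right γ).aestronglyMeasurable]
    refine and_congr_right fun h => ⟨fun h' q => h' _ (hc q), fun h' t ht => ?_⟩
    have hv : MemLp (velocity γ) 2 (timeMeasure T) :=
      (memLp_two_iff_lintegral (measurable_velocity_right γ).aestronglyMeasurable).2 h
    have hclamp : Continuous fun t : ℝ => max 0 (min (T : ℝ) t) := by fun_prop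
    have := Rat.denseRange_cast (𝕜 := ℝ).equalizer
      (γ.continuous_path_right.comp hclamp)
      ((continuous_primitive (memLp_two_integrable hv)).comp hclamp) (funext h')
    have ht' := congrFun this t
    simpa [min_eq_right ht.2, max_eq_right ht.1] using ht'
  rw [this]
  refine (measurableSet_lt measurable_lintegral_velocity measurable_const).inter
    (MeasurableSet.iInter fun q => measurableSet_eq_fun ?_ (measurable_primitive_velocity _))
  exact (continuous_path.comp (Continuous.prodMk_left _)).measurable

theorem IsH1.sub {γ ω : Curve d k T} (hγ : IsH1 γ) (hω : IsH1 ω) :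
    IsH1 (γ - ω) ∧ velocity (γ - ω) =ᵐ[timeMeasure T] velocity γ - velocity ω := by
  obtain ⟨x, hx⟩ := QuotientAddGroup.mk_surjective (γ.pos 0)
  obtain ⟨y, hy⟩ := QuotientAddGroup.mk_surjective (ω.pos 0)
  have hv := hγ.memLp_velocity.sub hω.memLp_velocity
  have : γ - ω = curveOf (x - y) (velocity γ - velocity ω) (memLp_two_integrable hv) := by
    refine Curve.ext_pos fun t _ => ?_
    change γ.pos t - ω.pos t = _
    rw [hγ.pos_eq hx, hω.pos_eq hy, curveOf_pos,
      primitive_sub hγ.integrable_velocity hω.integrable_velocity, ← QuotientAddGroup.mk_sub]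
    congr 1
    abel
  rw [this]
  exact ⟨isH1_curveOf _ hv, velocity_curveOf _ _⟩

end VelocityMFG
end

/-! ### Translation between the game and the abstract problem -/

noncomputable section

namespace VelocityMFG

set_option linter.unusedSectionVars false

variable {d : ℕ} {k : DomainKind} {T : ℝ≥0}

/-! ### The game as a variational problem -/

variable (d k) in
/-- The data of the game, with bounds. -/
structure GameData where
  (δ lam M C c L cΨ : ℝ)
  δ_pos : 0 < δ
  lam_pos : 0 < lam
  C_nonneg : 0 ≤ C
  c_nonneg : 0 ≤ c
  L_nonneg : 0 ≤ L
  cΨ_nonneg : 0 ≤ cΨ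
  η : Domain d k → ℝ
  Ψ : Domain d k → ℝ
  continuous_η : Continuous η
  η_pos : ∀ x, 0 < η x
  η_le : ∀ x, η x ≤ M
  η_le_exp : ∀ x (h : EuclideanSpace ℝ (Fin d)), η (x + (h : Domain d k)) ≤ Real.exp (C * ‖h‖) * η x
  η_semiconvex : ∀ x (h : EuclideanSpace ℝ (Fin d)),
    2 * η x - c * ‖h‖ ^ 2 ≤ η (x + (h : Domain d k)) + η (x - (h : Domain d k))
  Ψ_lip : ∀ y y' : EuclideanSpace ℝ (Fin d), |Ψ y - Ψ y'| ≤ L * ‖y - y'‖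
  Ψ_semiconvex : ∀ y h : EuclideanSpace ℝ (Fin d),
    2 * Ψ y - cΨ * ‖h‖ ^ 2 ≤ Ψ (y + h : EuclideanSpace ℝ (Fin d)) +
      Ψ (y - h : EuclideanSpace ℝ (Fin d))

theorem lintegral_enorm_sq {α E : Type*} [MeasurableSpace α] [NormedAddCommGroup E]
    {μ : Measure α} {v : α → E} (hv : MemLp v 2 μ) :
    ∫⁻ t, ‖v t‖ₑ ^ 2 ∂μ = ENNReal.ofReal (∫ t, ‖v t‖ ^ 2 ∂μ) := by
  rw [ofReal_integral_eq_lintegral_ofReal hv.norm.integrable_sq (.of_forall fun _ => sq_nonneg _)]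
  refine lintegral_congr fun t => ?_
  rw [ENNReal.ofReal_pow (norm_nonneg _), ofReal_norm]

theorem kineticEnergy_eq {γ : Curve d k T} (hγ : IsH1 γ) :
    kineticEnergy γ = ENNReal.ofReal (1 / 2 * ∫ t, ‖velocity γ t‖ ^ 2 ∂timeMeasure T) := by
  rw [kineticEnergy, if_pos hγ, lintegral_enorm_sq hγ.memLp_velocity,
    ENNReal.ofReal_mul (by norm_num)]
  congr 1
  rw [one_div, one_div, ENNReal.ofReal_inv_of_pos two_pos]
  simp

namespace GameData

variable (D : GameData d k)

theorem cost_eq_top {Q : Measure (Curve d k T)} {γ : Curve d k T} (hγ : ¬ IsH1 γ) :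
    cost D.δ D.lam D.η D.Ψ Q γ = ⊤ := by
  -- Positivity of `δ` matters, as `0 * ⊤ = 0`.
  rw [cost, kineticEnergy, if_neg hγ, ENNReal.mul_top (by simpa using D.δ_pos), top_add,
    EReal.coe_ennreal_top, EReal.top_add_coe]

theorem continuous_Ψ : Continuous D.Ψ := by
  have h : LipschitzWith D.L.toNNReal fun y : EuclideanSpace ℝ (Fin d) => D.Ψ y :=
    LipschitzWith.of_dist_le_mul fun y y' => by
      rw [Real.dist_eq, dist_eq_norm, Real.coe_toNNReal _ D.L_nonneg]
      exact D.Ψ_lip y y'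
  exact isCoveringMap_mk.isQuotientMap QuotientAddGroup.mk_surjective |>.continuous_iff.2
    h.continuous

/-- Coercivity, with the negative part of `Ψ` evaluated at the initial point, whose law `m₀` is
known, and not at the final one. -/
theorem toENNReal_cost_ge {Q : Measure (Curve d k T)} {γ : Curve d k T} (hγ : IsH1 γ) :
    ENNReal.ofReal (D.δ / 4 * ∫ t, ‖velocity γ t‖ ^ 2 ∂timeMeasure T) ≤
      (cost D.δ D.lam D.η D.Ψ Q γ).toENNReal +
        (ENNReal.ofReal (max (-D.Ψ (γ.pos 0)) 0) + ENNReal.ofReal (D.L ^ 2 * T / D.δ)) := by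
  set K := ∫ t, ‖velocity γ t‖ ^ 2 ∂timeMeasure T with hK
  obtain ⟨x, hx⟩ := QuotientAddGroup.mk_surjective (γ.pos 0)
  have h1 : ENNReal.ofReal (D.δ / 2 * K + D.Ψ (γ.pos T)) ≤
      (cost D.δ D.lam D.η D.Ψ Q γ).toENNReal := by
    have : ((D.δ / 2 * K + D.Ψ (γ.pos T) : ℝ) : EReal) ≤ cost D.δ D.lam D.η D.Ψ Q γ := by
      rw [EReal.coe_add, cost]
      refine add_le_add ?_ le_rfl
      have h2 : ENNReal.ofReal (D.δ / 2 * K) ≤ ENNReal.ofReal D.δ * kineticEnergy γ +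
          ENNReal.ofReal D.lam * ∫⁻ ω, interaction D.η γ ω ∂Q := by
        refine le_trans (le_of_eq ?_) le_self_add
        rw [kineticEnergy_eq hγ, ← ENNReal.ofReal_mul D.δ_pos.le]
        congr 1
        ring
      refine le_trans ?_ (EReal.coe_ennreal_le_coe_ennreal_iff.2 h2)
      rw [EReal.coe_ennreal_ofReal]
      exact EReal.coe_le_coe_iff.2 (le_max_left _ _)
    have h3 := EReal.toENNReal_le_toENNReal this
    rwa [EReal.toENNReal_of_ne_top (EReal.coe_ne_top _), EReal.toReal_coe] at h3
  have h4 : D.δ / 4 * K ≤ (D.δ / 2 * K + D.Ψ (γ.pos T)) +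
      (max (-D.Ψ (γ.pos 0)) 0 + D.L ^ 2 * T / D.δ) := by
    have h5 := mul_norm_primitive_le D.L hγ.memLp_velocity T (ε := D.δ / 4)
      (by linarith [D.δ_pos])
    rw [show 4 * (D.δ / 4) = D.δ by ring, ← hK] at h5
    have h6 := (abs_le.1 (D.Ψ_lip (x + primitive T (velocity γ) T) x)).1
    rw [add_sub_cancel_left, ← hγ.pos_eq hx, hx] at h6
    have h7 := le_max_left (-D.Ψ (γ.pos 0)) 0
    linarith
  refine (ENNReal.ofReal_le_ofReal h4).trans (ENNReal.ofReal_add_le.trans ?_)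
  exact add_le_add h1 ENNReal.ofReal_add_le

/-- The properties of equilibria in the form in which they are used. -/
structure IsSolution (Q : Measure (Curve d k T)) : Prop where
  isProbabilityMeasure : IsProbabilityMeasure Q
  ae_isH1 : ∀ᵐ ω ∂Q, IsH1 ω
  memLp : MemLp (fun p : Curve d k T × ℝ => velocity p.1 p.2) 2 (Q.prod (timeMeasure T))
  ae_optimal : ∀ᵐ ω ∂Q, IsOptimalFrom D.δ D.lam D.η D.Ψ Q (ω.pos 0) ω

/-- Finite total cost forces almost every curve into `H¹`; coercivity and the integrability of the
negative part of `Ψ` under `m₀` then give finite total kinetic energy. The support has full measure,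
so almost every curve is optimal. -/
theorem isSolution_of_isEquilibrium {m₀ : Measure (Domain d k)}
    (hm₀ : Integrable (fun x => max (-D.Ψ x) 0) m₀)
    {Q : Measure (Curve d k T)} [IsProbabilityMeasure Q]
    (h : IsEquilibrium D.δ D.lam D.η D.Ψ m₀ Q) : D.IsSolution Q := by
  have hev : Measurable fun γ : Curve d k T => γ.pos 0 :=
    (continuous_pos.comp (Continuous.prodMk_left (0 : ℝ))).measurable
  have hH1 : ∀ᵐ ω ∂Q, IsH1 ω := by
    rw [ae_iff]
    by_contra hne
    have h1 : ∫⁻ γ, {γ : Curve d k T | ¬ IsH1 γ}.indicator (fun _ => (⊤ : ℝ≥0∞)) γ ∂Q ≤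
        ∫⁻ γ, (cost D.δ D.lam D.η D.Ψ Q γ).toENNReal ∂Q := by
      refine lintegral_mono fun γ => ?_
      refine Set.indicator_apply_le' (fun hγ => ?_) (fun _ => zero_le)
      rw [D.cost_eq_top hγ, EReal.toENNReal_top]
    rw [lintegral_indicator (show MeasurableSet {γ : Curve d k T | ¬ IsH1 γ} from
      measurableSet_isH1.compl), lintegral_const, Measure.restrict_apply_univ, ENNReal.top_mul hne] at h1
    exact absurd h.finite_cost (not_lt.2 h1)
  refine ⟨inferInstance, hH1, ?_, ?_⟩
  · rw [memLp_two_iff_lintegral measurable_velocity.aestronglyMeasurable,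
      lintegral_prod _ (measurable_velocity.enorm.pow_const 2).aemeasurable]
    have hΨ : ∫⁻ γ, ENNReal.ofReal (max (-D.Ψ (Curve.pos γ 0)) 0) ∂Q < ⊤ := by
      have h1 : Integrable (fun γ : Curve d k T => max (-D.Ψ (γ.pos 0)) 0) Q := by
        have := hm₀
        rw [← h.initial] at this
        exact (integrable_map_measure this.aestronglyMeasurable hev.aemeasurable).1 this
      have h2 := h1.lintegral_lt_top
      exact h2
    have hδ : ENNReal.ofReal (D.δ / 4) ≠ 0 := by
      simpa using D.δ_pos
    have h3 : ENNReal.ofReal (D.δ / 4) *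
        ∫⁻ γ, ∫⁻ t, ‖velocity γ t‖ₑ ^ 2 ∂timeMeasure T ∂Q < ⊤ := by
      rw [← lintegral_const_mul _ measurable_lintegral_velocity]
      calc _ ≤ ∫⁻ γ, ((cost D.δ D.lam D.η D.Ψ Q γ).toENNReal +
            (ENNReal.ofReal (max (-D.Ψ (γ.pos 0)) 0) + ENNReal.ofReal (D.L ^ 2 * T / D.δ))) ∂Q := by
            refine lintegral_mono_ae ?_
            filter_upwards [hH1] with γ hγ
            rw [lintegral_enorm_sq hγ.memLp_velocity,
              ← ENNReal.ofReal_mul (by linarith [D.δ_pos])]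
            exact D.toENNReal_cost_ge hγ
        _ ≤ ∫⁻ γ, (cost D.δ D.lam D.η D.Ψ Q γ).toENNReal ∂Q +
            ∫⁻ γ, (ENNReal.ofReal (max (-D.Ψ (γ.pos 0)) 0) +
              ENNReal.ofReal (D.L ^ 2 * T / D.δ)) ∂Q := by
            refine (lintegral_add_right _ ?_).le
            refine Measurable.add (Measurable.ennreal_ofReal ?_) measurable_const
            refine Measurable.max (Measurable.neg ?_) measurable_const
            exact D.continuous_Ψ.measurable.comp hev
        _ < ⊤ := by
            rw [lintegral_add_right _ measurable_const, lintegral_const, measure_univ, mul_one]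
            exact ENNReal.add_lt_top.2 ⟨h.finite_cost, ENNReal.add_lt_top.2
              ⟨hΨ, ENNReal.ofReal_lt_top⟩⟩
    exact (ENNReal.mul_lt_top_iff.1 h3).elim (fun h => h.2) fun h =>
      h.elim (fun h => absurd h hδ) fun h => h ▸ ENNReal.zero_lt_top
  · filter_upwards [Measure.support_mem_ae (μ := Q)] with γ hγ
    refine ⟨rfl, fun ω hω => ?_⟩
    rw [h.optimal γ hγ]
    exact iInf₂_le ω hω

section Solution

variable {D} {Q : Measure (Curve d k T)} (hQ : D.IsSolution Q)

/-- The variational problem of an agent in the population `Q`. -/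
def IsSolution.toInteraction : InteractionData (EuclideanSpace ℝ (Fin d)) (Curve d k T) T where
  P := Q
  isProbabilityMeasure := hQ.isProbabilityMeasure
  δ := D.δ
  lam := D.lam
  M := D.M
  C := D.C
  c := D.c
  L := D.L
  cΨ := D.cΨ
  δ_pos := D.δ_pos
  lam_pos := D.lam_pos
  C_nonneg := D.C_nonneg
  c_nonneg := D.c_nonneg
  L_nonneg := D.L_nonneg
  cΨ_nonneg := D.cΨ_nonneg
  N p y := D.η ((y : Domain d k) - Curve.pos p.1 p.2)
  measurable_N := by
    refine Continuous.measurable ?_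
    exact D.continuous_η.comp ((continuous_mk.comp continuous_snd).sub
      (continuous_pos.comp continuous_fst))
  N_pos _ _ := D.η_pos _
  N_le _ _ := D.η_le _
  N_le_exp p y y' := by
    have := D.η_le_exp ((y' : Domain d k) - Curve.pos p.1 p.2) (y - y')
    rwa [QuotientAddGroup.mk_sub, show (y' : Domain d k) - Curve.pos p.1 p.2 +
      ((y : Domain d k) - y') = (y : Domain d k) - Curve.pos p.1 p.2 by abel] at this
  N_semiconvex p y h := by
    have := D.η_semiconvex ((y : Domain d k) - Curve.pos p.1 p.2) h
    rwa [sub_add_eq_add_sub, sub_right_comm, ← QuotientAddGroup.mk_add,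
      ← QuotientAddGroup.mk_sub] at this
  w p := velocity p.1 p.2
  memLp_w := hQ.memLp
  Ψ y := D.Ψ y
  Ψ_lip := D.Ψ_lip
  Ψ_semiconvex := D.Ψ_semiconvex

/-- Almost every `ω` is in `H¹`, so `γ - ω` is too and its velocity is the difference of the
velocities; Tonelli's theorem turns the iterated integral into one over the product. -/
theorem IsSolution.lintegral_interaction {γ : Curve d k T} (hγ : IsH1 γ)
    {x : EuclideanSpace ℝ (Fin d)} (hx : (x : Domain d k) = γ.pos 0) :
    ∫⁻ ω, interaction D.η γ ω ∂Q = ENNReal.ofReal (1 / 2 *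
      hQ.toInteraction.inter (fun t => x + primitive T (velocity γ) t) (velocity γ)) := by
  have := hQ.isProbabilityMeasure
  set G := hQ.toInteraction with hG
  have hi := G.integrable_inter (InteractionData.measurable_curve hγ.memLp_velocity x)
    hγ.memLp_velocity
  have h1 : ∀ᵐ ω ∂Q, interaction D.η γ ω = ENNReal.ofReal (1 / 2) * ∫⁻ t,
      ENNReal.ofReal (G.N (ω, t) (x + primitive T (velocity γ) t) *
        ‖velocity γ t - G.w (ω, t)‖ ^ 2) ∂timeMeasure T := by
    filter_upwards [hQ.ae_isH1] with ω hω
    obtain ⟨h2, h3⟩ := hγ.sub hω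
    rw [interaction, if_pos h2]
    congr 1
    · rw [one_div, one_div, ENNReal.ofReal_inv_of_pos two_pos]
      simp
    · refine lintegral_congr_ae ?_
      filter_upwards [h3] with t ht
      rw [ht, hγ.pos_eq hx, mul_comm, ENNReal.ofReal_mul (G.N_pos _ _).le,
        ENNReal.ofReal_pow (norm_nonneg _), ofReal_norm]
      rfl
  rw [lintegral_congr_ae h1, lintegral_const_mul' _ _ ENNReal.ofReal_ne_top,
    ENNReal.ofReal_mul (by norm_num), InteractionData.inter,
    ofReal_integral_eq_lintegral_ofReal hi
      (.of_forall fun p => mul_nonneg (G.N_pos _ _).le (sq_nonneg _))]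
  congr 1
  exact (lintegral_prod _ hi.aestronglyMeasurable.aemeasurable.ennreal_ofReal).symm

theorem IsSolution.cost_eq {γ : Curve d k T} (hγ : IsH1 γ)
    {x : EuclideanSpace ℝ (Fin d)} (hx : (x : Domain d k) = γ.pos 0) :
    cost D.δ D.lam D.η D.Ψ Q γ = ((hQ.toInteraction.J x (velocity γ) : ℝ) : EReal) := by
  have h0 : 0 ≤ ∫ t, ‖velocity γ t‖ ^ 2 ∂timeMeasure T := integral_nonneg fun _ => sq_nonneg _
  have h1 := hQ.toInteraction.inter_nonneg (fun t => x + primitive T (velocity γ) t) (velocity γ)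
  have h2 := D.δ_pos
  have h3 := D.lam_pos
  rw [cost, kineticEnergy_eq hγ, hQ.lintegral_interaction hγ hx, ← ENNReal.ofReal_mul h2.le,
    ← ENNReal.ofReal_mul h3.le, ← ENNReal.ofReal_add (by positivity) (by positivity),
    EReal.coe_ennreal_ofReal, max_eq_left (by positivity), ← EReal.coe_add, hγ.pos_eq hx]
  congr 1
  simp only [InteractionData.J]
  change _ = D.δ / 2 * _ + D.lam / 2 * _ + D.Ψ _
  ring

theorem IsSolution.cost_curveOf (x : EuclideanSpace ℝ (Fin d)) {v : ℝ → EuclideanSpace ℝ (Fin d)}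
    (hv : MemLp v 2 (timeMeasure T)) :
    cost D.δ D.lam D.η D.Ψ Q (curveOf x v (memLp_two_integrable hv)) =
      ((hQ.toInteraction.J x v : ℝ) : EReal) := by
  rw [hQ.cost_eq (isH1_curveOf x hv) (x := x) (curveOf_pos_zero x _).symm]
  have h := velocity_curveOf (k := k) x (memLp_two_integrable hv)
  congr 1
  simp only [InteractionData.J, primitive_congr h]
  congr 2
  · congr 1
    refine integral_congr_ae ?_
    filter_upwards [h] with t ht
    rw [ht]
  · congr 1
    refine integral_congr_ae ?_
    have h' := (measurePreserving_snd (μ := hQ.toInteraction.P)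
      (ν := timeMeasure T)).quasiMeasurePreserving.ae h
    filter_upwards [h'] with p hp
    rw [hp]

theorem IsSolution.isOptimalFrom_curveOf {x : EuclideanSpace ℝ (Fin d)}
    {v : ℝ → EuclideanSpace ℝ (Fin d)} (hv : hQ.toInteraction.IsMin x v) :
    IsOptimalFrom D.δ D.lam D.η D.Ψ Q (x : Domain d k)
      (curveOf x v (memLp_two_integrable hv.1)) := by
  refine ⟨curveOf_pos_zero x _, fun ω hω => ?_⟩
  by_cases hH : IsH1 ω
  · rw [hQ.cost_curveOf x hv.1, hQ.cost_eq hH hω.symm]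
    exact EReal.coe_le_coe_iff.2 (hv.2 _ hH.memLp_velocity)
  · rw [D.cost_eq_top hH]
    exact le_top

theorem IsSolution.isMin_of_isOptimalFrom {x : EuclideanSpace ℝ (Fin d)} {γ : Curve d k T}
    (hγ : IsOptimalFrom D.δ D.lam D.η D.Ψ Q (x : Domain d k) γ) :
    IsH1 γ ∧ hQ.toInteraction.IsMin x (velocity γ) := by
  have hH : IsH1 γ := by
    by_contra h
    have h1 := hγ.2 (curveOf x 0 (memLp_two_integrable MemLp.zero)) (curveOf_pos_zero x _)
    rw [D.cost_eq_top h, hQ.cost_curveOf x MemLp.zero, top_le_iff] at h1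
    exact EReal.coe_ne_top _ h1
  refine ⟨hH, hH.memLp_velocity, fun v hv => ?_⟩
  have h1 := hγ.2 (curveOf x v (memLp_two_integrable hv)) (curveOf_pos_zero x _)
  rw [hQ.cost_curveOf x hv, hQ.cost_eq hH hγ.1.symm] at h1
  exact EReal.coe_le_coe_iff.1 h1

theorem IsSolution.integrable_velocity_ae (hQ : D.IsSolution Q) :
    ∀ᵐ t ∂timeMeasure T, Integrable (fun ω : Curve d k T => velocity ω t) Q :=
  have := hQ.isProbabilityMeasure
  (hQ.memLp.integrable one_le_two).prod_left_ae

theorem measurable_weight (D : GameData d k) (γ : Curve d k T) (t : ℝ) :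
    Measurable fun ω : Curve d k T => D.η (γ.pos t - ω.pos t) :=
  (D.continuous_η.comp (continuous_const.sub
    (continuous_pos.comp (Continuous.prodMk_left t)))).measurable

/-- The local mass is positive and cancels the normalisation of the mean velocity. The momentum
takes the form required by the maximum principle. -/
theorem IsSolution.momentum_eq (hQ : D.IsSolution Q) (γ : Curve d k T) {t : ℝ}
    (ht : Integrable (fun ω : Curve d k T => velocity ω t) Q) :
    momentum D.δ D.lam D.η Q γ t = D.δ • velocity γ t +
      D.lam • ∫ ω, D.η (γ.pos t - ω.pos t) • (velocity γ t - velocity ω t) ∂Q := by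
  have := hQ.isProbabilityMeasure
  have hκm := D.measurable_weight γ t
  have hb : ∀ᵐ ω ∂Q, ‖D.η (γ.pos t - Curve.pos ω t)‖ ≤ D.M := .of_forall fun ω => by
    rw [Real.norm_eq_abs, abs_of_pos (D.η_pos _)]; exact D.η_le _
  have i1 : Integrable (fun ω : Curve d k T => D.η (γ.pos t - ω.pos t)) Q :=
    Integrable.of_bound hκm.aestronglyMeasurable D.M hb
  have i2 : Integrable (fun ω : Curve d k T => D.η (γ.pos t - ω.pos t) • velocity ω t) Q :=
    ht.bdd_smul D.M hκm.aestronglyMeasurable hb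
  have ha : 0 < localMass D.η Q t (γ.pos t) := by
    refine (integral_pos_iff_support_of_nonneg (fun _ => (D.η_pos _).le) i1).2 ?_
    rw [Function.support_eq_univ fun _ => (D.η_pos _).ne']
    simp
  rw [momentum, meanVelocity, smul_sub, smul_smul, mul_assoc, mul_inv_cancel₀ ha.ne', mul_one]
  simp only [smul_sub]
  rw [integral_sub (i1.smul_const _) i2, integral_smul_const, smul_sub, smul_smul]
  rfl

theorem IsSolution.momentum_ae_eq {x : EuclideanSpace ℝ (Fin d)} {γ : Curve d k T}
    (hγ : IsH1 γ) (hx : (x : Domain d k) = γ.pos 0) :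
    ∀ᵐ t ∂timeMeasure T, momentum D.δ D.lam D.η Q γ t = hQ.toInteraction.z x (velocity γ) t := by
  filter_upwards [hQ.integrable_velocity_ae] with t ht
  rw [hQ.momentum_eq γ ht, InteractionData.z]
  change _ = D.δ • velocity γ t + D.lam • ∫ ω, D.η (((x + primitive T (velocity γ) t :
    EuclideanSpace ℝ (Fin d)) : Domain d k) - ω.pos t) • (velocity γ t - velocity ω t) ∂Q
  rw [← hγ.pos_eq hx]

end Solution

end GameData

end VelocityMFG
end

/-! ### Estimates for equilibria and the short-time results -/

noncomputable section

namespace VelocityMFG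

set_option linter.unusedSectionVars false

variable {d : ℕ} {k : DomainKind} {T : ℝ≥0}

namespace GameData

variable {D : GameData d k} {Q : Measure (Curve d k T)}

/-! ### Bounds on momenta and velocities -/

variable (D Q) in
/-- The momenta of all optimal curves are bounded by `Z` after time `s`. -/
def MomentumBound (s Z : ℝ) : Prop :=
  ∀ γ : Curve d k T, IsOptimalFrom D.δ D.lam D.η D.Ψ Q (γ.pos 0) γ →
    ∀ᵐ t ∂timeMeasure T, s ≤ t → ‖momentum D.δ D.lam D.η Q γ t‖ ≤ Z

theorem IsSolution.norm_momentum_le (hQ : D.IsSolution Q) {γ : Curve d k T}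
    {x : EuclideanSpace ℝ (Fin d)} (hγ : IsOptimalFrom D.δ D.lam D.η D.Ψ Q x γ) (s : ℝ) :
    ∀ᵐ t ∂timeMeasure T, s ≤ t → ‖momentum D.δ D.lam D.η Q γ t‖ ≤
      D.L + D.lam / 2 * D.C * hQ.toInteraction.interFrom s
        (fun t => x + primitive T (velocity γ) t) (velocity γ) := by
  obtain ⟨hH, hmin⟩ := hQ.isMin_of_isOptimalFrom hγ
  filter_upwards [hQ.momentum_ae_eq hH hγ.1.symm, hmin.norm_z_le _ s] with t h1 h2 hs
  rw [h1]
  exact h2 hs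

theorem momentumSup_le {Z : ℝ} (h : MomentumBound D Q 0 Z) :
    momentumSup D.δ D.lam D.η D.Ψ Q ≤ ENNReal.ofReal Z := by
  refine iSup₂_le fun γ hγ => ?_
  rw [eLpNorm_exponent_top]
  refine eLpNormEssSup_le_of_ae_bound ?_
  filter_upwards [h γ hγ, ae_mem_timeMeasure] with t h1 h2
  exact h1 h2.1

/-- The momentum estimate from time `0`, with the interaction energy bounded by comparison with
rest. The bound may depend on `Q`; only its finiteness matters here. -/
theorem IsSolution.momentumSup_lt_top (hQ : D.IsSolution Q) :
    momentumSup D.δ D.lam D.η D.Ψ Q < ⊤ := by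
  set G := hQ.toInteraction
  refine (momentumSup_le (Z := D.L + D.C * (G.lam / 2 * (G.M * ∫ p, ‖G.w p‖ ^ 2 ∂G.prodMeasure) +
    G.L ^ 2 * T / G.δ)) fun γ hγ => ?_).trans_lt ENNReal.ofReal_lt_top
  obtain ⟨x, hx⟩ := QuotientAddGroup.mk_surjective (γ.pos 0)
  rw [← hx] at hγ
  obtain ⟨hH, hmin⟩ := hQ.isMin_of_isOptimalFrom hγ
  filter_upwards [hQ.norm_momentum_le hγ 0] with t ht h0
  refine (ht h0).trans ?_
  have h1 := G.interFrom_le_inter 0 (InteractionData.measurable_curve hmin.1 x) hmin.1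
  have h2 := hmin.inter_le
  have h3 := mul_le_mul_of_nonneg_left h1 (half_pos D.lam_pos).le
  have h4 := mul_le_mul_of_nonneg_left (h3.trans h2) D.C_nonneg
  linarith

theorem momentumBound_of_lt_top (h : momentumSup D.δ D.lam D.η D.Ψ Q < ⊤) (s : ℝ) :
    MomentumBound D Q s (momentumSup D.δ D.lam D.η D.Ψ Q).toReal := by
  intro γ hγ
  have h1 : eLpNorm (momentum D.δ D.lam D.η Q γ) ⊤ (timeMeasure T) ≤
      momentumSup D.δ D.lam D.η D.Ψ Q := le_iSup₂ (f := fun (γ : Curve d k T)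
        (_ : IsOptimalFrom D.δ D.lam D.η D.Ψ Q (γ.pos 0) γ) =>
          eLpNorm (momentum D.δ D.lam D.η Q γ) ⊤ (timeMeasure T)) γ hγ
  rw [eLpNorm_exponent_top] at h1
  filter_upwards [ae_le_eLpNormEssSup (f := momentum D.δ D.lam D.η Q γ)
    (μ := timeMeasure T)] with t ht _
  have h2 := ENNReal.toReal_mono h.ne (ht.trans h1)
  rwa [toReal_enorm] at h2

theorem measurable_momentum (D : GameData d k) [IsProbabilityMeasure Q] :
    Measurable fun p : Curve d k T × ℝ => momentum D.δ D.lam D.η Q p.1 p.2 := by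
  have hη : Measurable fun q : (Curve d k T × ℝ) × Curve d k T =>
      D.η (Curve.pos q.1.1 q.1.2 - Curve.pos q.2 q.1.2) := by
    refine Continuous.measurable (D.continuous_η.comp (Continuous.sub ?_ ?_))
    · exact continuous_pos.comp continuous_fst
    · exact continuous_pos.comp (continuous_snd.prodMk (continuous_snd.comp continuous_fst))
  have hv : Measurable fun q : (Curve d k T × ℝ) × Curve d k T => velocity q.2 q.1.2 :=
    measurable_velocity.comp (measurable_snd.prodMk (measurable_snd.comp measurable_fst))
  have ha : Measurable fun p : Curve d k T × ℝ => localMass D.η Q p.2 (Curve.pos p.1 p.2) :=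
    (StronglyMeasurable.integral_prod_right (ν := Q)
      (f := fun (p : Curve d k T × ℝ) ω => D.η (Curve.pos p.1 p.2 - Curve.pos ω p.2))
      hη.stronglyMeasurable).measurable
  have hb : Measurable fun p : Curve d k T × ℝ =>
      ∫ ω, D.η (Curve.pos p.1 p.2 - Curve.pos ω p.2) • velocity ω p.2 ∂Q :=
    (StronglyMeasurable.integral_prod_right (ν := Q)
      (f := fun (p : Curve d k T × ℝ) ω =>
        D.η (Curve.pos p.1 p.2 - Curve.pos ω p.2) • velocity ω p.2)
      (hη.smul hv).stronglyMeasurable).measurable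
  exact (measurable_velocity.const_smul D.δ).add ((ha.const_mul D.lam).smul
    (measurable_velocity.sub (ha.inv.smul hb)))

theorem IsSolution.ae_velocity_le (hQ : D.IsSolution Q) {s Z : ℝ}
    (h : MomentumBound D Q s Z) :
    ∀ᵐ t ∂timeMeasure T, ∀ᵐ ω ∂Q, s ≤ t → ‖velocity ω t‖ ≤ Z / D.δ := by
  have := hQ.isProbabilityMeasure
  have h1 : ∀ᵐ ω ∂Q, ∀ᵐ t ∂timeMeasure T, s ≤ t → ‖momentum D.δ D.lam D.η Q ω t‖ ≤ Z := by
    filter_upwards [hQ.ae_optimal] with ω hω using h ω hω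
  have hm : MeasurableSet {p : Curve d k T × ℝ | s ≤ p.2 →
      ‖momentum D.δ D.lam D.η Q p.1 p.2‖ ≤ Z} :=
    MeasurableSet.imp (measurableSet_le measurable_const measurable_snd)
      (measurableSet_le D.measurable_momentum.norm measurable_const)
  -- The maximum principle acts at a fixed time, across the population, so the order of the two
  -- almost-everywhere quantifiers is exchanged; this uses joint measurability of the momentum.
  rw [Measure.ae_ae_comm (p := fun (ω : Curve d k T) t => s ≤ t →
    ‖momentum D.δ D.lam D.η Q ω t‖ ≤ Z) hm] at h1
  filter_upwards [h1, hQ.integrable_velocity_ae] with t ht hi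
  by_cases hst : s ≤ t
  · have := ae_norm_le_of_momentum_le D.δ_pos D.lam_pos (P := Q) (Z := Z)
      (κ := fun a b : Curve d k T => D.η (a.pos t - b.pos t)) (M := D.M)
      (fun a => D.measurable_weight a t) (fun _ _ => (D.η_pos _).le) (fun _ _ => D.η_le _) hi ?_
    · filter_upwards [this] with ω hω _ using hω
    · filter_upwards [ht] with ω hω
      rw [← hQ.momentum_eq ω hi]
      exact hω hst
  · exact .of_forall fun _ h => absurd h hst

theorem IsSolution.ae_prod_velocity_le (hQ : D.IsSolution Q) {s Z : ℝ}
    (h : MomentumBound D Q s Z) :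
    ∀ᵐ p ∂hQ.toInteraction.prodMeasure, s ≤ p.2 → ‖hQ.toInteraction.w p‖ ≤ Z / D.δ := by
  have := hQ.isProbabilityMeasure
  have hm : MeasurableSet {p : Curve d k T × ℝ | s ≤ p.2 → ‖velocity p.1 p.2‖ ≤ Z / D.δ} :=
    MeasurableSet.imp (measurableSet_le measurable_const measurable_snd)
      (measurableSet_le measurable_velocity.norm measurable_const)
  refine (Measure.ae_prod_iff_ae_ae hm).2 ?_
  exact (Measure.ae_ae_comm (p := fun (ω : Curve d k T) t => s ≤ t → ‖velocity ω t‖ ≤ Z / D.δ)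
    hm).2 (hQ.ae_velocity_le h)

/-- An optimal curve need not be one of those followed by the population. The population bound with
excess `0` still transfers to it through its own momentum. -/
theorem IsSolution.optimal_velocity_le (hQ : D.IsSolution Q) {s Z : ℝ}
    (h : MomentumBound D Q s Z) {γ : Curve d k T}
    (hγ : IsOptimalFrom D.δ D.lam D.η D.Ψ Q (γ.pos 0) γ) :
    ∀ᵐ t ∂timeMeasure T, s ≤ t → ‖velocity γ t‖ ≤ Z / D.δ := by
  have := hQ.isProbabilityMeasure
  filter_upwards [hQ.ae_velocity_le h, hQ.integrable_velocity_ae, h γ hγ] with t h1 h2 h3 hst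
  have h4 := norm_le_of_momentum_le_of_ae_bound D.δ_pos D.lam_pos (P := Q) (Z := Z) (M := D.M)
    (D.measurable_weight γ t) (fun _ => (D.η_pos _).le) (fun _ => D.η_le _) h2
    (u := velocity γ t) (by rw [← hQ.momentum_eq γ h2]; exact h3 hst) (D := 0) le_rfl
    (by filter_upwards [h1] with ω hω; rw [add_zero]; exact hω hst)
  simpa using h4

/-- Backward induction from `T` in steps of length `h`. The a priori bound `Z` only determines how
small `h` must be, while the smallness of `T` involves the data alone; this is why the conclusion is
uniform in `Q`. -/
theorem IsSolution.momentumBound_short (hQ : D.IsSolution Q)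
    (hT : D.lam / 2 * D.C * D.M * (4 * (D.L + 1) / D.δ) ^ 2 * T ≤ (D.L + 1) / 2) :
    MomentumBound D Q 0 (2 * (D.L + 1)) := by
  have hL := D.L_nonneg
  have hδ := D.δ_pos
  have hlam := D.lam_pos
  have hC := D.C_nonneg
  have hM : 0 < D.M := hQ.toInteraction.M_pos
  set L' := D.L + 1 with hL'
  set κ := D.lam / 2 * D.C * D.M with hκ
  have hκ0 : 0 ≤ κ := by positivity
  have hfin := hQ.momentumSup_lt_top
  set Z := (momentumSup D.δ D.lam D.η D.Ψ Q).toReal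
  have hZ : ∀ s, MomentumBound D Q s Z := momentumBound_of_lt_top hfin
  -- Of the allowance `2L' ≥ L + L'`, one half of `L'` covers the energy after `s₁`, by the
  -- hypothesis on `T`, and the other half covers the new strip of length `h`, where relative
  -- velocities are at most `2Z/δ`. Using `L + 1` in place of `L` keeps `h` positive when `L = 0`.
  set h := L' / 2 / (κ * (2 * Z / D.δ) ^ 2 + 1)
  have hh : 0 < h := by positivity
  have hκh : κ * (2 * Z / D.δ) ^ 2 * h ≤ L' / 2 := by
    rw [mul_div_assoc', div_le_iff₀ (by positivity)]
    nlinarith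
  have key : ∀ n : ℕ, MomentumBound D Q (T - n * h) (2 * L') := by
    intro n
    induction n with
    | zero =>
      -- After time `T` only the null set `{T}` remains.
      intro γ _
      have h1 : ∀ᵐ t ∂timeMeasure T, t ≠ (T : ℝ) := by simp [ae_iff, measure_singleton]
      filter_upwards [h1, ae_mem_timeMeasure] with t h2 h3 h4
      simp only [CharP.cast_eq_zero, zero_mul, sub_zero] at h4
      exact absurd (le_antisymm h3.2 h4) h2
    | succ n ih =>
      intro γ hγ
      set s₁ := (T : ℝ) - n * h
      have hs : (T : ℝ) - ((n + 1 : ℕ) : ℝ) * h = s₁ - h := by push_cast; ring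
      rw [hs]
      obtain ⟨x, hx⟩ := QuotientAddGroup.mk_surjective (γ.pos 0)
      have hγx := hγ
      rw [← hx] at hγx
      obtain ⟨hH, hmin⟩ := hQ.isMin_of_isOptimalFrom hγx
      have qmp := (measurePreserving_snd (μ := hQ.toInteraction.P)
        (ν := timeMeasure T)).quasiMeasurePreserving
      have hbd := hQ.toInteraction.interFrom_le (InteractionData.measurable_curve hmin.1 x) hmin.1
        (s₀ := s₁ - h) (s₁ := s₁) (R₁ := 4 * L' / D.δ) (R := 2 * Z / D.δ) (by linarith) ?_ ?_
      · filter_upwards [hQ.norm_momentum_le hγx (s₁ - h)] with t ht hst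
        refine (ht hst).trans ?_
        have h1 := mul_le_mul_of_nonneg_left hbd (show 0 ≤ D.lam / 2 * D.C by positivity)
        have h2 : D.lam / 2 * D.C * (hQ.toInteraction.M * ((4 * L' / D.δ) ^ 2 * T +
            (2 * Z / D.δ) ^ 2 * (s₁ - (s₁ - h)))) =
            κ * (4 * L' / D.δ) ^ 2 * T + κ * (2 * Z / D.δ) ^ 2 * h := by
          rw [hκ]
          change D.lam / 2 * D.C * (D.M * _) = _
          ring
        linarith
      · filter_upwards [hQ.ae_prod_velocity_le ih, qmp.ae (hQ.optimal_velocity_le ih hγ)]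
          with p h1 h2 hp
        refine (norm_sub_le _ _).trans ((add_le_add (h2 hp) (h1 hp)).trans (le_of_eq ?_))
        ring
      · filter_upwards [hQ.ae_prod_velocity_le (hZ 0), qmp.ae (hQ.optimal_velocity_le (hZ 0) hγ),
          hQ.toInteraction.ae_mem_prodMeasure] with p h1 h2 hp
        refine (norm_sub_le _ _).trans ((add_le_add (h2 hp.1) (h1 hp.1)).trans (le_of_eq ?_))
        ring
  intro γ hγ
  obtain ⟨n, hn⟩ := exists_nat_ge ((T : ℝ) / h)
  rw [div_le_iff₀ hh] at hn
  filter_upwards [key n γ hγ] with t ht h0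
  exact ht (by linarith)

/-! ### Uniqueness and pure strategies for short times -/

/-- The time up to which optimal curves are unique if the momenta are bounded by `Z`. -/
def shortTime (δ lam κ cΨ : ℝ) (Z : ℝ≥0) : ℝ≥0 :=
  Real.toNNReal (min 1 (δ / 2 / (lam / 2 * (κ * (4 * (Z / δ) ^ 2)) + cΨ + 1)))

theorem shortTime_pos {δ lam κ cΨ : ℝ} (hδ : 0 < δ) (hlam : 0 < lam) (hκ : 0 ≤ κ) (hc : 0 ≤ cΨ)
    (Z : ℝ≥0) : 0 < shortTime δ lam κ cΨ Z :=
  Real.toNNReal_pos.2 (lt_min one_pos (by positivity))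

theorem shortTime_antitone {δ lam κ cΨ : ℝ} (hδ : 0 < δ) (hlam : 0 < lam) (hκ : 0 ≤ κ)
    (hc : 0 ≤ cΨ) : Antitone (shortTime δ lam κ cΨ) := by
  intro Z Z' h
  refine Real.toNNReal_le_toNNReal (min_le_min le_rfl ?_)
  have : (Z : ℝ) ≤ Z' := h
  gcongr

/-- The minimum with `1` reduces the condition, quadratic in `T`, to a linear one; the summand `1`
keeps the denominator of `shortTime` positive. -/
theorem le_of_lt_shortTime {δ lam κ cΨ : ℝ} (hlam : 0 < lam) (hκ : 0 ≤ κ)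
    (hc : 0 ≤ cΨ) {Z : ℝ≥0} (h : T < shortTime δ lam κ cΨ Z) :
    (lam / 2 * (κ * (4 * (Z / δ) ^ 2 * T)) + cΨ) * T ≤ δ / 2 := by
  have h1 : (T : ℝ) < min 1 (δ / 2 / (lam / 2 * (κ * (4 * (Z / δ) ^ 2)) + cΨ + 1)) := by
    have := Real.lt_toNNReal_iff_coe_lt.1 h
    exact this
  obtain ⟨h2, h3⟩ := lt_min_iff.1 h1
  rw [lt_div_iff₀ (by positivity)] at h3
  have hT : (0 : ℝ) ≤ T := T.2
  have h4 : 0 ≤ lam / 2 * (κ * (4 * (Z / δ) ^ 2)) := by positivity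
  have h5 : lam / 2 * (κ * (4 * (Z / δ) ^ 2)) * T ≤ lam / 2 * (κ * (4 * (Z / δ) ^ 2)) :=
    mul_le_of_le_one_right h4 h2.le
  have h6 := mul_le_mul_of_nonneg_right h5 hT
  nlinarith

theorem IsSolution.existsUnique_optimal (hQ : D.IsSolution Q) {R : ℝ}
    (hw : ∀ᵐ p ∂hQ.toInteraction.prodMeasure, ‖hQ.toInteraction.w p‖ ≤ R)
    (hR : ∀ γ : Curve d k T, IsOptimalFrom D.δ D.lam D.η D.Ψ Q (γ.pos 0) γ →
      ∀ᵐ t ∂timeMeasure T, ‖velocity γ t‖ ≤ R)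
    (hT : (D.lam / 2 * (hQ.toInteraction.semiconvexity * (4 * R ^ 2 * T)) + D.cΨ) * T ≤ D.δ / 2)
    (x₀ : Domain d k) : ∃! γ : Curve d k T, IsOptimalFrom D.δ D.lam D.η D.Ψ Q x₀ γ := by
  obtain ⟨x, rfl⟩ := QuotientAddGroup.mk_surjective x₀
  obtain ⟨v, hv⟩ := hQ.toInteraction.exists_isMin x
  refine ⟨_, hQ.isOptimalFrom_curveOf hv, fun γ hγ => ?_⟩
  obtain ⟨hH, hmin⟩ := hQ.isMin_of_isOptimalFrom hγ
  have hopt := hQ.isOptimalFrom_curveOf hv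
  have hv' : ∀ᵐ t ∂timeMeasure T, ‖v t‖ ≤ R := by
    have h1 := hR _ (by rw [curveOf_pos_zero]; exact hopt)
    filter_upwards [h1, velocity_curveOf (k := k) x (memLp_two_integrable hv.1)] with t h2 h3
    rwa [← h3]
  have hγ' := hR γ (by rw [hγ.1]; exact hγ)
  rw [hH.eq_curveOf hγ.1.symm]
  exact curveOf_congr x _ _ (hmin.ae_eq _ hv hγ' hv' hw hT)

/-- Stability in `L²` of the velocities controls the primitives uniformly in time. It is proved for
lifted starting points and descends to `Ω` by the quotient map. -/
theorem IsSolution.continuous_strategy (hQ : D.IsSolution Q) {R : ℝ}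
    (hw : ∀ᵐ p ∂hQ.toInteraction.prodMeasure, ‖hQ.toInteraction.w p‖ ≤ R)
    (hR : ∀ γ : Curve d k T, IsOptimalFrom D.δ D.lam D.η D.Ψ Q (γ.pos 0) γ →
      ∀ᵐ t ∂timeMeasure T, ‖velocity γ t‖ ≤ R)
    (hT : (D.lam / 2 * (hQ.toInteraction.semiconvexity * (4 * R ^ 2 * T)) + D.cΨ) * T ≤ D.δ / 2)
    {S : Domain d k → Curve d k T}
    (hS : ∀ x, IsOptimalFrom D.δ D.lam D.η D.Ψ Q x (S x)) : Continuous S := by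
  refine (isCoveringMap_mk.isQuotientMap QuotientAddGroup.mk_surjective).continuous_iff.2 ?_
  set v : EuclideanSpace ℝ (Fin d) → ℝ → EuclideanSpace ℝ (Fin d) :=
    fun e => velocity (S (e : Domain d k)) with hv
  have hmin : ∀ e : EuclideanSpace ℝ (Fin d),
      IsH1 (S (e : Domain d k)) ∧ hQ.toInteraction.IsMin e (v e) := fun e =>
    hQ.isMin_of_isOptimalFrom (hS e)
  have hbd : ∀ e : EuclideanSpace ℝ (Fin d), ∀ᵐ t ∂timeMeasure T, ‖v e t‖ ≤ R := fun e => hR _ (by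
    rw [(hS e).1]; exact hS e)
  have hcont : Continuous fun p : EuclideanSpace ℝ (Fin d) × ℝ => primitive T (v p.1) p.2 := by
    refine continuous_iff_continuousAt.2 fun ⟨e₀, t₀⟩ => ?_
    set G := hQ.toInteraction
    set B := G.lam / 2 * (G.M * ∫ p, ‖G.w p‖ ^ 2 ∂G.prodMeasure) + G.L ^ 2 * T / G.δ
    -- The modulus obtained from the stability estimate and `‖∫v‖² ≤ T∫‖v‖²`; it vanishes at `0`.
    let ρ : ℝ → ℝ := fun a => √(T * (8 / G.δ * (2 * ((Real.exp (G.C * a) - 1) * B + G.L * a))))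
    have hρ : Continuous ρ := by fun_prop
    have hdist : ∀ p : EuclideanSpace ℝ (Fin d) × ℝ,
        dist (primitive T (v p.1) p.2) (primitive T (v e₀) t₀) ≤
          ρ ‖p.1 - e₀‖ + dist (primitive T (v e₀) p.2) (primitive T (v e₀) t₀) := by
      intro p
      refine (dist_triangle _ (primitive T (v e₀) p.2) _).trans (add_le_add ?_ le_rfl)
      rw [dist_eq_norm, ← primitive_sub (hmin _).1.integrable_velocity
        (hmin _).1.integrable_velocity]
      refine Real.le_sqrt_of_sq_le ((norm_primitive_sq_le ((hmin _).2.1.sub (hmin _).2.1) _).trans ?_)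
      refine mul_le_mul_of_nonneg_left ?_ T.2
      have h1 := (hmin p.1).2.integral_sub_sq_le G (hmin e₀).2 (hbd _) (hbd _) hw hT
      have h2 : 0 < G.δ := G.δ_pos
      rw [div_mul_eq_mul_div, le_div_iff₀ h2]
      simp only [Pi.sub_apply]
      change G.δ / 8 * _ ≤ 2 * ((Real.exp (G.C * ‖p.1 - e₀‖) - 1) * B + _) at h1
      have h3 : ∀ I J : ℝ, G.δ / 8 * I ≤ 2 * J → I * G.δ ≤ 8 * (2 * J) := fun I J h => by linarith
      exact h3 _ _ h1
    refine tendsto_iff_dist_tendsto_zero.2 (squeeze_zero (fun _ => dist_nonneg) hdist ?_)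
    have h1 : Continuous fun p : EuclideanSpace ℝ (Fin d) × ℝ => ρ ‖p.1 - e₀‖ +
        dist (primitive T (v e₀) p.2) (primitive T (v e₀) t₀) := by
      have := continuous_primitive (hmin e₀).1.integrable_velocity
      exact (hρ.comp (by fun_prop)).add ((this.comp continuous_snd).dist continuous_const)
    have h2 := h1.tendsto (e₀, t₀)
    simpa [ρ] using h2
  refine ContinuousMap.continuous_of_continuous_uncurry _ ?_
  have h1 : (Function.uncurry fun (e : EuclideanSpace ℝ (Fin d)) (t : Set.Icc (0 : ℝ) T) =>
      (S ∘ ((↑) : EuclideanSpace ℝ (Fin d) → Domain d k)) e t) = fun p =>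
      ((p.1 + primitive T (v p.1) p.2 : EuclideanSpace ℝ (Fin d)) : Domain d k) := by
    funext p
    have h2 := (hmin p.1).1.pos_eq (hS p.1).1.symm p.2
    exact (congrArg (S p.1) (Set.projIcc_val T.2 p.2)).symm.trans h2
  rw [h1]
  exact continuous_mk.comp (continuous_fst.add
    (hcont.comp (continuous_fst.prodMk (continuous_subtype_val.comp continuous_snd))))

/-- Almost every curve is optimal from its starting point, so by uniqueness it equals `S (ω(0))`;
pushing `Q` forward through the starting point gives back `Q`. -/
theorem IsSolution.isPureStrategy (hQ : D.IsSolution Q) {m₀ : Measure (Domain d k)}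
    (hm₀ : Q.map (fun γ => Curve.pos γ 0) = m₀) {R : ℝ}
    (hw : ∀ᵐ p ∂hQ.toInteraction.prodMeasure, ‖hQ.toInteraction.w p‖ ≤ R)
    (hR : ∀ γ : Curve d k T, IsOptimalFrom D.δ D.lam D.η D.Ψ Q (γ.pos 0) γ →
      ∀ᵐ t ∂timeMeasure T, ‖velocity γ t‖ ≤ R)
    (hT : (D.lam / 2 * (hQ.toInteraction.semiconvexity * (4 * R ^ 2 * T)) + D.cΨ) * T ≤ D.δ / 2) :
    IsPureStrategy D.δ D.lam D.η D.Ψ m₀ Q := by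
  choose S hS hS' using hQ.existsUnique_optimal hw hR hT
  have hSm : Measurable S := (hQ.continuous_strategy hw hR hT hS).measurable
  have hev : Measurable fun γ : Curve d k T => γ.pos 0 :=
    (continuous_pos.comp (Continuous.prodMk_left (0 : ℝ))).measurable
  refine ⟨S, hSm, hS, ?_⟩
  rw [← hm₀, Measure.map_map hSm hev]
  conv_lhs => rw [← Measure.map_id (μ := Q)]
  refine Measure.map_congr ?_
  filter_upwards [hQ.ae_optimal] with ω hω
  exact hS' _ ω hω

end GameData

/-! ### The bounds on the data -/

/-- The logarithm of `f` is Lipschitz with constant `C`. -/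
theorem le_exp_mul_of_gradient_le {f : EuclideanSpace ℝ (Fin d) → ℝ} {C : ℝ} (hf : Differentiable ℝ f)
    (hpos : ∀ y, 0 < f y) (hC : ∀ y, ‖gradient f y‖ ≤ C * f y) (y y' : EuclideanSpace ℝ (Fin d)) :
    f y ≤ Real.exp (C * ‖y - y'‖) * f y' := by
  have h1 : ∀ y ∈ Set.univ, DifferentiableAt ℝ (fun y => Real.log (f y)) y := fun y _ =>
    (hf y).log (hpos y).ne'
  have h2 : ∀ y ∈ Set.univ, ‖fderiv ℝ (fun y => Real.log (f y)) y‖ ≤ C := by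
    intro y _
    rw [fderiv.log (hf y) (hpos y).ne', norm_smul, norm_inv, Real.norm_eq_abs,
      abs_of_pos (hpos y), inv_mul_le_iff₀ (hpos y), mul_comm]
    have := hC y
    rwa [gradient, LinearIsometryEquiv.norm_map] at this
  have h3 := convex_univ.norm_image_sub_le_of_norm_fderiv_le h1 h2 (Set.mem_univ y')
    (Set.mem_univ y)
  have h4 := (le_abs_self _).trans h3
  calc f y = Real.exp (Real.log (f y)) := (Real.exp_log (hpos y)).symm
    _ ≤ Real.exp (C * ‖y - y'‖ + Real.log (f y')) := Real.exp_le_exp.2 (by linarith)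
    _ = _ := by rw [Real.exp_add, Real.exp_log (hpos y')]

theorem SemiconvexWith.midpoint {f : EuclideanSpace ℝ (Fin d) → ℝ} {c : ℝ} (hf : SemiconvexWith c f)
    (y h : EuclideanSpace ℝ (Fin d)) : 2 * f y - max c 0 * ‖h‖ ^ 2 ≤ f (y + h) + f (y - h) := by
  have hf' : ConvexOn ℝ Set.univ fun x => f x + c / 2 * ‖x‖ ^ 2 := hf
  have h1 := hf'.2 (Set.mem_univ (y + h)) (Set.mem_univ (y - h))
    (show (0 : ℝ) ≤ 1 / 2 by norm_num) (show (0 : ℝ) ≤ 1 / 2 by norm_num) (by norm_num)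
  have h2 : (1 / 2 : ℝ) • (y + h) + (1 / 2 : ℝ) • (y - h) = y := by module
  rw [h2] at h1
  simp only [smul_eq_mul] at h1
  have h3 := parallelogram_law_with_norm ℝ y h
  have h4 : c * ‖h‖ ^ 2 ≤ max c 0 * ‖h‖ ^ 2 :=
    mul_le_mul_of_nonneg_right (le_max_left _ _) (sq_nonneg _)
  have h5 : c / 2 * (‖y + h‖ ^ 2 + ‖y - h‖ ^ 2) = c * ‖y‖ ^ 2 + c * ‖h‖ ^ 2 := by
    rw [show ‖y + h‖ ^ 2 + ‖y - h‖ ^ 2 = 2 * (‖y‖ ^ 2 + ‖h‖ ^ 2) by nlinarith]; ring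
  linarith

end VelocityMFG
end

/-! ### Assembly of the two parts -/

theorem mainTheorem6 (d : ℕ) (k : VelocityMFG.DomainKind) (δ lam : ℝ) (hδ : 0 < δ) (hlam : 0 < lam)
    (η : VelocityMFG.Domain d k → ℝ)
    (hη_pos : ∀ x, 0 < η x)
    (hη_bdd : ∃ M : ℝ, ∀ x, η x ≤ M)
    (hη_C1 : ContDiff ℝ 1 (VelocityMFG.lift η))
    (hη_lip : ∃ K : ℝ≥0, LipschitzWith K (VelocityMFG.lift η))
    (hη_grad : ∃ C : ℝ, ∀ y, ‖gradient (VelocityMFG.lift η) y‖ ≤ C * VelocityMFG.lift η y)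
    (hη_semi : ∃ c : ℝ, VelocityMFG.SemiconvexWith c (VelocityMFG.lift η))
    (cΨ : ℝ) :
    ∃ T₀ : ℝ≥0 → ℝ≥0, (∀ Z, 0 < T₀ Z) ∧
      ∀ Ψ : VelocityMFG.Domain d k → ℝ,
        ContDiff ℝ 1 (VelocityMFG.lift Ψ) →
        (∃ K : ℝ≥0, LipschitzWith K (VelocityMFG.lift Ψ)) →
        VelocityMFG.SemiconvexWith cΨ (VelocityMFG.lift Ψ) →
        (∀ (T : ℝ≥0), 0 < T →
          ∀ (m₀ : Measure (VelocityMFG.Domain d k)) (_ : IsProbabilityMeasure m₀),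
          Integrable (fun x => max (-Ψ x) 0) m₀ →
          ∀ (Q : Measure (VelocityMFG.Curve d k T)) (_ : IsProbabilityMeasure Q),
          VelocityMFG.IsEquilibrium δ lam η Ψ m₀ Q →
            VelocityMFG.momentumSup δ lam η Ψ Q < ⊤ ∧
            (T < T₀ (VelocityMFG.momentumSup δ lam η Ψ Q).toNNReal →
              (∀ x₀ : VelocityMFG.Domain d k,
                ∃! γ : VelocityMFG.Curve d k T, VelocityMFG.IsOptimalFrom δ lam η Ψ Q x₀ γ) ∧
              VelocityMFG.IsPureStrategy δ lam η Ψ m₀ Q)) ∧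
        (∃ T₁ : ℝ≥0, 0 < T₁ ∧ ∀ (T : ℝ≥0), 0 < T → T < T₁ →
          ∀ (m₀ : Measure (VelocityMFG.Domain d k)) (_ : IsProbabilityMeasure m₀),
          Integrable (fun x => max (-Ψ x) 0) m₀ →
          ∀ (Q : Measure (VelocityMFG.Curve d k T)) (_ : IsProbabilityMeasure Q),
          VelocityMFG.IsEquilibrium δ lam η Ψ m₀ Q →
            T < T₀ (VelocityMFG.momentumSup δ lam η Ψ Q).toNNReal) := by
  open VelocityMFG in
  obtain ⟨M, hM⟩ := hη_bdd
  obtain ⟨C, hC⟩ := hη_grad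
  obtain ⟨c, hc⟩ := hη_semi
  have hM0 : 0 < M := (hη_pos 0).trans_le (hM 0)
  -- This is the `semiconvexity` constant of the data. It involves only `η`, so the function `T₀`
  -- below is fixed before `Ψ`. Positive parts of `c`, `C` and `cΨ` are taken because no sign is
  -- given.
  set κ := max c 0 + 8 * M * max C 0 ^ 2 with hκ
  have hκ0 : 0 ≤ κ := add_nonneg (le_max_right _ _) (by positivity)
  have hcΨ : 0 ≤ max cΨ 0 := le_max_right _ _
  refine ⟨GameData.shortTime δ lam κ (max cΨ 0),
    GameData.shortTime_pos hδ hlam hκ0 hcΨ, fun Ψ _ hΨL hΨs => ?_⟩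
  obtain ⟨K, hK⟩ := hΨL
  have hexp : ∀ y y' : EuclideanSpace ℝ (Fin d),
      VelocityMFG.lift η y ≤ Real.exp (max C 0 * ‖y - y'‖) * VelocityMFG.lift η y' :=
    le_exp_mul_of_gradient_le (hη_C1.differentiable one_ne_zero) (fun y => hη_pos _) fun y =>
      (hC y).trans (mul_le_mul_of_nonneg_right (le_max_left _ _) (hη_pos _).le)
  let D : GameData d k :=
    { δ := δ, lam := lam, M := M, C := max C 0, c := max c 0, L := K, cΨ := max cΨ 0
      δ_pos := hδ, lam_pos := hlam, C_nonneg := le_max_right _ _, c_nonneg := le_max_right _ _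
      L_nonneg := K.2, cΨ_nonneg := hcΨ, η := η, Ψ := Ψ
      continuous_η := (isCoveringMap_mk.isQuotientMap
        QuotientAddGroup.mk_surjective).continuous_iff.2 hη_C1.continuous
      η_pos := hη_pos, η_le := hM
      η_le_exp := fun x h => by
        obtain ⟨y, rfl⟩ := QuotientAddGroup.mk_surjective x
        have := hexp (y + h) y
        rwa [add_sub_cancel_left] at this
      η_semiconvex := fun x h => by
        obtain ⟨y, rfl⟩ := QuotientAddGroup.mk_surjective x
        exact hc.midpoint y h
      Ψ_lip := fun y y' => by
        have := hK.dist_le_mul y y'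
        rwa [Real.dist_eq, dist_eq_norm] at this
      Ψ_semiconvex := hΨs.midpoint }
  refine ⟨fun T _ m₀ _ hm₀ Q _ hE => ?_, ?_⟩
  · have hQ : D.IsSolution Q := D.isSolution_of_isEquilibrium hm₀ hE
    have hfin : momentumSup δ lam η Ψ Q < ⊤ := hQ.momentumSup_lt_top
    refine ⟨hfin, fun hT => ?_⟩
    have hb : GameData.MomentumBound D Q 0 (momentumSup δ lam η Ψ Q).toNNReal :=
      GameData.momentumBound_of_lt_top (D := D) hfin 0
    have hT' := GameData.le_of_lt_shortTime hlam hκ0 hcΨ hT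
    have hw : ∀ᵐ p ∂hQ.toInteraction.prodMeasure, ‖hQ.toInteraction.w p‖ ≤
        (momentumSup δ lam η Ψ Q).toNNReal / δ := by
      filter_upwards [hQ.ae_prod_velocity_le hb, hQ.toInteraction.ae_mem_prodMeasure]
        with p h1 h2 using h1 h2.1
    have hR : ∀ γ : Curve d k T, IsOptimalFrom D.δ D.lam D.η D.Ψ Q (γ.pos 0) γ →
        ∀ᵐ t ∂timeMeasure T, ‖velocity γ t‖ ≤ (momentumSup δ lam η Ψ Q).toNNReal / δ := by
      intro γ hγ
      filter_upwards [hQ.optimal_velocity_le hb hγ, ae_mem_timeMeasure] with t h1 h2 using h1 h2.1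
    exact ⟨hQ.existsUnique_optimal hw hR hT', hQ.isPureStrategy hE.initial hw hR hT'⟩
  · set L' : ℝ≥0 := 2 * (K + 1)
    set B : ℝ := lam / 2 * max C 0 * M * (4 * (K + 1) / δ) ^ 2 with hB
    have hB0 : 0 ≤ B := by positivity
    -- The first bound on `T` allows `momentumBound_short` and yields `‖z‖_∞ ≤ 2(K+1)`; the second
    -- is `T₀` at that value, which is at most `T₀(‖z‖_∞)` since `T₀` is antitone.
    refine ⟨min (Real.toNNReal (((K : ℝ) + 1) / 2 / (B + 1)))
      (GameData.shortTime δ lam κ (max cΨ 0) L'), lt_min (Real.toNNReal_pos.2 (by positivity))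
        (GameData.shortTime_pos hδ hlam hκ0 hcΨ _), fun T _ hT m₀ _ hm₀ Q _ hE => ?_⟩
    have hQ : D.IsSolution Q := D.isSolution_of_isEquilibrium hm₀ hE
    obtain ⟨hT1, hT2⟩ := lt_min_iff.1 hT
    have h1 : (T : ℝ) < ((K : ℝ) + 1) / 2 / (B + 1) := Real.lt_toNNReal_iff_coe_lt.1 hT1
    have h2 : B * T ≤ ((K : ℝ) + 1) / 2 := by
      rw [lt_div_iff₀ (by positivity)] at h1
      have : (0 : ℝ) ≤ T := T.2
      linarith
    have h3 := GameData.momentumSup_le (hQ.momentumBound_short h2)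
    have h4 : (momentumSup δ lam η Ψ Q).toNNReal ≤ L' := by
      have h5 : (2 * (D.L + 1) : ℝ) = ((L' : ℝ≥0) : ℝ) := by simp [D, L']
      rw [h5, ENNReal.ofReal_coe_nnreal] at h3
      exact (ENNReal.toNNReal_mono ENNReal.coe_ne_top h3).trans_eq (ENNReal.toNNReal_coe _)
    exact hT2.trans_le (GameData.shortTime_antitone hδ hlam hκ0 hcΨ h4)
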